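/- Let $\mathbb{K}$ be a field of characteristic $0$ (for instance $\mathbb{K}=\mathbb{C}((\hbar))$), let $0\le k\le n$ and $N\ge 0$ be integers, and let $\lambda_{k+1},\dots,\lambda_n\in\mathbb{K}\setminus\{0,1\}$. Put $K=\mathbb{K}[q_1,\dots,q_k,z_{k+1},\dots,z_n]$ and let $\gamma$ be the algebra automorphism of $K$ with $\gamma(q_i)=q_i$ and $\gamma(z_j)=\lambda_jz_j$. Let $W_{k,n-k,N}=\mathrm{Der}_{\mathbb{K}}(K)\ltimes\mathfrak{gl}_N(K)$ be the semidirect product Lie algebra in which derivations act on matrices entrywise, and let $W^\gamma_{k,n-k,N}$ be the Lie subalgebra of its $\gamma$-invariant elements (the pairs $(D,M)$ with $\gamma D\gamma^{-1}=D$ and $\gamma(M_{st})=M_{st}$ for all $s,t$). Let $$\mathfrak{h}_1\cong\mathfrak{gl}_k\oplus\mathfrak{gl}_{i_1}\oplus\cdots\oplus\mathfrak{gl}_{i_l}\oplus\mathfrak{gl}_N\subset W^\gamma_{k,n-k,N}$$ be the subalgebra spanned by the vector fields $q_i\,\partial/\partial q_{i'}$, the vector fields $z_j\,\partial/\partial z_{j'}$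 with $\lambda_j=\lambda_{j'}$, and the constant matrices; thus $i_1,\dots,i_l$ are the multiplicities of the distinct values among the $\lambda_j$. For a Lie algebra $\mathfrak{g}$ with a subalgebra $\mathfrak{h}$, let $H^\bullet(\mathfrak{g},\mathfrak{h};\mathbb{K})$ be the cohomology of the complex of $\mathfrak{h}$-invariant alternating forms on $\mathfrak{g}$ that vanish when one of the arguments is in $\mathfrak{h}$, with the Chevalley–Eilenberg differential. Let $(S^q\mathfrak{h}^*)^{\mathfrak{h}}$ be the space of $\mathfrak{h}$-invariant symmetric $q$-linear forms on $\mathfrak{h}$. For an $\mathfrak{h}$-invariant projection $\mathrm{pr}:\mathfrak{g}\to\mathfrak{h}$ with curvature $C(u,v)=[\mathrm{pr}\,u,\mathrm{pr}\,v]-\mathrm{pr}[u,v]$ and for $P\in(S^q\mathfrak{h}^*)^{\mathfrak{h}}$ put $$\chi_{\mathrm{pr}}(P)(v_1,\dots,v_{2q})=\frac1{q!}\sum_{\substack{\sigma\in S_{2q}\\ \sigma(2i-1)<\sigma(2i)}}(-1)^\sigma P\big(C(v_{\sigma(1)},v_{\sigma(2)}),\dots,C(v_{\sigma(2q-1)},v_{\sigma(2q)})\big).$$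 Then for $\mathfrak{g}=W^\gamma_{k,n-k,N}$ and $\mathfrak{h}=\mathfrak{h}_1$ an $\mathfrak{h}_1$-invariant projection exists, and for every $q\le k$ the Chern–Weil homomorphism $$\chi:(S^q\mathfrak{h}_1^*)^{\mathfrak{h}_1}\to H^{2q}(W^\gamma_{k,n-k,N},\mathfrak{h}_1;\mathbb{K}),\qquad P\mapsto[\chi_{\mathrm{pr}}(P)],$$ is well defined (each $\chi_{\mathrm{pr}}(P)$ is a relative cocycle, and its class does not depend on the $\mathfrak{h}_1$-invariant projection $\mathrm{pr}$), linear and injective. -/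

import Mathlib

open scoped Nat

noncomputable section

/-! ### Relative Lie algebra cohomology with trivial coefficients -/

namespace RelLie

variable {𝕂 : Type*} [Field 𝕂] {g : Type*} [LieRing g] [LieAlgebra 𝕂 g]

/-- The Chevalley--Eilenberg differential with trivial coefficients. For `i < j` the bracket
`⁅x i, x j⁆` is put in the place of `x j` and `x i` is left out. Moving the bracket to the front
costs the sign `(-1) ^ (j - 1)`, so this is the usual
`(dω)(x₀, …, x_p) = ∑_{i < j} (-1) ^ (i + j) ω([x_i, x_j], x₀, …, x̂_i, …, x̂_j, …, x_p)`. -/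
def ceDiff (p : ℕ) : (g [⋀^Fin p]→ₗ[𝕂] 𝕂) →ₗ[𝕂] ((Fin (p + 1) → g) → 𝕂) where
  toFun ω x := ∑ i : Fin (p + 1), ∑ j : Fin (p + 1), if i < j then
    (-1) ^ ((i : ℕ) + 1) * ω (fun l => Function.update x j ⁅x i, x j⁆ (i.succAbove l)) else 0
  map_add' ω η := by
    funext x
    simp only [Pi.add_apply, ← Finset.sum_add_distrib]
    refine Finset.sum_congr rfl fun i _ => Finset.sum_congr rfl fun j _ => ?_
    split_ifs
    · rw [AlternatingMap.add_apply, mul_add]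
    · simp
  map_smul' c ω := by
    funext x
    simp only [Pi.smul_apply, smul_eq_mul, RingHom.id_apply, Finset.mul_sum]
    refine Finset.sum_congr rfl fun i _ => Finset.sum_congr rfl fun j _ => ?_
    split_ifs
    · rw [AlternatingMap.smul_apply, smul_eq_mul]; ring
    · simp

variable (h : LieSubalgebra 𝕂 g)

/-- `C^p(g, h; 𝕂)`: the alternating `p`-forms on `g` that vanish as soon as one of the arguments
lies in `h`, and that are invariant under the action of `h`. -/
def relCochain (p : ℕ) : Submodule 𝕂 (g [⋀^Fin p]→ₗ[𝕂] 𝕂) where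
  carrier := {ω | (∀ v : Fin p → g, (∃ i, v i ∈ h) → ω v = 0) ∧
    ∀ x ∈ h, ∀ v : Fin p → g, ∑ i, ω (Function.update v i ⁅x, v i⁆) = 0}
  add_mem' {a b} ha hb := by
    refine ⟨fun v hv => ?_, fun x hx v => ?_⟩
    · rw [AlternatingMap.add_apply, ha.1 v hv, hb.1 v hv, add_zero]
    · simp only [AlternatingMap.add_apply, Finset.sum_add_distrib, ha.2 x hx v, hb.2 x hx v,
        add_zero]
  zero_mem' := ⟨fun _ _ => rfl, fun _ _ _ => by simp⟩
  smul_mem' c a ha := by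
    refine ⟨fun v hv => ?_, fun x hx v => ?_⟩
    · rw [AlternatingMap.smul_apply, ha.1 v hv, smul_zero]
    · simp only [AlternatingMap.smul_apply, ← Finset.smul_sum, ha.2 x hx v, smul_zero]

/-- `Z^p(g, h; 𝕂)`: the closed relative cochains. -/
def relCocycle (p : ℕ) : Submodule 𝕂 (g [⋀^Fin p]→ₗ[𝕂] 𝕂) :=
  relCochain h p ⊓ LinearMap.ker (ceDiff p)

/-- `B^p(g, h; 𝕂)`: the differentials of relative cochains of degree `p - 1`. -/
def relCoboundary : (p : ℕ) → Submodule 𝕂 (g [⋀^Fin p]→ₗ[𝕂] 𝕂)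
  | 0 => ⊥
  | p + 1 =>
    { carrier := {ω | ∃ η ∈ relCochain h p, ∀ x : Fin (p + 1) → g, ceDiff p η x = ω x}
      add_mem' := by
        rintro a b ⟨η, hη, hη'⟩ ⟨θ, hθ, hθ'⟩
        refine ⟨η + θ, Submodule.add_mem _ hη hθ, fun x => ?_⟩
        simp [hη' x, hθ' x]
      zero_mem' := ⟨0, Submodule.zero_mem _, fun x => by simp⟩
      smul_mem' := by
        rintro c a ⟨η, hη, hη'⟩
        refine ⟨c • η, Submodule.smul_mem _ c hη, fun x => ?_⟩
        simp [hη' x] }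

/-- `H^p(g, h; 𝕂) = Z^p / B^p`, relative Lie algebra cohomology with trivial coefficients: the
image of the cocycles in the quotient of the space of all forms by the coboundaries. -/
abbrev relCohomology (p : ℕ) : Type _ :=
  (relCocycle h p).map (relCoboundary h p).mkQ

/-- The cohomology class of a relative cocycle. -/
def cohomologyClass (p : ℕ) : relCocycle h p →ₗ[𝕂] relCohomology h p :=
  (relCoboundary h p).mkQ.submoduleMap (relCocycle h p)

/-! ### The Chern--Weil homomorphism -/

/-- `(S^q h^*)^h`: the `h`-invariant homogeneous polynomials of degree `q` on `h`, as invariant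
symmetric `q`-linear forms (their complete polarizations). -/
def invPoly (q : ℕ) : Submodule 𝕂 (MultilinearMap 𝕂 (fun _ : Fin q => h) 𝕂) where
  carrier := {P | (∀ (σ : Equiv.Perm (Fin q)) (v : Fin q → h), P (fun i => v (σ i)) = P v) ∧
    ∀ (x : h) (v : Fin q → h), ∑ i, P (Function.update v i ⁅x, v i⁆) = 0}
  add_mem' {a b} ha hb := by
    refine ⟨fun σ v => ?_, fun x v => ?_⟩
    · rw [add_apply, add_apply, ha.1 σ v, hb.1 σ v]
    · simp only [add_apply, Finset.sum_add_distrib, ha.2 x v, hb.2 x v, add_zero]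
  zero_mem' := ⟨fun _ _ => rfl, fun _ _ => by simp⟩
  smul_mem' c a ha := by
    refine ⟨fun σ v => ?_, fun x v => ?_⟩
    · rw [smul_apply, smul_apply, ha.1 σ v]
    · simp only [smul_apply, ← Finset.smul_sum, ha.2 x v, smul_zero]

variable {h}

/-- `pr : g → h` is an `h`-invariant projection: it is the identity on `h` and commutes with the
action of `h`. -/
def IsInvariantProjection (pr : g →ₗ[𝕂] h) : Prop :=
  (∀ x : h, pr (x : g) = x) ∧ ∀ (x : h) (y : g), pr ⁅(x : g), y⁆ = ⁅x, pr y⁆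

/-- The curvature `C(u ∧ v) = [pr u, pr v] - pr [u, v]` of a projection. -/
def curvature (pr : g →ₗ[𝕂] h) (u v : g) : h :=
  ⁅pr u, pr v⁆ - pr ⁅u, v⁆

/-- The Chern--Weil form
`χ(P)(v₁ ∧ ⋯ ∧ v_{2q}) = 1/q! ∑_σ sign(σ) P(C(v_{σ(1)}, v_{σ(2)}), …, C(v_{σ(2q-1)}, v_{σ(2q)}))`,
the sum being over the permutations `σ` with `σ(2i-1) < σ(2i)` for all `i`
(the code counts from `0`). -/
def chernWeilForm (pr : g →ₗ[𝕂] h) {q : ℕ} (P : MultilinearMap 𝕂 (fun _ : Fin q => h) 𝕂)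
    (v : Fin (2 * q) → g) : 𝕂 :=
  ((q ! : ℕ) : 𝕂)⁻¹ * ∑ σ : Equiv.Perm (Fin (2 * q)) with
      ∀ i : Fin q, σ ⟨2 * i, by omega⟩ < σ ⟨2 * i + 1, by omega⟩,
    ((Equiv.Perm.sign σ : ℤ) : 𝕂) *
      P (fun i : Fin q => curvature pr (v (σ ⟨2 * i, by omega⟩)) (v (σ ⟨2 * i + 1, by omega⟩)))

variable (h) in
/-- `χ` is the Chern--Weil homomorphism in degree `q`: for every `h`-invariant projection `pr` and
every `P`, the Chern--Weil form of `P` with respect to `pr` is a relative cocycle, and its class is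
`χ P`. -/
def IsChernWeilHom (q : ℕ) (χ : invPoly h q →ₗ[𝕂] relCohomology h (2 * q)) : Prop :=
  ∀ pr : g →ₗ[𝕂] h, IsInvariantProjection pr → ∀ P : invPoly h q,
    ∃ z : relCocycle h (2 * q),
      (∀ v : Fin (2 * q) → g, (z : g [⋀^Fin (2 * q)]→ₗ[𝕂] 𝕂) v = chernWeilForm pr P.1 v) ∧
      χ P = cohomologyClass h (2 * q) z

end RelLie

/-! ### The Lie algebra of invariant polynomial vector fields and matrices

Throughout `m` plays the role of `n - k`. -/

namespace WGamma

/-- The polynomial algebra `K = 𝕂[q₁, …, q_k, z₁, …, z_m]`. -/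
abbrev Poly (𝕂 : Type*) [Field 𝕂] (k m : ℕ) : Type _ := MvPolynomial (Fin k ⊕ Fin m) 𝕂

/-- The coordinate `q_i`. -/
abbrev qVar (𝕂 : Type*) [Field 𝕂] {k : ℕ} (m : ℕ) (i : Fin k) : Poly 𝕂 k m :=
  MvPolynomial.X (Sum.inl i)

/-- The coordinate `z_j`. -/
abbrev zVar (𝕂 : Type*) [Field 𝕂] (k : ℕ) {m : ℕ} (j : Fin m) : Poly 𝕂 k m :=
  MvPolynomial.X (Sum.inr j)

/-- `gl_N(A)` is a Lie ring under the commutator. -/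
instance glLieRing (A : Type*) [CommRing A] (N : ℕ) : LieRing (Matrix (Fin N) (Fin N) A) :=
  LieRing.ofAssociativeRing

theorem gl_lie_def {A : Type*} [CommRing A] {N : ℕ} (M M' : Matrix (Fin N) (Fin N) A) :
    ⁅M, M'⁆ = M * M' - M' * M := rfl

/-- `gl_N(A)` is a Lie algebra under the commutator. -/
instance glLieAlgebra (R A : Type*) [CommRing R] [CommRing A] [Algebra R A] (N : ℕ) :
    LieAlgebra R (Matrix (Fin N) (Fin N) A) where
  lie_smul t x y := by
    rw [gl_lie_def, gl_lie_def, Matrix.mul_smul, Matrix.smul_mul, smul_sub]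

/-- Polynomial vector fields act on `gl_N(K)` by differentiating the entries. -/
def derAction (𝕂 : Type*) [Field 𝕂] (k m N : ℕ) :
    Derivation 𝕂 (Poly 𝕂 k m) (Poly 𝕂 k m) →ₗ⁅𝕂⁆
      LieDerivation 𝕂 (Matrix (Fin N) (Fin N) (Poly 𝕂 k m))
        (Matrix (Fin N) (Fin N) (Poly 𝕂 k m)) where
  toFun D :=
    { toFun := fun M => M.map D
      map_add' := fun M M' => by ext1 s t; simp
      map_smul' := fun c M => by ext1 s t; simp
      leibniz' := fun M M' => by
        ext1 s t
        simp only [gl_lie_def, LinearMap.coe_mk, AddHom.coe_mk, Matrix.map_apply,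
          Matrix.sub_apply, Matrix.mul_apply, map_sub, map_sum, Derivation.leibniz, smul_eq_mul,
          Finset.sum_add_distrib]
        simp only [mul_comm]
        ring }
  map_add' D D' := by ext M s t; rfl
  map_smul' c D := by ext M s t; rfl
  map_lie' {D D'} := by ext M s t; rfl

/-- `W_{k,m,N} = Der(K) ⋉ gl_N(K)`, an element being a pair of a matrix (`left`) and a vector field
(`right`), with bracket `[(M, D), (M', D')] = ([M, M'] + D M' - D' M, [D, D'])`. -/
abbrev W (𝕂 : Type*) [Field 𝕂] (k m N : ℕ) : Type _ :=
  LieAlgebra.SemiDirectSum (Matrix (Fin N) (Fin N) (Poly 𝕂 k m))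
    (Derivation 𝕂 (Poly 𝕂 k m) (Poly 𝕂 k m)) (derAction 𝕂 k m N)

variable {𝕂 : Type*} [Field 𝕂] (k : ℕ) {m : ℕ} (N : ℕ) (ev : Fin m → 𝕂ˣ)

/-- The action of `γ` on `K`: `γ q_i = q_i` and `γ z_j = ev j • z_j`. -/
def gammaPoly : Poly 𝕂 k m →ₐ[𝕂] Poly 𝕂 k m :=
  MvPolynomial.aeval (Sum.elim (fun i => qVar 𝕂 m i) (fun j => (ev j : 𝕂) • zVar 𝕂 k j))

/-- The `γ`-invariant part `W^γ_{k,m,N}` of `W_{k,m,N}`. As `γ` acts on vector fields by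
`D ↦ γ ∘ D ∘ γ⁻¹`, a vector field is invariant when it commutes with `γ`; a matrix is invariant
when its entries are. -/
def Wγ : LieSubalgebra 𝕂 (W 𝕂 k m N) where
  carrier := {x | (∀ s t, gammaPoly k ev (x.left s t) = x.left s t) ∧
    ∀ f, gammaPoly k ev (x.right f) = x.right (gammaPoly k ev f)}
  add_mem' {x y} hx hy := by
    refine ⟨fun s t => ?_, fun f => ?_⟩
    · simp [hx.1 s t, hy.1 s t]
    · simp [hx.2 f, hy.2 f]
  zero_mem' := by
    refine ⟨fun s t => ?_, fun f => ?_⟩ <;> simp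
  smul_mem' c x hx := by
    refine ⟨fun s t => ?_, fun f => ?_⟩
    · simp [hx.1 s t]
    · simp [hx.2 f]
  lie_mem' {x y} hx hy := by
    have h1 : ∀ s t, gammaPoly k ev (x.left s t) = x.left s t := hx.1
    have h2 : ∀ s t, gammaPoly k ev (y.left s t) = y.left s t := hy.1
    have h3 : ∀ f, gammaPoly k ev (x.right f) = x.right (gammaPoly k ev f) := hx.2
    have h4 : ∀ f, gammaPoly k ev (y.right f) = y.right (gammaPoly k ev f) := hy.2
    refine ⟨fun s t => ?_, fun f => ?_⟩
    · have e : (⁅x, y⁆ : W 𝕂 k m N).left s t =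
          (∑ l, x.left s l * y.left l t - ∑ l, y.left s l * x.left l t)
            + x.right (y.left s t) - y.right (x.left s t) := rfl
      rw [e]
      simp only [map_sub, map_add, map_sum, map_mul, h1, h2, h3, h4]
    · have e : ∀ f', (⁅x, y⁆ : W 𝕂 k m N).right f' =
          x.right (y.right f') - y.right (x.right f') := fun _ => rfl
      rw [e, e, map_sub, h3, h4, h4, h3]

/-- The linear span of the coordinates `q_i`. -/
def qSpan (𝕂 : Type*) [Field 𝕂] (k m : ℕ) : Submodule 𝕂 (Poly 𝕂 k m) :=
  Submodule.span 𝕂 (Set.range fun i => qVar 𝕂 m i)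

/-- The linear span of the coordinates `z_j` with eigenvalue `c`. -/
def zSpan (c : 𝕂ˣ) : Submodule 𝕂 (Poly 𝕂 k m) :=
  Submodule.span 𝕂 {f | ∃ j, ev j = c ∧ f = zVar 𝕂 k j}

/-- A derivation that maps a set of polynomials into a subspace maps its span into it. -/
theorem der_mem_of_span {k m : ℕ} (D : Derivation 𝕂 (Poly 𝕂 k m) (Poly 𝕂 k m))
    {s : Set (Poly 𝕂 k m)} {V : Submodule 𝕂 (Poly 𝕂 k m)} (H : ∀ f ∈ s, D f ∈ V)
    {f : Poly 𝕂 k m} (hf : f ∈ Submodule.span 𝕂 s) : D f ∈ V :=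
  (Submodule.span_le (p := V.comap (D : Poly 𝕂 k m →ₗ[𝕂] Poly 𝕂 k m))).2 H hf

/-- The subalgebra `h₁ = gl_k ⊕ gl_{i_1} ⊕ ⋯ ⊕ gl_{i_l} ⊕ gl_N` of `W^γ_{k,m,N}`: `gl_N` is the
constant matrices, `gl_k` the linear vector fields in the `q_i`, and there is one summand
`gl_{i_s}` for each eigenvalue, the linear vector fields in the `z_j` with that eigenvalue. So it
is spanned by the `q_i ∂/∂q_{i'}`, the `z_j ∂/∂z_{j'}` with `ev j = ev j'` and the constant
matrices. -/
def h₁ : LieSubalgebra 𝕂 (Wγ k N ev) where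
  carrier := {x | (∀ s t, ∃ c : 𝕂, (x : W 𝕂 k m N).left s t = MvPolynomial.C c) ∧
    (∀ i, (x : W 𝕂 k m N).right (qVar 𝕂 m i) ∈ qSpan 𝕂 k m) ∧
    ∀ j, (x : W 𝕂 k m N).right (zVar 𝕂 k j) ∈ zSpan k ev (ev j)}
  add_mem' {x y} hx hy := by
    refine ⟨fun s t => ?_, fun i => ?_, fun j => ?_⟩
    · obtain ⟨a, ha⟩ := hx.1 s t
      obtain ⟨b, hb⟩ := hy.1 s t
      exact ⟨a + b, by simp [ha, hb]⟩
    · exact Submodule.add_mem _ (hx.2.1 i) (hy.2.1 i)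
    · exact Submodule.add_mem _ (hx.2.2 j) (hy.2.2 j)
  zero_mem' := by
    refine ⟨fun s t => ⟨0, by simp⟩, fun i => ?_, fun j => ?_⟩ <;> exact Submodule.zero_mem _
  smul_mem' c x hx := by
    refine ⟨fun s t => ?_, fun i => ?_, fun j => ?_⟩
    · obtain ⟨a, ha⟩ := hx.1 s t
      exact ⟨c * a, by simp [ha, MvPolynomial.smul_eq_C_mul]⟩
    · exact Submodule.smul_mem _ c (hx.2.1 i)
    · exact Submodule.smul_mem _ c (hx.2.2 j)
  lie_mem' {x y} hx hy := by
    have hq : ∀ z : Wγ k N ev, (∀ i, (z : W 𝕂 k m N).right (qVar 𝕂 m i) ∈ qSpan 𝕂 k m) →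
        ∀ f ∈ qSpan 𝕂 k m, (z : W 𝕂 k m N).right f ∈ qSpan 𝕂 k m := by
      intro z hz f hf
      refine der_mem_of_span _ ?_ hf
      rintro _ ⟨i, rfl⟩
      exact hz i
    have hz : ∀ z : Wγ k N ev,
        (∀ j, (z : W 𝕂 k m N).right (zVar 𝕂 k j) ∈ zSpan k ev (ev j)) →
        ∀ c, ∀ f ∈ zSpan k ev c, (z : W 𝕂 k m N).right f ∈ zSpan k ev c := by
      intro z hz c f hf
      refine der_mem_of_span _ ?_ hf
      rintro _ ⟨j, rfl, rfl⟩
      exact hz j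
    refine ⟨fun s t => ?_, fun i => ?_, fun j => ?_⟩
    · choose a ha using hx.1
      choose b hb using hy.1
      refine ⟨∑ l, a s l * b l t - ∑ l, b s l * a l t, ?_⟩
      have e : ((⁅x, y⁆ : Wγ k N ev) : W 𝕂 k m N).left s t =
          (∑ l, (x : W 𝕂 k m N).left s l * (y : W 𝕂 k m N).left l t
              - ∑ l, (y : W 𝕂 k m N).left s l * (x : W 𝕂 k m N).left l t)
            + (x : W 𝕂 k m N).right ((y : W 𝕂 k m N).left s t)
            - (y : W 𝕂 k m N).right ((x : W 𝕂 k m N).left s t) := rfl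
      rw [e]
      simp [ha, hb]
    · exact Submodule.sub_mem _ (hq x hx.2.1 _ (hy.2.1 i)) (hq y hy.2.1 _ (hx.2.1 i))
    · exact Submodule.sub_mem _ (hz x hx.2.2 _ _ (hy.2.2 j)) (hz y hy.2.2 _ _ (hx.2.2 j))

end WGamma

end

/-!
The subalgebra `h₁` is the part of degree zero of `Wγ` for the grading by polynomial degree: because
no `ev j` is `1`, a `γ`-invariant linear vector field preserves the span of the `q_i` and the spans
of the `z_j` with a given eigenvalue. Taking the part of degree zero is an invariant projection. It
is the only one (`WGamma.eq_degreeZero`), since the Euler field is central in `h₁` and acts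
invertibly on the parts of other degrees. So the independence of the projection needs no homotopy.
That Chern--Weil forms are closed follows, for any pair of Lie algebras, from the Bianchi identity
and the invariance of `P` (`RelLie.ceDiff_chernWeilAlt`).

For the injectivity, suppose that the Chern--Weil form of `P` is the differential of a relative
cochain. Then it vanishes on every family of elements whose mutual brackets lie in `h₁`. Such
a family consists of the `q ≤ k` vector fields `∂/∂q_{κ a}` and of the elements
`q_{κ b} ∑_{d ∈ S_b} e_dd`, where the `e_cd` are the matrix units of `h₁`, and `S_b` is either a
set of `q`-coordinates or the index of a single `z_j` or of a single basis vector of `gl_N`.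
The Chern--Weil form on them is, up to sign, the determinant of the matrix of their brackets
evaluated by `P` (`RelLie.sum_sign_eq_zero_of_mem_relCoboundary`). Regard `P` as a functional `Φ` on
polynomials in the `e_cd` (`GlPoly.polarFunctional`). It is invariant, and it vanishes on the test
determinants.

Such a functional is zero (`GlPoly.eq_zero_of_test`). By a form of Chevalley's restriction theorem,
it is determined by its values on monomials in the diagonal matrix units
(`GlPoly.eq_zero_of_diag_eq_zero`). A test determinant is a product of determinants of the form
`det (X + tr X)`, one for each block of `q`-coordinates, and of powers of the other diagonal matrix
units. For an invariant functional that vanishes on the diagonal monomials with several distinct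
indices, `det (X + tr X)` on a block of size `n` may be replaced by `(n + 1) e_bb ^ n`
(`GlPoly.map_det_add_trace`). Up to monomials with more distinct `q`-indices, every diagonal
monomial of degree `q` arises from a test determinant in this way, with a nonzero factor. The bound
`q ≤ k` gives the room to choose the coordinates `q_{κ a}` distinct. Descending induction on the
number of distinct `q`-indices finishes the proof.
-/

noncomputable section

namespace RelLie

/-! ### The differential of an alternatization -/

/-- The permutation of `Fin (p + 1)` that maps `0` to `i` and `l + 1` to `i.succAbove (σ l)`. -/
def permCons {p : ℕ} (i : Fin (p + 1)) (σ : Equiv.Perm (Fin p)) : Equiv.Perm (Fin (p + 1)) :=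
  i.cycleRange⁻¹ * Equiv.Perm.decomposeFin.symm (0, σ)

theorem permCons_zero {p : ℕ} (i : Fin (p + 1)) (σ : Equiv.Perm (Fin p)) :
    permCons i σ 0 = i := by
  rw [permCons, Equiv.Perm.mul_apply, Equiv.Perm.decomposeFin_symm_apply_zero]
  exact Fin.cycleRange_symm_zero i

theorem permCons_succ {p : ℕ} (i : Fin (p + 1)) (σ : Equiv.Perm (Fin p)) (l : Fin p) :
    permCons i σ l.succ = i.succAbove (σ l) := by
  rw [permCons, Equiv.Perm.mul_apply, Equiv.Perm.decomposeFin_symm_apply_succ, Equiv.swap_self]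
  exact Fin.cycleRange_symm_succ i (σ l)

theorem sign_permCons {p : ℕ} (i : Fin (p + 1)) (σ : Equiv.Perm (Fin p)) :
    Equiv.Perm.sign (permCons i σ) = (-1) ^ (i : ℕ) * Equiv.Perm.sign σ := by
  rw [permCons, Equiv.Perm.sign_mul, Equiv.Perm.sign_inv, Fin.sign_cycleRange,
    Equiv.Perm.decomposeFin.symm_sign, if_pos rfl, one_mul]

theorem permCons_bijective (p : ℕ) :
    Function.Bijective fun x : Fin (p + 1) × Equiv.Perm (Fin p) => permCons x.1 x.2 := by
  rw [Fintype.bijective_iff_injective_and_card]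
  refine ⟨?_, ?_⟩
  · rintro ⟨i, σ⟩ ⟨j, τ⟩ h
    have h' : permCons i σ = permCons j τ := h
    have hij : i = j := by rw [← permCons_zero i σ, h', permCons_zero]
    subst hij
    refine Prod.ext rfl (Equiv.ext fun l => ?_)
    apply Fin.succAbove_right_injective (p := i)
    rw [← permCons_succ, h', permCons_succ]
  · simp [Fintype.card_perm, Nat.factorial_succ]

variable {𝕂 : Type*} [Field 𝕂] {g : Type*} [LieRing g] [LieAlgebra 𝕂 g]

theorem ceDiff_apply {p : ℕ} (ω : g [⋀^Fin p]→ₗ[𝕂] 𝕂) (x : Fin (p + 1) → g) :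
    ceDiff p ω x = ∑ i : Fin (p + 1), ∑ j : Fin (p + 1), if i < j then
      (-1) ^ ((i : ℕ) + 1) * ω (fun l => Function.update x j ⁅x i, x j⁆ (i.succAbove l)) else 0 :=
  rfl

theorem alternatization_eq_sum {p : ℕ} (F : MultilinearMap 𝕂 (fun _ : Fin p => g) 𝕂)
    (v : Fin p → g) : MultilinearMap.alternatization F v =
      ∑ σ : Equiv.Perm (Fin p), ((Equiv.Perm.sign σ : ℤ) : 𝕂) * F (fun l => v (σ l)) := by
  rw [MultilinearMap.alternatization_apply]
  refine Finset.sum_congr rfl fun σ _ => ?_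
  rw [Units.smul_def, zsmul_eq_mul]
  rfl

/-- The differential of an alternatization, up to a factor of two: every slot of `F` in turn
receives the bracket of its argument with one extra argument, and the result is alternated. -/
theorem two_mul_ceDiff_alternatization {p : ℕ} (F : MultilinearMap 𝕂 (fun _ : Fin p => g) 𝕂)
    (x : Fin (p + 1) → g) : 2 * ceDiff p (MultilinearMap.alternatization F) x =
      -∑ l : Fin p, ∑ τ : Equiv.Perm (Fin (p + 1)), ((Equiv.Perm.sign τ : ℤ) : 𝕂) *
        F (Function.update (fun l' => x (τ l'.succ)) l ⁅x (τ 0), x (τ l.succ)⁆) := by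
  set f : Fin p → Equiv.Perm (Fin (p + 1)) → 𝕂 := fun l τ => ((Equiv.Perm.sign τ : ℤ) : 𝕂) *
    F (Function.update (fun l' => x (τ l'.succ)) l ⁅x (τ 0), x (τ l.succ)⁆) with hf
  -- The pair `(i, σ)` in the differential of the alternatization is the permutation
  -- `permCons i σ`.
  have h1 : ceDiff p (MultilinearMap.alternatization F) x =
      -∑ l : Fin p, ∑ τ : Equiv.Perm (Fin (p + 1)), if τ 0 < τ l.succ then f l τ else 0 := by
    rw [ceDiff_apply, Finset.sum_comm (f := fun l τ => if τ 0 < τ (Fin.succ l) then f l τ else 0),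
      ← (permCons_bijective p).sum_comp fun τ =>
      ∑ l : Fin p, if τ 0 < τ l.succ then f l τ else 0, Fintype.sum_prod_type,
      ← Finset.sum_neg_distrib]
    refine Finset.sum_congr rfl fun i _ => ?_
    rw [Fin.sum_univ_succAbove _ i, if_neg (lt_irrefl i), zero_add]
    simp only [alternatization_eq_sum, Finset.mul_sum, ← Finset.sum_neg_distrib]
    have : ∀ j : Fin p, (if i < i.succAbove j then ∑ σ : Equiv.Perm (Fin p),
        (-1 : 𝕂) ^ ((i : ℕ) + 1) * (((Equiv.Perm.sign σ : ℤ) : 𝕂) *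
          F fun l => Function.update x (i.succAbove j) ⁅x i, x (i.succAbove j)⁆
            (i.succAbove (σ l))) else 0) =
        ∑ σ : Equiv.Perm (Fin p), if i < i.succAbove j then
        (-1 : 𝕂) ^ ((i : ℕ) + 1) * (((Equiv.Perm.sign σ : ℤ) : 𝕂) *
          F fun l => Function.update x (i.succAbove j) ⁅x i, x (i.succAbove j)⁆
            (i.succAbove (σ l))) else 0 := by
      intro j
      split_ifs <;> simp
    rw [Finset.sum_congr rfl fun j _ => this j, Finset.sum_comm]
    refine Finset.sum_congr rfl fun σ _ => ?_
    rw [← Equiv.sum_comp σ]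
    refine Finset.sum_congr rfl fun l _ => ?_
    simp only [permCons_zero, permCons_succ, hf, sign_permCons]
    split_ifs with hlt
    · have e : (fun l' => Function.update x (i.succAbove (σ l)) ⁅x i, x (i.succAbove (σ l))⁆
          (i.succAbove (σ l'))) = Function.update (fun l' => x (i.succAbove (σ l'))) l
            ⁅x i, x (i.succAbove (σ l))⁆ := by
        funext l'
        by_cases hl : l' = l
        · subst hl; simp
        · rw [Function.update_of_ne hl, Function.update_of_ne]
          intro h
          exact hl (σ.injective (Fin.succAbove_right_injective h))
      rw [e]
      push_cast
      ring
    · simp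
  -- The transposition of the two arguments of the bracket exchanges the cases `τ 0 < τ l.succ` and
  -- `τ l.succ < τ 0`.
  have h2 : ∀ l, ∑ τ, f l τ = 2 * ∑ τ, if τ 0 < τ l.succ then f l τ else 0 := by
    intro l
    have hsw : ∀ τ, f l (τ * Equiv.swap 0 l.succ) = f l τ := by
      intro τ
      simp only [hf, Equiv.Perm.mul_apply, Equiv.swap_apply_left, Equiv.swap_apply_right,
        Equiv.Perm.sign_mul, Equiv.Perm.sign_swap (Fin.succ_ne_zero l).symm]
      have e : Function.update (fun l' : Fin p => x (τ (Equiv.swap 0 l.succ l'.succ))) l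
          ⁅x (τ l.succ), x (τ 0)⁆ = Function.update (fun l' : Fin p => x (τ l'.succ)) l
          (-⁅x (τ 0), x (τ l.succ)⁆) := by
        funext l'
        by_cases hl : l' = l
        · subst hl; simp
        · rw [Function.update_of_ne hl, Function.update_of_ne hl,
            Equiv.swap_apply_of_ne_of_ne (Fin.succ_ne_zero l')
              (fun h => hl (Fin.succ_injective _ h))]
      rw [e, MultilinearMap.map_update_neg]
      push_cast
      ring
    have hrev : ∑ τ, (if τ 0 < τ l.succ then f l τ else 0) =
        ∑ τ, (if τ l.succ < τ 0 then f l τ else 0) := by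
      rw [← Equiv.sum_comp (Equiv.mulRight (Equiv.swap (0 : Fin (p + 1)) l.succ))]
      refine Finset.sum_congr rfl fun τ _ => ?_
      simp [hsw]
    rw [two_mul]
    nth_rewrite 2 [hrev]
    rw [← Finset.sum_add_distrib]
    refine Finset.sum_congr rfl fun τ _ => ?_
    have hne : τ 0 ≠ τ l.succ := fun h => Fin.succ_ne_zero l (τ.injective h).symm
    rcases lt_or_gt_of_ne hne with h | h
    · simp [h, not_lt.2 h.le]
    · simp [h, not_lt.2 h.le]
  rw [h1, mul_neg, Finset.mul_sum]
  exact congrArg _ (Finset.sum_congr rfl fun l _ => (h2 l).symm)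

/-! ### Chern--Weil forms are relative cocycles -/

/-- The first member of the `i`-th of the `q` pairs of consecutive arguments. -/
abbrev fstIdx {q : ℕ} (i : Fin q) : Fin (2 * q) := ⟨2 * i, by omega⟩

/-- The second member of the `i`-th of the `q` pairs of consecutive arguments. -/
abbrev sndIdx {q : ℕ} (i : Fin q) : Fin (2 * q) := ⟨2 * i + 1, by omega⟩

theorem fstIdx_inj {q : ℕ} {i j : Fin q} : fstIdx i = fstIdx j ↔ i = j := by
  simp [fstIdx, Fin.ext_iff]

theorem sndIdx_inj {q : ℕ} {i j : Fin q} : sndIdx i = sndIdx j ↔ i = j := by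
  simp [sndIdx, Fin.ext_iff]

theorem fstIdx_ne_sndIdx {q : ℕ} (i j : Fin q) : fstIdx i ≠ sndIdx j := by
  simp only [fstIdx, sndIdx, ne_eq, Fin.mk.injEq]; omega

theorem exists_pair_idx {q : ℕ} (l : Fin (2 * q)) : ∃ i : Fin q, l = fstIdx i ∨ l = sndIdx i := by
  refine ⟨⟨l / 2, by omega⟩, ?_⟩
  simp only [fstIdx, sndIdx, Fin.ext_iff]
  omega

/-- The arrangement of the positions in pairs of consecutive ones. -/
def pairEquiv (q : ℕ) : Fin q ⊕ Fin q ≃ Fin (2 * q) :=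
  Equiv.ofBijective (Sum.elim fstIdx sndIdx) (by
    refine ⟨?_, fun l => ?_⟩
    · rintro (i | i) (j | j) h
      · exact congrArg _ (fstIdx_inj.1 h)
      · exact absurd h (fstIdx_ne_sndIdx i j)
      · exact absurd h.symm (fstIdx_ne_sndIdx j i)
      · exact congrArg _ (sndIdx_inj.1 h)
    · obtain ⟨i, h | h⟩ := exists_pair_idx l
      · exact ⟨Sum.inl i, h.symm⟩
      · exact ⟨Sum.inr i, h.symm⟩)

theorem sum_pair_idx {M : Type*} [AddCommMonoid M] {q : ℕ} (f : Fin (2 * q) → M) :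
    ∑ l, f l = ∑ i : Fin q, (f (fstIdx i) + f (sndIdx i)) := by
  rw [← (pairEquiv q).sum_comp, Fintype.sum_sum_type, ← Finset.sum_add_distrib]
  rfl

variable {h : LieSubalgebra 𝕂 g}

/-- The family of the curvatures of the `q` consecutive pairs of arguments. -/
def curvatures (pr : g →ₗ[𝕂] h) {q : ℕ} (v : Fin (2 * q) → g) (i : Fin q) : h :=
  curvature pr (v (fstIdx i)) (v (sndIdx i))

theorem curvatures_update_fst (pr : g →ₗ[𝕂] h) {q : ℕ}
    (v : Fin (2 * q) → g) (i : Fin q) (y : g) :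
    curvatures pr (Function.update v (fstIdx i) y) =
      Function.update (curvatures pr v) i (curvature pr y (v (sndIdx i))) := by
  funext j
  by_cases hj : j = i
  · subst hj
    simp only [curvatures, Function.update_self,
      Function.update_of_ne (fstIdx_ne_sndIdx j j).symm]
  · simp only [curvatures, Function.update_of_ne hj,
      Function.update_of_ne (fun e => hj (fstIdx_inj.1 e)),
      Function.update_of_ne (fstIdx_ne_sndIdx i j).symm]

theorem curvatures_update_snd (pr : g →ₗ[𝕂] h) {q : ℕ} (v : Fin (2 * q) → g) (i : Fin q) (y : g) :
    curvatures pr (Function.update v (sndIdx i) y) =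
      Function.update (curvatures pr v) i (curvature pr (v (fstIdx i)) y) := by
  funext j
  by_cases hj : j = i
  · subst hj
    simp only [curvatures, Function.update_self, Function.update_of_ne (fstIdx_ne_sndIdx j j)]
  · simp only [curvatures, Function.update_of_ne hj,
      Function.update_of_ne (fun e => hj (sndIdx_inj.1 e)),
      Function.update_of_ne (fstIdx_ne_sndIdx j i)]

theorem curvature_add_left (pr : g →ₗ[𝕂] h) (u u' v : g) :
    curvature pr (u + u') v = curvature pr u v + curvature pr u' v := by
  simp only [curvature, map_add, add_lie]; abel

theorem curvature_smul_left (pr : g →ₗ[𝕂] h) (c : 𝕂) (u v : g) :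
    curvature pr (c • u) v = c • curvature pr u v := by
  simp only [curvature, map_smul, smul_lie, smul_sub]

theorem curvature_swap (pr : g →ₗ[𝕂] h) (u v : g) : curvature pr v u = -curvature pr u v := by
  simp only [curvature]
  rw [← lie_skew, ← lie_skew v u, map_neg]
  abel

theorem curvature_add_right (pr : g →ₗ[𝕂] h) (u v v' : g) :
    curvature pr u (v + v') = curvature pr u v + curvature pr u v' := by
  simp only [curvature, map_add, lie_add]; abel

theorem curvature_smul_right (pr : g →ₗ[𝕂] h) (c : 𝕂) (u v : g) :
    curvature pr u (c • v) = c • curvature pr u v := by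
  simp only [curvature, map_smul, lie_smul, smul_sub]

/-- The multilinear form `v ↦ P(C(v₁, v₂), …, C(v_{2q-1}, v_{2q}))`, whose alternatization is the
Chern--Weil form up to a scalar. -/
def curvatureForm (pr : g →ₗ[𝕂] h) {q : ℕ} (P : MultilinearMap 𝕂 (fun _ : Fin q => h) 𝕂) :
    MultilinearMap 𝕂 (fun _ : Fin (2 * q) => g) 𝕂 :=
  MultilinearMap.mk' (fun v => P (curvatures pr v))
    (by
      intro v l x y
      obtain ⟨i, rfl | rfl⟩ := exists_pair_idx l
      · simp only [curvatures_update_fst, curvature_add_left, P.map_update_add]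
      · simp only [curvatures_update_snd, curvature_add_right, P.map_update_add])
    (by
      intro v l c x
      obtain ⟨i, rfl | rfl⟩ := exists_pair_idx l
      · simp only [curvatures_update_fst, curvature_smul_left, P.map_update_smul]
      · simp only [curvatures_update_snd, curvature_smul_right, P.map_update_smul])

theorem curvatureForm_apply (pr : g →ₗ[𝕂] h) {q : ℕ}
    (P : MultilinearMap 𝕂 (fun _ : Fin q => h) 𝕂) (v : Fin (2 * q) → g) :
    curvatureForm pr P v = P (curvatures pr v) := rfl

/-- The Chern--Weil form as an alternating map. The sum over all permutations counts every
permutation with `σ(2i-1) < σ(2i)` for all `i` exactly `2 ^ q` times. -/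
def chernWeilAlt (pr : g →ₗ[𝕂] h) (q : ℕ) :
    MultilinearMap 𝕂 (fun _ : Fin q => h) 𝕂 →ₗ[𝕂] (g [⋀^Fin (2 * q)]→ₗ[𝕂] 𝕂) where
  toFun P := (((q ! : ℕ) : 𝕂)⁻¹ * (2 ^ q)⁻¹) • MultilinearMap.alternatization (curvatureForm pr P)
  map_add' P P' := by
    ext v
    simp only [AlternatingMap.smul_apply, AlternatingMap.add_apply, alternatization_eq_sum,
      curvatureForm_apply, _root_.add_apply, mul_add, Finset.sum_add_distrib, smul_add]
  map_smul' c P := by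
    ext v
    simp only [AlternatingMap.smul_apply, alternatization_eq_sum, RingHom.id_apply,
      curvatureForm_apply, _root_.smul_apply, smul_eq_mul, Finset.mul_sum]
    refine Finset.sum_congr rfl fun σ _ => ?_
    ring

theorem chernWeilAlt_apply (pr : g →ₗ[𝕂] h) {q : ℕ}
    (P : MultilinearMap 𝕂 (fun _ : Fin q => h) 𝕂) (v : Fin (2 * q) → g) :
    chernWeilAlt pr q P v = ((q ! : ℕ) : 𝕂)⁻¹ * (2 ^ q)⁻¹ *
      ∑ σ : Equiv.Perm (Fin (2 * q)), ((Equiv.Perm.sign σ : ℤ) : 𝕂) *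
        P (curvatures pr fun l => v (σ l)) := by
  simp only [← curvatureForm_apply, ← alternatization_eq_sum]
  rfl

/-- Exchanging the two members of a pair changes the sign, as the curvature is alternating. -/
theorem curvatures_comp_swap (pr : g →ₗ[𝕂] h) {q : ℕ} (P : MultilinearMap 𝕂 (fun _ : Fin q => h) 𝕂)
    (v : Fin (2 * q) → g) (i : Fin q) :
    P (curvatures pr fun l => v (Equiv.swap (fstIdx i) (sndIdx i) l)) = -P (curvatures pr v) := by
  have e : (curvatures pr fun l => v (Equiv.swap (fstIdx i) (sndIdx i) l)) =
      Function.update (curvatures pr v) i (-curvatures pr v i) := by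
    funext j
    by_cases hj : j = i
    · subst hj
      simp only [curvatures, Function.update_self, Equiv.swap_apply_left, Equiv.swap_apply_right]
      exact curvature_swap pr _ _
    · rw [Function.update_of_ne hj]
      simp only [curvatures]
      rw [Equiv.swap_apply_of_ne_of_ne (fun e => hj (fstIdx_inj.1 e)) (fstIdx_ne_sndIdx j i),
        Equiv.swap_apply_of_ne_of_ne (fstIdx_ne_sndIdx i j).symm (fun e => hj (sndIdx_inj.1 e))]
  rw [e, P.map_update_neg, Function.update_eq_self]

theorem chernWeilForm_eq_chernWeilAlt [CharZero 𝕂] (pr : g →ₗ[𝕂] h) {q : ℕ}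
    (P : MultilinearMap 𝕂 (fun _ : Fin q => h) 𝕂) (v : Fin (2 * q) → g) :
    chernWeilForm pr P v = chernWeilAlt pr q P v := by
  set f : Equiv.Perm (Fin (2 * q)) → 𝕂 := fun σ => ((Equiv.Perm.sign σ : ℤ) : 𝕂) *
    P (curvatures pr fun l => v (σ l)) with hf
  have hsw : ∀ σ (i : Fin q), f (σ * Equiv.swap (fstIdx i) (sndIdx i)) = f σ := by
    intro σ i
    simp only [hf, Equiv.Perm.sign_mul, Equiv.Perm.sign_swap (fstIdx_ne_sndIdx i i),
      Equiv.Perm.mul_apply]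
    rw [curvatures_comp_swap pr P (fun l => v (σ l))]
    push_cast
    ring
  -- For each pair, half of the total comes from the permutations that preserve its order.
  have key : ∀ T : Finset (Fin q), ∑ σ, f σ =
      2 ^ T.card * ∑ σ, if ∀ i ∈ T, σ (fstIdx i) < σ (sndIdx i) then f σ else 0 := by
    intro T
    induction T using Finset.induction_on with
    | empty => simp
    | insert a T ha ih =>
      rw [ih, Finset.card_insert_of_notMem ha, pow_succ, mul_assoc]
      congr 1
      have hrev : ∑ σ, (if ∀ i ∈ insert a T, σ (fstIdx i) < σ (sndIdx i) then f σ else 0) =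
          ∑ σ, (if (∀ i ∈ T, σ (fstIdx i) < σ (sndIdx i)) ∧ σ (sndIdx a) < σ (fstIdx a)
            then f σ else 0) := by
        rw [← Equiv.sum_comp (Equiv.mulRight (Equiv.swap (fstIdx a) (sndIdx a)))]
        refine Finset.sum_congr rfl fun σ _ => ?_
        simp only [Equiv.coe_mulRight, hsw, Equiv.Perm.mul_apply, Finset.forall_mem_insert,
          Equiv.swap_apply_left, Equiv.swap_apply_right]
        refine if_congr ?_ rfl rfl
        rw [and_comm]
        refine and_congr_left fun _ => forall₂_congr fun i hi => ?_
        have hia : i ≠ a := fun e => ha (e ▸ hi)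
        rw [Equiv.swap_apply_of_ne_of_ne (fun e => hia (fstIdx_inj.1 e)) (fstIdx_ne_sndIdx i a),
          Equiv.swap_apply_of_ne_of_ne (fstIdx_ne_sndIdx a i).symm
            (fun e => hia (sndIdx_inj.1 e))]
      refine Eq.trans ?_ ((congrArg₂ (· + ·) rfl hrev.symm).trans (two_mul _).symm)
      rw [← Finset.sum_add_distrib]
      refine Finset.sum_congr rfl fun σ _ => ?_
      simp only [Finset.forall_mem_insert]
      have hne : σ (fstIdx a) ≠ σ (sndIdx a) := fun e => fstIdx_ne_sndIdx a a (σ.injective e)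
      by_cases hT : ∀ i ∈ T, σ (fstIdx i) < σ (sndIdx i)
      · rcases lt_or_gt_of_ne hne with h | h
        · rw [if_pos hT, if_pos ⟨h, hT⟩, if_neg (fun e => lt_asymm h e.2), add_zero]
        · rw [if_pos hT, if_neg (fun e => lt_asymm h e.1), if_pos ⟨hT, h⟩, zero_add]
      · rw [if_neg hT, if_neg (fun e => hT e.2), if_neg (fun e => hT e.1), add_zero]
  rw [chernWeilAlt_apply, chernWeilForm]
  change _ = _ * ∑ σ, f σ
  rw [key Finset.univ, Finset.card_univ, Fintype.card_fin, mul_assoc,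
    inv_mul_cancel_left₀ (pow_ne_zero q two_ne_zero), Finset.sum_filter]
  simp only [Finset.mem_univ, true_imp_iff]
  rfl

variable {pr : g →ₗ[𝕂] h}

theorem curvature_of_mem_left (hpr : IsInvariantProjection pr) (x : h) (y : g) :
    curvature pr x y = 0 := by
  rw [curvature, hpr.1, hpr.2, sub_self]

theorem curvature_of_mem_right (hpr : IsInvariantProjection pr) (x : h) (y : g) :
    curvature pr y x = 0 := by
  rw [curvature_swap, curvature_of_mem_left hpr, neg_zero]

theorem lie_curvature (hpr : IsInvariantProjection pr) (x : h) (u v : g) :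
    curvature pr ⁅(x : g), u⁆ v + curvature pr u ⁅(x : g), v⁆ = ⁅x, curvature pr u v⁆ := by
  have e : ⁅⁅(x : g), u⁆, v⁆ + ⁅u, ⁅(x : g), v⁆⁆ = ⁅(x : g), ⁅u, v⁆⁆ :=
    (leibniz_lie (x : g) u v).symm
  have e' : ⁅⁅x, pr u⁆, pr v⁆ + ⁅pr u, ⁅x, pr v⁆⁆ = ⁅x, ⁅pr u, pr v⁆⁆ := (leibniz_lie x _ _).symm
  simp only [curvature, hpr.2, lie_sub, ← e', ← hpr.2 x ⁅u, v⁆, ← e, map_add]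
  abel

theorem chernWeilAlt_mem_relCochain (hpr : IsInvariantProjection pr) {q : ℕ}
    {P : MultilinearMap 𝕂 (fun _ : Fin q => h) 𝕂} (hP : P ∈ invPoly h q) :
    chernWeilAlt pr q P ∈ relCochain h (2 * q) := by
  refine ⟨fun v hv => ?_, fun x hx v => ?_⟩
  · obtain ⟨l, hl⟩ := hv
    rw [chernWeilAlt_apply, Finset.sum_eq_zero, mul_zero]
    intro σ _
    obtain ⟨i, hi⟩ := exists_pair_idx (σ.symm l)
    rw [P.map_coord_zero i, mul_zero]
    rcases hi with hi | hi <;> rw [curvatures, ← hi, Equiv.apply_symm_apply]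
    · exact curvature_of_mem_left hpr ⟨_, hl⟩ _
    · exact curvature_of_mem_right hpr ⟨_, hl⟩ _
  · simp only [chernWeilAlt_apply, ← Finset.mul_sum]
    rw [Finset.sum_comm, Finset.sum_eq_zero, mul_zero]
    intro σ _
    rw [← Finset.mul_sum, ← Equiv.sum_comp σ]
    have e : ∀ l, (fun l' => Function.update v (σ l) ⁅x, v (σ l)⁆ (σ l')) =
        Function.update (fun l' => v (σ l')) l ⁅x, v (σ l)⁆ := by
      intro l
      funext l'
      by_cases hl : l' = l
      · subst hl; simp
      · rw [Function.update_of_ne hl, Function.update_of_ne (fun e => hl (σ.injective e))]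
    simp only [e]
    rw [sum_pair_idx]
    simp only [curvatures_update_fst, curvatures_update_snd, ← P.map_update_add]
    rw [Finset.sum_congr rfl fun i _ => by rw [lie_curvature hpr ⟨x, hx⟩]]
    exact mul_eq_zero_of_right _ (hP.2 ⟨x, hx⟩ (curvatures pr fun l => v (σ l)))

/-- The Bianchi identity. -/
theorem bianchi (pr : g →ₗ[𝕂] h) (x a b : g) :
    curvature pr ⁅x, a⁆ b + curvature pr a ⁅x, b⁆ - curvature pr x ⁅a, b⁆ =
      ⁅pr x, curvature pr a b⁆ + ⁅pr b, curvature pr x a⁆ - ⁅pr a, curvature pr x b⁆ := by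
  have e : ⁅x, ⁅a, b⁆⁆ = ⁅⁅x, a⁆, b⁆ + ⁅a, ⁅x, b⁆⁆ := leibniz_lie x a b
  have e' : ⁅pr x, ⁅pr a, pr b⁆⁆ = ⁅⁅pr x, pr a⁆, pr b⁆ + ⁅pr a, ⁅pr x, pr b⁆⁆ :=
    leibniz_lie _ _ _
  simp only [curvature, lie_sub, e, e', map_add]
  rw [← lie_skew (pr b) ⁅pr x, pr a⁆, ← lie_skew (pr b) (pr ⁅x, a⁆)]
  abel

/-- The alternated sum of `P(…, f(x₀, x_{2i-1}, x_{2i}), …)`, where `f` fills the `i`-th slot and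
the curvatures of the remaining pairs fill the others. -/
def altSlot (pr : g →ₗ[𝕂] h) {q : ℕ} (P : MultilinearMap 𝕂 (fun _ : Fin q => h) 𝕂)
    (x : Fin (2 * q + 1) → g) (i : Fin q) (f : g → g → g → h) : 𝕂 :=
  ∑ τ : Equiv.Perm (Fin (2 * q + 1)), ((Equiv.Perm.sign τ : ℤ) : 𝕂) *
    P (Function.update (curvatures pr fun l => x (τ l.succ)) i
      (f (x (τ 0)) (x (τ (fstIdx i).succ)) (x (τ (sndIdx i).succ))))

section altSlot

variable {q : ℕ} (P : MultilinearMap 𝕂 (fun _ : Fin q => h) 𝕂) (x : Fin (2 * q + 1) → g) (i : Fin q)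

theorem altSlot_add (f f' : g → g → g → h) :
    altSlot pr P x i (fun u a b => f u a b + f' u a b) =
      altSlot pr P x i f + altSlot pr P x i f' := by
  simp only [altSlot, P.map_update_add, mul_add, Finset.sum_add_distrib]

theorem altSlot_neg (f : g → g → g → h) :
    altSlot pr P x i (fun u a b => -f u a b) = -altSlot pr P x i f := by
  simp only [altSlot, P.map_update_neg, mul_neg, Finset.sum_neg_distrib]

/-- A transposition of two of the three arguments of `f` changes the sign of the alternated sum. -/
theorem altSlot_swap (f f' : g → g → g → h) (s t : Fin (2 * q + 1)) (hst : s ≠ t)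
    (hs : s = 0 ∨ s = (fstIdx i).succ ∨ s = (sndIdx i).succ)
    (ht : t = 0 ∨ t = (fstIdx i).succ ∨ t = (sndIdx i).succ)
    (H : ∀ y : Fin (2 * q + 1) → g, f' (y 0) (y (fstIdx i).succ) (y (sndIdx i).succ) =
      f (y (Equiv.swap s t 0)) (y (Equiv.swap s t (fstIdx i).succ))
        (y (Equiv.swap s t (sndIdx i).succ))) :
    altSlot pr P x i f' = -altSlot pr P x i f := by
  rw [altSlot, altSlot, ← Equiv.sum_comp (Equiv.mulRight (Equiv.swap s t)),
    ← Finset.sum_neg_distrib]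
  refine Finset.sum_congr rfl fun τ _ => ?_
  have hswap : ∀ j : Fin q, j ≠ i → ∀ r, r = (fstIdx j).succ ∨ r = (sndIdx j).succ →
      Equiv.swap s t r = r := by
    intro j hj r hr
    have hj' : (j : ℕ) ≠ i := fun e => hj (Fin.ext e)
    apply Equiv.swap_apply_of_ne_of_ne
    all_goals
      rw [Ne, Fin.ext_iff]
      simp only [Fin.ext_iff, Fin.val_succ, Fin.val_zero] at hs ht hr
      omega
  rw [Equiv.coe_mulRight, Equiv.Perm.sign_mul, Equiv.Perm.sign_swap hst,
    H (fun l => x ((τ * Equiv.swap s t) l))]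
  simp only [Equiv.Perm.mul_apply, Equiv.swap_apply_self]
  have e : Function.update (curvatures pr fun l => x (τ (Equiv.swap s t l.succ))) i
      (f (x (τ 0)) (x (τ (fstIdx i).succ)) (x (τ (sndIdx i).succ))) =
      Function.update (curvatures pr fun l => x (τ l.succ)) i
      (f (x (τ 0)) (x (τ (fstIdx i).succ)) (x (τ (sndIdx i).succ))) := by
    funext j
    by_cases hj : j = i
    · subst hj; simp only [Function.update_self]
    · rw [Function.update_of_ne hj, Function.update_of_ne hj]
      simp only [curvatures]
      rw [hswap j hj _ (Or.inl rfl), hswap j hj _ (Or.inr rfl)]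
  rw [e]
  push_cast
  ring

theorem altSlot_swap_pair (f : g → g → g → h) :
    altSlot pr P x i (fun u a b => f u b a) = -altSlot pr P x i f := by
  have hne : (fstIdx i).succ ≠ (sndIdx i).succ :=
    fun e => fstIdx_ne_sndIdx i i (Fin.succ_injective _ e)
  refine altSlot_swap P x i _ _ (fstIdx i).succ (sndIdx i).succ hne (Or.inr (Or.inl rfl))
    (Or.inr (Or.inr rfl)) fun y => ?_
  rw [Equiv.swap_apply_left, Equiv.swap_apply_right,
    Equiv.swap_apply_of_ne_of_ne (Fin.succ_ne_zero _).symm (Fin.succ_ne_zero _).symm]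

theorem altSlot_swap_zero (f : g → g → g → h) :
    altSlot pr P x i (fun u a b => f a u b) = -altSlot pr P x i f := by
  have hne : (sndIdx i).succ ≠ (fstIdx i).succ :=
    fun e => fstIdx_ne_sndIdx i i (Fin.succ_injective _ e).symm
  refine altSlot_swap P x i _ _ 0 (fstIdx i).succ (Fin.succ_ne_zero _).symm (Or.inl rfl)
    (Or.inr (Or.inl rfl)) fun y => ?_
  rw [Equiv.swap_apply_left, Equiv.swap_apply_right,
    Equiv.swap_apply_of_ne_of_ne (Fin.succ_ne_zero _) hne]

end altSlot

/-- Under alternation, the terms on each side of the Bianchi identity become equal. -/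
theorem altSlot_bianchi [CharZero 𝕂] {q : ℕ} (P : MultilinearMap 𝕂 (fun _ : Fin q => h) 𝕂)
    (x : Fin (2 * q + 1) → g) (i : Fin q) :
    altSlot pr P x i (fun u a b => curvature pr ⁅u, a⁆ b + curvature pr a ⁅u, b⁆) =
      2 * altSlot pr P x i (fun u a b => ⁅pr u, curvature pr a b⁆) := by
  set A := altSlot pr P x i (fun u a b => curvature pr ⁅u, a⁆ b)
  set R := altSlot pr P x i (fun u a b => ⁅pr u, curvature pr a b⁆)
  have h1 : altSlot pr P x i (fun u a b => curvature pr a ⁅u, b⁆) = A := by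
    have := altSlot_swap_pair (pr := pr) P x i (fun u a b => curvature pr b ⁅u, a⁆)
    rw [this, ← altSlot_neg]
    simp only [← curvature_swap]
    rfl
  have h2 : altSlot pr P x i (fun u a b => -curvature pr u ⁅a, b⁆) = A := by
    have := altSlot_swap_zero (pr := pr) P x i (fun u a b => curvature pr a ⁅u, b⁆)
    rw [altSlot_neg, this, neg_neg, h1]
  have h3 : altSlot pr P x i (fun u a b => -⁅pr a, curvature pr u b⁆) = R := by
    have := altSlot_swap_zero (pr := pr) P x i (fun u a b => ⁅pr u, curvature pr a b⁆)
    rw [altSlot_neg, this, neg_neg]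
  have h4 : altSlot pr P x i (fun u a b => ⁅pr b, curvature pr u a⁆) = R := by
    have := altSlot_swap_pair (pr := pr) P x i (fun u a b => ⁅pr a, curvature pr u b⁆)
    rw [this, ← altSlot_neg, h3]
  have h5 : A + A + A = R + R + R := by
    refine (congrArg₂ (· + ·) (congrArg₂ (· + ·) rfl h1.symm) h2.symm).trans (Eq.trans ?_
      (congrArg₂ (· + ·) (congrArg₂ (· + ·) rfl h4) h3))
    rw [← altSlot_add, ← altSlot_add, ← altSlot_add, ← altSlot_add]
    simp only [← sub_eq_add_neg, bianchi]
  have h6 : (3 : 𝕂) * A = 3 * R := by linear_combination h5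
  rw [altSlot_add P x i (fun u a b => curvature pr ⁅u, a⁆ b), h1,
    ← mul_left_cancel₀ three_ne_zero h6, two_mul]

/-- By the Bianchi identity, the differential of a Chern--Weil form is an alternated sum of
derivatives of `P` along elements of `h`. -/
theorem ceDiff_chernWeilAlt [CharZero 𝕂] (pr : g →ₗ[𝕂] h) {q : ℕ}
    {P : MultilinearMap 𝕂 (fun _ : Fin q => h) 𝕂} (hP : P ∈ invPoly h q) :
    ceDiff (2 * q) (chernWeilAlt pr q P) = 0 := by
  have key : ceDiff (2 * q) (MultilinearMap.alternatization (curvatureForm pr P)) = 0 := by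
    funext x
    apply mul_left_cancel₀ (two_ne_zero (α := 𝕂))
    rw [two_mul_ceDiff_alternatization, sum_pair_idx, Pi.zero_apply, mul_zero, neg_eq_zero]
    simp only [curvatureForm_apply, curvatures_update_fst, curvatures_update_snd,
      ← Finset.sum_add_distrib, ← mul_add, ← P.map_update_add]
    refine (Finset.sum_congr rfl fun i _ => altSlot_bianchi (pr := pr) P x i).trans ?_
    rw [← Finset.mul_sum]
    simp only [altSlot]
    rw [Finset.sum_comm, Finset.sum_eq_zero, mul_zero]
    intro τ _
    rw [← Finset.mul_sum]
    exact mul_eq_zero_of_right _ (hP.2 (pr (x (τ 0))) (curvatures pr fun l => x (τ l.succ)))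
  have e : chernWeilAlt pr q P = (((q ! : ℕ) : 𝕂)⁻¹ * (2 ^ q)⁻¹) •
      MultilinearMap.alternatization (curvatureForm pr P) := rfl
  rw [e, map_smul, key, smul_zero]

end RelLie

namespace GlPoly

open MvPolynomial

/-! ### Restriction of invariant functionals to the diagonal -/

section Restriction

variable {𝕂 : Type*} [Field 𝕂] {J : Type*} [DecidableEq J]

/-- The action of the matrix unit `e_ab` on the symmetric algebra of `gl_J`, a polynomial algebra
in the matrix units `X (c, d)`: the derivation that extends
`[e_ab, e_cd] = δ_bc e_ad - δ_da e_cb`. -/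
def adDer (𝕂 : Type*) [Field 𝕂] (a b : J) :
    Derivation 𝕂 (MvPolynomial (J × J) 𝕂) (MvPolynomial (J × J) 𝕂) :=
  mkDerivation 𝕂 fun p =>
    (if b = p.1 then X (a, p.2) else 0) - (if p.2 = a then X (p.1, b) else 0)

theorem adDer_X (a b c d : J) : adDer 𝕂 a b (X (c, d)) =
    (if b = c then X (a, d) else 0) - (if d = a then X (c, b) else 0) := by
  rw [adDer, mkDerivation_X]

theorem adDer_X_diag_right {a b : J} (hab : a ≠ b) : adDer 𝕂 a b (X (b, b)) = X (a, b) := by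
  rw [adDer_X, if_pos rfl, if_neg hab.symm, sub_zero]

theorem adDer_X_diag_left {a b : J} (hab : a ≠ b) : adDer 𝕂 a b (X (a, a)) = -X (a, b) := by
  rw [adDer_X, if_pos rfl, if_neg hab.symm, zero_sub]

theorem adDer_X_diag_other {a b c : J} (hca : c ≠ a) (hcb : c ≠ b) :
    adDer 𝕂 a b (X (c, c)) = 0 := by
  rw [adDer_X, if_neg hcb.symm, if_neg hca, sub_zero]

/-- Polynomials in the diagonal matrix units. -/
abbrev diag (𝕂 : Type*) [Field 𝕂] {J : Type*} : MvPolynomial J 𝕂 →ₐ[𝕂] MvPolynomial (J × J) 𝕂 :=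
  rename fun j => (j, j)

/-- The number of off-diagonal factors of a monomial. -/
def offDegree : ((J × J) →₀ ℕ) →+ ℕ := Finsupp.weight fun p => if p.1 = p.2 then 0 else 1

theorem offDegree_single (p : J × J) (n : ℕ) :
    offDegree (Finsupp.single p n) = if p.1 = p.2 then 0 else n := by
  rw [offDegree, Finsupp.weight_single]; split_ifs <;> simp

/-- One off-diagonal factor `X (a, b)` can be removed by the invariance under `e_ab`: apply it to
the product with one more factor `X (b, b)`. -/
theorem mul_offDiag_eq_zero [CharZero 𝕂] (Ψ : MvPolynomial (J × J) 𝕂 →ₗ[𝕂] 𝕂) {a b : J}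
    (hab : a ≠ b) (hL : ∀ f, Ψ (adDer 𝕂 a b f) = 0) (w : MvPolynomial (J × J) 𝕂)
    (hw : ∀ i j, Ψ (adDer 𝕂 a b w * X (a, a) ^ j * X (b, b) ^ i) = 0) (j i : ℕ) :
    Ψ (X (a, b) * w * X (a, a) ^ j * X (b, b) ^ i) = 0 := by
  induction j generalizing i with
  | zero =>
    have h := hL (w * X (b, b) ^ (i + 1))
    have e : adDer 𝕂 a b (w * X (b, b) ^ (i + 1)) =
        adDer 𝕂 a b w * X (a, a) ^ 0 * X (b, b) ^ (i + 1) +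
          ((i + 1 : ℕ) : 𝕂) • (X (a, b) * w * X (a, a) ^ 0 * X (b, b) ^ i) := by
      rw [Derivation.leibniz, Derivation.leibniz_pow, adDer_X_diag_right hab]
      simp only [smul_eq_mul, nsmul_eq_mul, MvPolynomial.smul_eq_C_mul, map_natCast,
        Nat.add_sub_cancel]
      ring
    rw [e, map_add, hw, zero_add, map_smul, smul_eq_mul] at h
    exact (mul_eq_zero.1 h).resolve_left (Nat.cast_ne_zero.2 (Nat.succ_ne_zero i))
  | succ j ih =>
    have h := hL (w * X (a, a) ^ (j + 1) * X (b, b) ^ (i + 1))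
    have e : adDer 𝕂 a b (w * X (a, a) ^ (j + 1) * X (b, b) ^ (i + 1)) =
        adDer 𝕂 a b w * X (a, a) ^ (j + 1) * X (b, b) ^ (i + 1) +
          ((i + 1 : ℕ) : 𝕂) • (X (a, b) * w * X (a, a) ^ (j + 1) * X (b, b) ^ i) -
          ((j + 1 : ℕ) : 𝕂) • (X (a, b) * w * X (a, a) ^ j * X (b, b) ^ (i + 1)) := by
      rw [Derivation.leibniz, Derivation.leibniz, Derivation.leibniz_pow, Derivation.leibniz_pow,
        adDer_X_diag_right hab, adDer_X_diag_left hab]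
      simp only [smul_eq_mul, nsmul_eq_mul, MvPolynomial.smul_eq_C_mul, map_natCast,
        Nat.add_sub_cancel]
      ring
    rw [e, map_sub, map_add, hw, zero_add, map_smul, map_smul, ih, smul_zero, sub_zero,
      smul_eq_mul] at h
    exact (mul_eq_zero.1 h).resolve_left (Nat.cast_ne_zero.2 (Nat.succ_ne_zero i))

/-- An invariant functional on the symmetric algebra is determined by its values on the polynomials
in the diagonal matrix units. The invariance is only needed for the `e_ab` with `R a b`, when the
functional vanishes on the multiples of the other off-diagonal matrix units. -/
theorem eq_zero_of_diag_eq_zero [CharZero 𝕂] (Ψ : MvPolynomial (J × J) 𝕂 →ₗ[𝕂] 𝕂)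
    (R : J → J → Prop) (hL : ∀ a b, a ≠ b → R a b → ∀ f, Ψ (adDer 𝕂 a b f) = 0)
    (hR : ∀ a b, a ≠ b → ¬R a b → ∀ f, Ψ (X (a, b) * f) = 0)
    (hdiag : ∀ d, Ψ (diag 𝕂 d) = 0) : Ψ = 0 := by
  have key : ∀ n (s : (J × J) →₀ ℕ), offDegree s ≤ n → Ψ (monomial s 1) = 0 := by
    intro n
    induction n with
    | zero =>
      intro s hs
      have hs' : ∀ p ∈ s.support, p.1 = p.2 := by
        intro p hp
        by_contra hne
        have e : s = Finsupp.single p (s p) + s.erase p := (Finsupp.single_add_erase p s).symm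
        rw [e, map_add, offDegree_single, if_neg hne] at hs
        exact Finsupp.mem_support_iff.1 hp (by omega)
      have e : monomial s (1 : 𝕂) = diag 𝕂 (∏ p ∈ s.support, X p.1 ^ s p) := by
        rw [monomial_eq, C_1, one_mul, map_prod, Finsupp.prod]
        refine Finset.prod_congr rfl fun p hp => ?_
        rw [map_pow, rename_X]
        congr 2
        exact Prod.ext rfl (hs' p hp).symm
      rw [e, hdiag]
    | succ n ih =>
      intro s hs
      by_cases hoff : ∃ p ∈ s.support, p.1 ≠ p.2
      swap
      · push Not at hoff
        apply ih
        have : offDegree s = 0 := by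
          rw [offDegree, Finsupp.weight_apply, Finsupp.sum]
          exact Finset.sum_eq_zero fun p hp => by simp [hoff p hp]
        omega
      obtain ⟨⟨a, b⟩, hp, hab⟩ := hoff
      replace hab : a ≠ b := hab
      have hsplit : s = Finsupp.single (a, b) 1 + (s - Finsupp.single (a, b) 1) := by
        rw [add_comm, tsub_add_cancel_of_le]
        rw [Finsupp.single_le_iff]
        exact Nat.one_le_iff_ne_zero.2 (Finsupp.mem_support_iff.1 hp)
      -- The factor `w` carries the remaining off-diagonal matrix units; `e_ab` does not raise
      -- their number, because `w` contains neither `X (a, a)` nor `X (b, b)`.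
      set r := s - Finsupp.single (a, b) 1 with hr
      set w := (r.erase (a, a)).erase (b, b) with hw
      have hrw : r = w + Finsupp.single (a, a) (r (a, a)) + Finsupp.single (b, b) (r (b, b)) := by
        have h1 := Finsupp.erase_add_single (a, a) r
        have h2 := Finsupp.erase_add_single (b, b) (r.erase (a, a))
        rw [Finsupp.erase_ne (fun e => hab (Prod.ext_iff.1 e).1.symm)] at h2
        rw [add_right_comm, hw, h2, h1]
      have hmon : monomial s (1 : 𝕂) =
          X (a, b) * monomial w 1 * X (a, a) ^ r (a, a) * X (b, b) ^ r (b, b) := by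
        conv_lhs => rw [hsplit, hrw]
        simp only [X_pow_eq_monomial]
        simp only [X, monomial_mul, mul_one, add_assoc]
      rw [hmon]
      by_cases hRab : R a b
      swap
      · rw [mul_assoc, mul_assoc]; exact hR a b hab hRab _
      refine mul_offDiag_eq_zero Ψ hab (hL a b hab hRab) _ ?_ _ _
      intro i j
      have hwn : offDegree w ≤ n := by
        have h1 := congrArg offDegree hsplit
        rw [hrw] at h1
        simp only [map_add, offDegree_single, if_neg hab, if_true] at h1
        omega
      have hterm : ∀ p ∈ w.support, ∀ p' : J × J, p.1 ≠ p.2 →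
          Ψ (monomial (w - Finsupp.single p 1) ((w p : ℕ) : 𝕂) * X p' * X (a, a) ^ j *
            X (b, b) ^ i) = 0 := by
        intro p hpw p' hpp
        have e : monomial (w - Finsupp.single p 1) ((w p : ℕ) : 𝕂) * X p' * X (a, a) ^ j *
            X (b, b) ^ i = ((w p : ℕ) : 𝕂) • monomial (w - Finsupp.single p 1 +
              Finsupp.single p' 1 + Finsupp.single (a, a) j + Finsupp.single (b, b) i) 1 := by
          simp only [X_pow_eq_monomial]
          simp only [X, monomial_mul, mul_one, smul_monomial, smul_eq_mul]
        rw [e, map_smul, ih, smul_zero]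
        have h1 : w - Finsupp.single p 1 + Finsupp.single p 1 = w := by
          rw [tsub_add_cancel_of_le]
          rw [Finsupp.single_le_iff]
          exact Nat.one_le_iff_ne_zero.2 (Finsupp.mem_support_iff.1 hpw)
        have h2 := congrArg offDegree h1
        simp only [map_add, offDegree_single, if_neg hpp, if_true] at h2 ⊢
        split_ifs <;> omega
      rw [adDer, mkDerivation_monomial, Finsupp.sum, Finset.smul_sum, Finset.sum_mul,
        Finset.sum_mul, map_sum]
      refine Finset.sum_eq_zero fun p hpw => ?_
      have hwa : w (a, a) = 0 := by
        rw [hw, Finsupp.erase_ne (fun e => hab (Prod.ext_iff.1 e).1), Finsupp.erase_same]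
      have hwb : w (b, b) = 0 := by rw [hw, Finsupp.erase_same]
      have hpw' := Finsupp.mem_support_iff.1 hpw
      rw [one_smul, smul_eq_mul, mul_sub, sub_mul, sub_mul, map_sub]
      have e1 : Ψ (monomial (w - Finsupp.single p 1) ((w p : ℕ) : 𝕂) *
          (if b = p.1 then X (a, p.2) else 0) * X (a, a) ^ j * X (b, b) ^ i) = 0 := by
        split_ifs with hb
        · refine hterm p hpw _ fun hpp => hpw' ?_
          rw [← hwb]; congr 1; exact Prod.ext hb.symm (hpp.symm.trans hb.symm)
        · simp
      have e2 : Ψ (monomial (w - Finsupp.single p 1) ((w p : ℕ) : 𝕂) *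
          (if p.2 = a then X (p.1, b) else 0) * X (a, a) ^ j * X (b, b) ^ i) = 0 := by
        split_ifs with ha
        · refine hterm p hpw _ fun hpp => hpw' ?_
          rw [← hwa]; congr 1; exact Prod.ext (hpp.trans ha) ha
        · simp
      rw [e1, e2, sub_zero]
  refine (basisMonomials (J × J) 𝕂).ext fun s => ?_
  rw [coe_basisMonomials, key _ s le_rfl, LinearMap.zero_apply]

end Restriction

/-! ### Principal minors -/

section Minors

theorem derivation_prod {R A ι : Type*} [CommRing R] [CommRing A] [Algebra R A] [DecidableEq ι]
    (D : Derivation R A A) (s : Finset ι) (f : ι → A) :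
    D (∏ i ∈ s, f i) = ∑ i ∈ s, (∏ j ∈ s.erase i, f j) * D (f i) := by
  induction s using Finset.induction_on with
  | empty => simp
  | insert a s ha ih =>
    rw [Finset.prod_insert ha, Derivation.leibniz, ih, Finset.sum_insert ha,
      Finset.erase_insert ha, smul_eq_mul, smul_eq_mul, Finset.mul_sum, add_comm]
    congr 1
    refine Finset.sum_congr rfl fun i hi => ?_
    have hia : a ≠ i := fun e => ha (e ▸ hi)
    rw [Finset.erase_insert_of_ne hia,
      Finset.prod_insert (fun h => ha (Finset.mem_of_mem_erase h)), mul_assoc]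

/-- Jacobi's formula for a derivation. -/
theorem derivation_det {R A ι : Type*} [CommRing R] [CommRing A] [Algebra R A] [Fintype ι]
    [DecidableEq ι] (D : Derivation R A A) (M : Matrix ι ι A) :
    D M.det = ∑ b, ∑ a, M.adjugate b a * D (M a b) := by
  have h : ∀ b, ∑ a, M.adjugate b a * D (M a b) =
      (M.updateCol b fun a => D (M a b)).det := by
    intro b
    rw [← Matrix.cramer_apply, Matrix.cramer_eq_adjugate_mulVec]
    rfl
  simp only [h, Matrix.det_apply, map_sum]
  rw [Finset.sum_comm]
  refine Finset.sum_congr rfl fun σ _ => ?_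
  rw [Units.smul_def, map_zsmul, derivation_prod, Finset.smul_sum]
  refine Finset.sum_congr rfl fun b _ => ?_
  rw [Units.smul_def, ← Finset.prod_erase_mul _ _ (Finset.mem_univ b), Matrix.updateCol_self]
  congr 2
  refine Finset.prod_congr rfl fun j hj => ?_
  rw [Matrix.updateCol_ne (Finset.ne_of_mem_erase hj)]

variable {𝕂 : Type*} [Field 𝕂] {B : Type*} [DecidableEq B]

/-- The generic matrix on `S`, extended by the identity. -/
def minorMatrix (𝕂 : Type*) [Field 𝕂] (S : Finset B) : Matrix B B (MvPolynomial (B × B) 𝕂) :=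
  Matrix.of fun a b => if a ∈ S ∧ b ∈ S then X (a, b) else if a = b then 1 else 0

theorem minorMatrix_mem {S : Finset B} {a b : B} (ha : a ∈ S) (hb : b ∈ S) :
    minorMatrix 𝕂 S a b = X (a, b) := by
  rw [minorMatrix, Matrix.of_apply, if_pos ⟨ha, hb⟩]

theorem minorMatrix_left {S : Finset B} {a : B} (ha : a ∉ S) (b : B) :
    minorMatrix 𝕂 S a b = if a = b then 1 else 0 := by
  rw [minorMatrix, Matrix.of_apply, if_neg (fun h => ha h.1)]

theorem minorMatrix_right {S : Finset B} {b : B} (a : B) (hb : b ∉ S) :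
    minorMatrix 𝕂 S a b = if a = b then 1 else 0 := by
  rw [minorMatrix, Matrix.of_apply, if_neg (fun h => hb h.2)]

variable [Fintype B]

/-- The principal minor of the generic matrix on `S`. -/
def minor (𝕂 : Type*) [Field 𝕂] (S : Finset B) : MvPolynomial (B × B) 𝕂 := (minorMatrix 𝕂 S).det

theorem minor_empty : minor 𝕂 (∅ : Finset B) = 1 := by
  have : minorMatrix 𝕂 (∅ : Finset B) = 1 := by
    ext1 a b
    rw [minorMatrix_left (Finset.notMem_empty a), Matrix.one_apply]
  rw [minor, this, Matrix.det_one]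

/-- A matrix that agrees with the generic one on `S` and has multiples of unit vectors as its other
rows: its determinant is a multiple of the principal minor. -/
theorem det_eq_pow_mul_minor (S : Finset B) (e : MvPolynomial (B × B) 𝕂)
    (M : Matrix B B (MvPolynomial (B × B) 𝕂)) (h1 : ∀ a ∈ S, ∀ b ∈ S, M a b = X (a, b))
    (h2 : ∀ a ∉ S, ∀ b, M a b = if a = b then e else 0) :
    M.det = e ^ Sᶜ.card * minor 𝕂 S := by
  have h3 : ∀ (e' : MvPolynomial (B × B) 𝕂) (M' : Matrix B B (MvPolynomial (B × B) 𝕂)),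
      (∀ a ∉ S, ∀ b, M' a b = if a = b then e' else 0) →
      M'.det = (M'.toSquareBlockProp (· ∈ S)).det * e' ^ Sᶜ.card := by
    intro e' M' hM'
    rw [Matrix.twoBlockTriangular_det M' (· ∈ S)
      (fun a ha b hb => by rw [hM' a ha, if_neg (fun h : a = b => ha (h ▸ hb))])]
    have : M'.toSquareBlockProp (fun a => ¬a ∈ S) = Matrix.diagonal fun _ => e' := by
      ext1 a b
      rw [Matrix.toSquareBlockProp_def, Matrix.of_apply, hM' a a.2, Matrix.diagonal_apply]
      simp only [Subtype.ext_iff]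
    have hcard : Fintype.card {a // ¬a ∈ S} = Sᶜ.card := by
      rw [Fintype.card_subtype]
      congr 1
      ext a
      simp
    rw [this, Matrix.det_diagonal, Finset.prod_const, Finset.card_univ, hcard]
    congr!
  rw [h3 e M h2, minor, h3 1 (minorMatrix 𝕂 S) (fun a ha b => minorMatrix_left ha b), one_pow,
    mul_one, mul_comm]
  congr 2
  ext1 a b
  rw [Matrix.toSquareBlockProp_def, Matrix.of_apply, Matrix.toSquareBlockProp_def, Matrix.of_apply,
    h1 a a.2 b b.2, minorMatrix_mem a.2 b.2]

/-- The minor without `c` is the cofactor of the entry `(c, c)`. -/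
theorem det_updateRow_minorMatrix {S : Finset B} (c : B) :
    ((minorMatrix 𝕂 S).updateRow c (Pi.single c 1)).det = minor 𝕂 (S.erase c) := by
  rw [det_eq_pow_mul_minor (S.erase c) 1, one_pow, one_mul]
  · intro a ha b hb
    rw [Matrix.updateRow_ne (Finset.ne_of_mem_erase ha),
      minorMatrix_mem (Finset.mem_of_mem_erase ha) (Finset.mem_of_mem_erase hb)]
  · intro a ha b
    by_cases hac : a = c
    · subst hac
      rw [Matrix.updateRow_self, Pi.single_apply]
      simp only [eq_comm]
    · rw [Matrix.updateRow_ne hac, minorMatrix_left (fun h => ha (Finset.mem_erase.2 ⟨hac, h⟩))]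

/-- The cofactor of the entry `(c, m)` in the generic matrix on `S`. -/
def cofactor (𝕂 : Type*) [Field 𝕂] (S : Finset B) (c m : B) : MvPolynomial (B × B) 𝕂 :=
  ((minorMatrix 𝕂 S).updateRow c (Pi.single m 1)).det

/-- Laplace expansion along the column `m`. -/
theorem minor_eq_sum {S : Finset B} {m : B} (hm : m ∈ S) :
    minor 𝕂 S = X (m, m) * minor 𝕂 (S.erase m) +
      ∑ c ∈ S.erase m, X (c, m) * cofactor 𝕂 S c m := by
  rw [minor, Matrix.det_eq_sum_mul_adjugate_col _ m]
  simp only [Matrix.adjugate_apply]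
  rw [← Finset.sum_subset (Finset.subset_univ S), ← Finset.add_sum_erase _ _ hm,
    det_updateRow_minorMatrix, minorMatrix_mem hm hm]
  · congr 1
    refine Finset.sum_congr rfl fun c hc => ?_
    rw [minorMatrix_mem (Finset.mem_of_mem_erase hc) hm, cofactor]
  · intro c _ hc
    rw [minorMatrix_left hc, if_neg (fun h : c = m => hc (h ▸ hm)), zero_mul]

theorem adDer_cofactor {S : Finset B} {c m : B} (hc : c ∈ S) (hm : m ∈ S) (hcm : c ≠ m) :
    adDer 𝕂 c m (cofactor 𝕂 S c m) = minor 𝕂 (S.erase c) - minor 𝕂 (S.erase m) := by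
  set M := (minorMatrix 𝕂 S).updateRow c (Pi.single m 1) with hM
  have hMc : ∀ b, M c b = if m = b then 1 else 0 := by
    intro b
    rw [hM, Matrix.updateRow_self, Pi.single_apply]
    simp only [eq_comm]
  have hMne : ∀ a, a ≠ c → ∀ b, M a b = minorMatrix 𝕂 S a b := by
    intro a ha b
    rw [hM, Matrix.updateRow_ne ha]
  -- The derivation adds row `c` of the generic matrix to row `m`, and subtracts column `m` from
  -- column `c`, apart from the constant row `c`.
  have hD : ∀ a b, adDer 𝕂 c m (M a b) = (if a = m then minorMatrix 𝕂 S c b else 0) -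
      (if b = c then M a m - (if a = c then 1 else 0) else 0) := by
    intro a b
    by_cases hac : a = c
    · subst hac
      rw [hMc, if_neg hcm, if_pos rfl, hMc, if_pos rfl, sub_self]
      split_ifs <;> simp
    · rw [hMne a hac, hMne a hac, if_neg hac, sub_zero]
      by_cases haS : a ∈ S
      · by_cases hbS : b ∈ S
        · rw [minorMatrix_mem haS hbS, minorMatrix_mem hc hbS, minorMatrix_mem haS hm, adDer_X]
          simp only [eq_comm]
        · rw [minorMatrix_right a hbS, minorMatrix_right c hbS,
            if_neg (fun h : b = c => hbS (h ▸ hc)), if_neg (fun h : a = b => hbS (h ▸ haS)),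
            if_neg (fun h : c = b => hbS (h ▸ hc))]
          simp
      · rw [minorMatrix_left haS, minorMatrix_left haS]
        have ham : a ≠ m := fun h => haS (h ▸ hm)
        simp only [if_neg ham, ite_self, sub_zero]
        split_ifs <;> simp
  have hrow : ∑ b, M.adjugate b m * minorMatrix 𝕂 S c b = -minor 𝕂 (S.erase m) := by
    have e : ∑ b, M.adjugate b m * minorMatrix 𝕂 S c b =
        (M.updateRow m (minorMatrix 𝕂 S c)).det := by
      rw [Matrix.det_eq_sum_mul_adjugate_row _ m]
      refine Finset.sum_congr rfl fun b _ => ?_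
      rw [Matrix.updateRow_self, Matrix.adjugate_apply, Matrix.adjugate_apply,
        Matrix.updateRow_idem, mul_comm]
    rw [e, ← det_updateRow_minorMatrix m, hM]
    have e' : ((minorMatrix 𝕂 S).updateRow c (Pi.single m 1)).updateRow m (minorMatrix 𝕂 S c) =
        ((minorMatrix 𝕂 S).updateRow m (Pi.single m 1)).submatrix (Equiv.swap c m) id := by
      ext1 a b
      rw [Matrix.submatrix_apply]
      by_cases ham : a = m
      · subst ham
        rw [Equiv.swap_apply_right, Matrix.updateRow_self, Matrix.updateRow_ne hcm, id]
      · by_cases hac : a = c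
        · subst hac
          rw [Equiv.swap_apply_left, Matrix.updateRow_self, Matrix.updateRow_ne hcm,
            Matrix.updateRow_self, id]
        · rw [Equiv.swap_apply_of_ne_of_ne hac ham, Matrix.updateRow_ne ham,
            Matrix.updateRow_ne hac, Matrix.updateRow_ne ham, id]
    rw [e', Matrix.det_permute, Equiv.Perm.sign_swap hcm]
    simp
  have hcol : ∑ a, M.adjugate c a * (M a m - if a = c then 1 else 0) = -minor 𝕂 (S.erase c) := by
    have e1 : ∑ a, M.adjugate c a * M a m = 0 := by
      have := congrFun (congrFun (Matrix.adjugate_mul M) c) m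
      rw [Matrix.mul_apply] at this
      rw [this, Matrix.smul_apply, Matrix.one_apply_ne hcm, smul_zero]
    have e2 : M.adjugate c c = minor 𝕂 (S.erase c) := by
      rw [Matrix.adjugate_apply, hM, Matrix.updateRow_idem, det_updateRow_minorMatrix]
    simp only [mul_sub, Finset.sum_sub_distrib, e1, mul_ite, mul_one, mul_zero,
      Finset.sum_ite_eq', Finset.mem_univ, if_true, e2, zero_sub]
  have hdet : cofactor 𝕂 S c m = M.det := rfl
  have hsplit : ∀ b, ∑ a, M.adjugate b a * adDer 𝕂 c m (M a b) =
      M.adjugate b m * minorMatrix 𝕂 S c b -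
        if b = c then ∑ a, M.adjugate c a * (M a m - if a = c then 1 else 0) else 0 := by
    intro b
    have e1 : ∑ a, M.adjugate b a * (if a = m then minorMatrix 𝕂 S c b else 0) =
        M.adjugate b m * minorMatrix 𝕂 S c b := by
      simp only [mul_ite, mul_zero, Finset.sum_ite_eq', Finset.mem_univ, if_true]
    have e2 : ∑ a, M.adjugate b a * (if b = c then M a m - (if a = c then 1 else 0) else 0) =
        if b = c then ∑ a, M.adjugate c a * (M a m - if a = c then 1 else 0) else 0 := by
      by_cases h : b = c
      · subst h
        simp only [if_true]
      · simp only [if_neg h, mul_zero, Finset.sum_const_zero]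
    rw [← e1, ← e2, ← Finset.sum_sub_distrib]
    refine Finset.sum_congr rfl fun a _ => ?_
    rw [hD, mul_sub]
  rw [hdet, derivation_det, Finset.sum_congr rfl fun b _ => hsplit b, Finset.sum_sub_distrib, hrow,
    Finset.sum_ite_eq', if_pos (Finset.mem_univ c), hcol]
  ring

end Minors

/-! ### The determinant of the generic matrix plus its trace -/

section Trace

variable {𝕂 : Type*} [Field 𝕂] {B : Type*} [DecidableEq B]

/-- The sum of the diagonal matrix units. -/
def traceVar (𝕂 : Type*) [Field 𝕂] (B : Type*) [Fintype B] :
    MvPolynomial (B × B) 𝕂 :=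
  ∑ b, X (b, b)

theorem adDer_traceVar [Fintype B] (a b : B) : adDer 𝕂 a b (traceVar 𝕂 B) = 0 := by
  simp only [traceVar, map_sum, adDer_X, Finset.sum_sub_distrib, Finset.sum_ite_eq,
    Finset.sum_ite_eq', Finset.mem_univ, if_true, sub_self]

/-- The substitution that kills the variables with an index outside `S`. -/
def restrictTo (𝕂 : Type*) [Field 𝕂] (S : Finset B) :
    MvPolynomial (B × B) 𝕂 →ₐ[𝕂] MvPolynomial (B × B) 𝕂 :=
  aeval fun p => if p.1 ∈ S ∧ p.2 ∈ S then X p else 0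

theorem restrictTo_X (S : Finset B) (a b : B) :
    restrictTo 𝕂 S (X (a, b)) = if a ∈ S ∧ b ∈ S then X (a, b) else 0 := by
  rw [restrictTo, aeval_X]

theorem restrictTo_minor [Fintype B] (S : Finset B) : restrictTo 𝕂 S (minor 𝕂 S) = minor 𝕂 S := by
  rw [minor, AlgHom.map_det]
  congr 1
  ext1 a b
  rw [AlgHom.mapMatrix_apply, Matrix.map_apply, minorMatrix, Matrix.of_apply]
  split_ifs with h h'
  · rw [restrictTo_X, if_pos h]
  · rw [map_one]
  · rw [map_zero]

theorem restrictTo_adDer {S : Finset B} {a b : B} (ha : a ∈ S) (hb : b ∈ S)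
    (f : MvPolynomial (B × B) 𝕂) :
    restrictTo 𝕂 S (adDer 𝕂 a b f) = adDer 𝕂 a b (restrictTo 𝕂 S f) := by
  induction f using MvPolynomial.induction_on with
  | C c => rw [derivation_C, map_zero, restrictTo, aeval_C, MvPolynomial.algebraMap_eq,
      derivation_C]
  | add f f' hf hf' => simp only [map_add, hf, hf']
  | mul_X f p hf =>
    obtain ⟨c, d⟩ := p
    have hX : restrictTo 𝕂 S (adDer 𝕂 a b (X (c, d))) =
        adDer 𝕂 a b (restrictTo 𝕂 S (X (c, d))) := by
      rw [adDer_X, restrictTo_X, map_sub, apply_ite (restrictTo 𝕂 S), apply_ite (restrictTo 𝕂 S),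
        restrictTo_X, restrictTo_X, map_zero, apply_ite (adDer 𝕂 a b), adDer_X, map_zero]
      by_cases hbc : b = c
      · subst hbc
        by_cases hda : d = a
        · subst hda
          simp [ha, hb]
        · simp [ha, hb, hda]
      · by_cases hda : d = a
        · subst hda
          simp only [if_neg hbc, ha, hb, if_true, and_true, zero_sub]
          split_ifs <;> simp
        · simp [hbc, hda]
    rw [Derivation.leibniz, map_add, map_mul, Derivation.leibniz]
    simp only [smul_eq_mul, map_mul, hf, hX]

theorem constantCoeff_adDer (a b : B) (f : MvPolynomial (B × B) 𝕂) :
    constantCoeff (adDer 𝕂 a b f) = 0 := by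
  induction f using MvPolynomial.induction_on with
  | C c => rw [derivation_C, map_zero]
  | add f f' hf hf' => rw [map_add, map_add, hf, hf', add_zero]
  | mul_X f p hf =>
    obtain ⟨c, d⟩ := p
    rw [Derivation.leibniz, adDer_X, smul_eq_mul, smul_eq_mul, map_add, map_mul, map_mul, hf,
      mul_zero, add_zero, map_sub]
    split_ifs <;> simp

theorem constantCoeff_minor [Fintype B] {S : Finset B} (hS : S.Nonempty) :
    constantCoeff (minor 𝕂 S) = 0 := by
  obtain ⟨c, hc⟩ := hS
  rw [minor, RingHom.map_det]
  apply Matrix.det_eq_zero_of_row_eq_zero c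
  intro b
  rw [RingHom.mapMatrix_apply, Matrix.map_apply, minorMatrix, Matrix.of_apply]
  split_ifs with h h'
  · simp
  · exact absurd ⟨hc, h' ▸ hc⟩ h
  · simp

section Block

variable [Fintype B] [CharZero 𝕂] {Ψ : MvPolynomial (B × B) 𝕂 →ₗ[𝕂] 𝕂}
  (hL : ∀ a b, a ≠ b → ∀ f, Ψ (adDer 𝕂 a b f) = 0)
  (hcross : ∀ a b, a ≠ b → ∀ d, Ψ (X (a, a) * X (b, b) * diag 𝕂 d) = 0)
include hL hcross

/-- A principal minor away from a diagonal factor does not contribute: the restriction theorem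
turns it into diagonal monomials in several distinct indices. -/
theorem map_diag_mul_minor_eq_zero {S : Finset B} (hS : S.Nonempty) {m : B} (hm : m ∉ S) (a t : ℕ) :
    Ψ (X (m, m) ^ (a + 1) * traceVar 𝕂 B ^ t * minor 𝕂 S) = 0 := by
  set u := X (m, m) ^ (a + 1) * traceVar 𝕂 B ^ t with hu
  set Ψ' : MvPolynomial (B × B) 𝕂 →ₗ[𝕂] 𝕂 := Ψ ∘ₗ LinearMap.mulLeft 𝕂 u ∘ₗ
    (restrictTo 𝕂 S).toLinearMap ∘ₗ (LinearMap.id - (Algebra.linearMap 𝕂 _) ∘ₗ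
      (aeval (R := 𝕂) (fun _ : B × B => (0 : 𝕂))).toLinearMap) with hΨ'
  have hval : ∀ f, Ψ' f = Ψ (u * restrictTo 𝕂 S (f - C (constantCoeff f))) := by
    intro f
    rw [constantCoeff_eq, ← MvPolynomial.algebraMap_eq]
    simp [hΨ', constantCoeff_eq]
  have hLu : ∀ c ∈ S, ∀ d ∈ S, adDer 𝕂 c d u = 0 := by
    intro c hc d hd
    rw [hu, Derivation.leibniz, Derivation.leibniz_pow, Derivation.leibniz_pow, adDer_traceVar,
      adDer_X_diag_other (fun h : m = c => hm (h ▸ hc)) (fun h : m = d => hm (h ▸ hd))]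
    simp
  have hzero : Ψ' = 0 := by
    refine eq_zero_of_diag_eq_zero Ψ' (fun c d => c ∈ S ∧ d ∈ S) ?_ ?_ ?_
    · rintro c d hcd ⟨hc, hd⟩ f
      rw [hval, constantCoeff_adDer, C_0, sub_zero, restrictTo_adDer hc hd]
      have := hL c d hcd (u * restrictTo 𝕂 S f)
      rwa [Derivation.leibniz, hLu c hc d hd, smul_zero, add_zero, smul_eq_mul] at this
    · intro c d _ hcd f
      rw [hval, map_mul constantCoeff, constantCoeff_X, zero_mul, C_0, sub_zero,
        map_mul (restrictTo 𝕂 S), restrictTo_X,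
        if_neg hcd, zero_mul, mul_zero, map_zero]
    · intro d
      induction d using MvPolynomial.induction_on with
      | C c => rw [hval, rename_C, constantCoeff_C, sub_self, map_zero, mul_zero, map_zero]
      | add d d' h h' => rw [map_add, map_add, h, h', add_zero]
      | mul_X d c _ =>
        rw [hval, map_mul (diag 𝕂), rename_X, map_mul constantCoeff, constantCoeff_X, mul_zero, C_0,
          sub_zero, map_mul (restrictTo 𝕂 S), restrictTo_X]
        split_ifs with hc
        · have e : restrictTo 𝕂 S (diag 𝕂 d) =
              diag 𝕂 (aeval (fun b => if b ∈ S then X b else 0) d) := by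
            rw [← AlgHom.comp_apply, ← AlgHom.comp_apply]
            congr 1
            refine algHom_ext fun b => ?_
            rw [AlgHom.comp_apply, AlgHom.comp_apply, rename_X, restrictTo_X, aeval_X]
            simp only [and_self]
            split_ifs
            · rw [rename_X]
            · rw [map_zero]
          have e' : u * (restrictTo 𝕂 S (diag 𝕂 d) * X (c, c)) = X (m, m) * X (c, c) *
              diag 𝕂 (X m ^ a * (∑ b, X b) ^ t * aeval (fun b => if b ∈ S then X b else 0) d) := by
            rw [e, hu, traceVar]
            simp only [map_mul, map_pow, map_sum, rename_X]
            ring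
          rw [e', hcross m c (fun h => hm (h ▸ hc.1))]
        · rw [mul_zero, mul_zero, map_zero]
  have := hval (minor 𝕂 S)
  rw [hzero, constantCoeff_minor hS, C_0, sub_zero, restrictTo_minor, LinearMap.zero_apply] at this
  exact this.symm

/-- Principal minors reduce to powers of one diagonal matrix unit. -/
theorem choose_mul_map_minor (n : ℕ) : ∀ (S : Finset B) (m : B) (a t : ℕ), S.card = n + 1 → m ∈ S →
    ((n + a).choose a : 𝕂) * Ψ (X (m, m) ^ a * traceVar 𝕂 B ^ t * minor 𝕂 S) =
      (-1) ^ n * Ψ (X (m, m) ^ (a + n + 1) * traceVar 𝕂 B ^ t) := by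
  induction n with
  | zero =>
    intro S m a t hS hm
    have hempty : S.erase m = ∅ := by
      rw [← Finset.card_eq_zero, Finset.card_erase_of_mem hm, hS]
    rw [minor_eq_sum hm, hempty, minor_empty, Finset.sum_empty]
    simp only [zero_add, Nat.choose_self, Nat.cast_one, one_mul, pow_zero, mul_one, add_zero]
    congr 1
    ring
  | succ n ih =>
    intro S m a t hS hm
    have hcard : ∀ c ∈ S, (S.erase c).card = n + 1 := by
      intro c hc
      rw [Finset.card_erase_of_mem hc, hS]
      rfl
    have hne : ∀ c ∈ S, (S.erase c).Nonempty := by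
      intro c hc
      rw [← Finset.card_pos, hcard c hc]
      exact Nat.succ_pos n
    have hkill : Ψ (X (m, m) ^ (a + 1) * traceVar 𝕂 B ^ t * minor 𝕂 (S.erase m)) = 0 :=
      map_diag_mul_minor_eq_zero hL hcross (hne m hm) (Finset.notMem_erase m S) a t
    -- Apply the invariance under `e_cm` to the cofactor of the entry `(c, m)`.
    have hstep : ∀ c ∈ S.erase m, ((a + 1 : ℕ) : 𝕂) *
        Ψ (X (m, m) ^ a * traceVar 𝕂 B ^ t * (X (c, m) * cofactor 𝕂 S c m)) =
        -Ψ (X (m, m) ^ (a + 1) * traceVar 𝕂 B ^ t * minor 𝕂 (S.erase c)) := by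
      intro c hc
      have hcm := Finset.ne_of_mem_erase hc
      have hcS := Finset.mem_of_mem_erase hc
      have h := hL c m hcm (X (m, m) ^ (a + 1) * traceVar 𝕂 B ^ t * cofactor 𝕂 S c m)
      have e : adDer 𝕂 c m (X (m, m) ^ (a + 1) * traceVar 𝕂 B ^ t * cofactor 𝕂 S c m) =
          ((a + 1 : ℕ) : 𝕂) • (X (m, m) ^ a * traceVar 𝕂 B ^ t * (X (c, m) * cofactor 𝕂 S c m)) +
          X (m, m) ^ (a + 1) * traceVar 𝕂 B ^ t * minor 𝕂 (S.erase c) -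
          X (m, m) ^ (a + 1) * traceVar 𝕂 B ^ t * minor 𝕂 (S.erase m) := by
        rw [Derivation.leibniz, Derivation.leibniz, Derivation.leibniz_pow, Derivation.leibniz_pow,
          adDer_traceVar, adDer_X_diag_right hcm, adDer_cofactor hcS hm hcm]
        simp only [smul_eq_mul, nsmul_eq_mul, MvPolynomial.smul_eq_C_mul, map_natCast,
          Nat.add_sub_cancel]
        ring
      rw [e, map_sub, map_add, hkill, sub_zero, map_smul, smul_eq_mul] at h
      exact eq_neg_of_add_eq_zero_left h
    have hsum : ((a + 1 : ℕ) : 𝕂) * Ψ (X (m, m) ^ a * traceVar 𝕂 B ^ t * minor 𝕂 S) =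
        -∑ c ∈ S.erase m, Ψ (X (m, m) ^ (a + 1) * traceVar 𝕂 B ^ t * minor 𝕂 (S.erase c)) := by
      have e : X (m, m) ^ a * traceVar 𝕂 B ^ t * minor 𝕂 S =
          X (m, m) ^ (a + 1) * traceVar 𝕂 B ^ t * minor 𝕂 (S.erase m) +
          ∑ c ∈ S.erase m, X (m, m) ^ a * traceVar 𝕂 B ^ t * (X (c, m) * cofactor 𝕂 S c m) := by
        rw [minor_eq_sum hm, mul_add, Finset.mul_sum]
        ring
      rw [e, map_add, hkill, zero_add, map_sum, Finset.mul_sum, Finset.sum_congr rfl hstep,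
        Finset.sum_neg_distrib]
    have hih : ∀ c ∈ S.erase m, ((n + (a + 1)).choose (a + 1) : 𝕂) *
        Ψ (X (m, m) ^ (a + 1) * traceVar 𝕂 B ^ t * minor 𝕂 (S.erase c)) =
        (-1) ^ n * Ψ (X (m, m) ^ (a + (n + 1) + 1) * traceVar 𝕂 B ^ t) := by
      intro c hc
      rw [ih (S.erase c) m (a + 1) t (hcard c (Finset.mem_of_mem_erase hc))
        (Finset.mem_erase.2 ⟨(Finset.ne_of_mem_erase hc).symm, hm⟩)]
      congr 4
      ring
    have h1 : ((n + 1 : ℕ) : 𝕂) * (((n + 1 + a).choose a : 𝕂) *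
        Ψ (X (m, m) ^ a * traceVar 𝕂 B ^ t * minor 𝕂 S)) = ((n + 1 : ℕ) : 𝕂) *
        ((-1) ^ (n + 1) * Ψ (X (m, m) ^ (a + (n + 1) + 1) * traceVar 𝕂 B ^ t)) := by
      have hch : ((n + (a + 1)).choose (a + 1) : 𝕂) * ((a + 1 : ℕ) : 𝕂) =
          ((n + 1 + a).choose a : 𝕂) * ((n + 1 : ℕ) : 𝕂) := by
        rw [← Nat.cast_mul, ← Nat.cast_mul, Nat.choose_succ_right_eq]
        congr 3 <;> omega
      have h2 := congrArg (((n + (a + 1)).choose (a + 1) : 𝕂) * ·) hsum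
      simp only [mul_neg, Finset.mul_sum] at h2
      rw [Finset.sum_congr rfl hih, Finset.sum_const, hcard m hm, ← mul_assoc, hch,
        nsmul_eq_mul] at h2
      rw [← mul_assoc, mul_comm ((n + 1 : ℕ) : 𝕂), h2, pow_succ]
      ring
    exact mul_left_cancel₀ (Nat.cast_ne_zero.2 (Nat.succ_ne_zero n)) h1

omit hL in
omit [CharZero 𝕂] in
theorem map_pow_mul_trace_pow (m : B) (p t : ℕ) :
    Ψ (X (m, m) ^ (p + 1) * traceVar 𝕂 B ^ t) = Ψ (X (m, m) ^ (p + 1 + t)) := by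
  induction t generalizing p with
  | zero => rw [pow_zero, mul_one, add_zero]
  | succ t ih =>
    have e : X (m, m) ^ (p + 1) * traceVar 𝕂 B ^ (t + 1) =
        X (m, m) ^ (p + 1 + 1) * traceVar 𝕂 B ^ t + ∑ b ∈ Finset.univ.erase m,
          X (m, m) * X (b, b) * diag 𝕂 (X m ^ p * (∑ b, X b) ^ t) := by
      have hE : traceVar 𝕂 B = X (m, m) + ∑ b ∈ Finset.univ.erase m, X (b, b) :=
        (Finset.add_sum_erase _ _ (Finset.mem_univ m)).symm
      have hd : diag 𝕂 (X m ^ p * (∑ b, X b) ^ t) = X (m, m) ^ p * traceVar 𝕂 B ^ t := by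
        simp only [map_mul, map_pow, map_sum, rename_X, traceVar]
      rw [hd, ← Finset.sum_mul, ← Finset.mul_sum]
      linear_combination (X (m, m) ^ (p + 1) * traceVar 𝕂 B ^ t) * hE
    rw [e, map_add, ih, map_sum, Finset.sum_eq_zero, add_zero]
    · congr 2; ring
    · exact fun b hb => hcross m b (Finset.ne_of_mem_erase hb).symm _

omit [CharZero 𝕂] in
theorem map_pow_eq_map_pow (a b : B) (p : ℕ) :
    Ψ (X (a, a) ^ (p + 1)) = Ψ (X (b, b) ^ (p + 1)) := by
  by_cases hab : a = b
  · rw [hab]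
  have h := hL a b hab (X (b, a) * traceVar 𝕂 B ^ p)
  have e : adDer 𝕂 a b (X (b, a) * traceVar 𝕂 B ^ p) =
      X (a, a) ^ (0 + 1) * traceVar 𝕂 B ^ p - X (b, b) ^ (0 + 1) * traceVar 𝕂 B ^ p := by
    rw [Derivation.leibniz, Derivation.leibniz_pow, adDer_traceVar, adDer_X, if_pos rfl, if_pos rfl]
    simp only [smul_eq_mul]
    ring
  rw [e, map_sub, map_pow_mul_trace_pow hcross, map_pow_mul_trace_pow hcross, sub_eq_zero] at h
  rw [add_comm p, h]

/-- The factor `n + 1` reflects that the tangent bundle of the projective space `ℙⁿ` is stably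
`(n + 1) 𝒪(1)`, so that the `n`-th power sum of its Chern roots has the value `n + 1` on `ℙⁿ`. -/
theorem map_det_add_trace (b : B) :
    Ψ (Matrix.det (Matrix.of fun c d => (X (c, d) : MvPolynomial (B × B) 𝕂) +
      if c = d then traceVar 𝕂 B else 0)) =
      ((Fintype.card B : 𝕂) + 1) * Ψ (X (b, b) ^ Fintype.card B) := by
  obtain ⟨n, hn⟩ : ∃ n, Fintype.card B = n + 1 :=
    ⟨Fintype.card B - 1, by have := Fintype.card_pos_iff.2 ⟨b⟩; omega⟩
  have hexp : Matrix.det (Matrix.of fun c d => (X (c, d) : MvPolynomial (B × B) 𝕂) +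
      if c = d then traceVar 𝕂 B else 0) =
      ∑ S : Finset B, traceVar 𝕂 B ^ Sᶜ.card * minor 𝕂 S := by
    have h := Matrix.detRowAlternating.map_add_univ
      (fun c d => (X (c, d) : MvPolynomial (B × B) 𝕂))
      (fun c d => if c = d then traceVar 𝕂 B else 0)
    refine Eq.trans ?_ (h.trans (Finset.sum_congr rfl fun S _ => ?_))
    · rfl
    · refine det_eq_pow_mul_minor S _ _ ?_ ?_
      · intro c hc d _
        simp [Finset.piecewise_eq_of_mem _ _ _ hc]
      · intro c hc d
        simp [Finset.piecewise_eq_of_notMem _ _ _ hc]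
  set θ := Ψ (X (b, b) ^ Fintype.card B) with hθ
  have hterm : ∀ S : Finset B, Ψ (traceVar 𝕂 B ^ Sᶜ.card * minor 𝕂 S) =
      (if S = ∅ then ((Fintype.card B : 𝕂) + 1) * θ else 0) - (-1) ^ S.card * θ := by
    intro S
    by_cases hS : S = ∅
    · subst hS
      rw [if_pos rfl, minor_empty, mul_one, Finset.compl_empty, Finset.card_univ, hn, pow_succ']
      nth_rewrite 1 [traceVar]
      rw [Finset.sum_mul, map_sum]
      have : ∀ c, Ψ (X (c, c) * traceVar 𝕂 B ^ n) = θ := by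
        intro c
        have h := map_pow_mul_trace_pow hcross c 0 n
        rw [zero_add, pow_one, add_comm 1 n] at h
        rw [h, map_pow_eq_map_pow hL hcross c b, hθ, hn]
      simp only [this, Finset.sum_const, Finset.card_univ, hn, nsmul_eq_mul, Finset.card_empty,
        pow_zero, one_mul]
      ring
    · rw [if_neg hS, zero_sub]
      obtain ⟨m, hm⟩ := Finset.nonempty_iff_ne_empty.2 hS
      obtain ⟨r, hr⟩ : ∃ r, S.card = r + 1 :=
        ⟨S.card - 1, by have := Finset.card_pos.2 ⟨m, hm⟩; omega⟩
      have h := choose_mul_map_minor hL hcross r S m 0 Sᶜ.card hr hm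
      rw [add_zero, Nat.choose_zero_right, Nat.cast_one, one_mul, pow_zero, one_mul, zero_add,
        map_pow_mul_trace_pow hcross] at h
      have hcard : r + 1 + Sᶜ.card = n + 1 := by
        rw [← hr, Finset.card_add_card_compl, hn]
      rw [h, hcard, map_pow_eq_map_pow hL hcross m b, ← hn, hr, pow_succ]
      ring
  rw [hexp, map_sum, Finset.sum_congr rfl fun S _ => hterm S, Finset.sum_sub_distrib,
    Finset.sum_ite_eq', if_pos (Finset.mem_univ _), ← Finset.sum_mul]
  have hsign : ∑ S : Finset B, (-1 : 𝕂) ^ S.card = 0 := by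
    have := Finset.sum_powerset_neg_one_pow_card_of_nonempty (x := (Finset.univ : Finset B))
      ⟨b, Finset.mem_univ b⟩
    rw [Finset.powerset_univ] at this
    exact_mod_cast congrArg (Int.cast : ℤ → 𝕂) this
  rw [hsign, zero_mul, sub_zero]

end Block

end Trace

/-! ### Evaluation of the test determinants -/

section Blocks

variable {𝕂 : Type*} [Field 𝕂] {J : Type*} [DecidableEq J]

/-- The determinant of the generic matrix plus its trace, for the block of `gl_J` on the image of
`ι`. -/
def blockDet (𝕂 : Type*) [Field 𝕂] {J B : Type*} [DecidableEq B] [Fintype B] (ι : B → J) :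
    MvPolynomial (J × J) 𝕂 :=
  Matrix.det (Matrix.of fun c d => (X (ι c, ι d) : MvPolynomial (J × J) 𝕂) +
    if c = d then ∑ b, X (ι b, ι b) else 0)

omit [DecidableEq J] in
theorem blockDet_eq_rename {B : Type*} [DecidableEq B] [Fintype B] (ι : B → J) :
    blockDet 𝕂 ι = rename (Prod.map ι ι) (Matrix.det (Matrix.of fun c d =>
      (X (c, d) : MvPolynomial (B × B) 𝕂) + if c = d then traceVar 𝕂 B else 0)) := by
  rw [blockDet, AlgHom.map_det]
  congr 1
  ext1 c d
  rw [AlgHom.mapMatrix_apply, Matrix.map_apply, Matrix.of_apply, Matrix.of_apply, map_add,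
    rename_X, apply_ite (rename (Prod.map ι ι)), map_zero, traceVar, map_sum]
  simp only [rename_X, Prod.map_apply]

theorem adDer_rename {B : Type*} [DecidableEq B] {ι : B → J} (hι : Function.Injective ι) (a b : B)
    (f : MvPolynomial (B × B) 𝕂) :
    adDer 𝕂 (ι a) (ι b) (rename (Prod.map ι ι) f) = rename (Prod.map ι ι) (adDer 𝕂 a b f) := by
  induction f using MvPolynomial.induction_on with
  | C c => rw [rename_C, derivation_C, derivation_C, map_zero]
  | add f f' hf hf' => simp only [map_add, hf, hf']
  | mul_X f p hf =>
    obtain ⟨c, d⟩ := p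
    have hX : adDer 𝕂 (ι a) (ι b) (X (ι c, ι d)) =
        rename (Prod.map ι ι) (adDer 𝕂 a b (X (c, d))) := by
      rw [adDer_X, adDer_X, map_sub, apply_ite (rename (Prod.map ι ι)),
        apply_ite (rename (Prod.map ι ι)), rename_X, rename_X, map_zero]
      simp only [hι.eq_iff, Prod.map_apply]
    rw [map_mul, rename_X, Prod.map_apply, Derivation.leibniz, hX, hf, Derivation.leibniz, map_add]
    simp only [smul_eq_mul, map_mul, rename_X, Prod.map_apply]

theorem adDer_rename_eq_zero {B : Type*} {ι : B → J} {a b : J} (ha : ∀ c, ι c ≠ a)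
    (hb : ∀ c, ι c ≠ b) (f : MvPolynomial (B × B) 𝕂) :
    adDer 𝕂 a b (rename (Prod.map ι ι) f) = 0 := by
  induction f using MvPolynomial.induction_on with
  | C c => rw [rename_C, derivation_C]
  | add f f' hf hf' => rw [map_add, map_add, hf, hf', add_zero]
  | mul_X f p hf =>
    rw [map_mul, rename_X, Prod.map, Derivation.leibniz, hf, adDer_X, if_neg (hb _).symm,
      if_neg (ha _), sub_zero, smul_zero, smul_zero, add_zero]

theorem adDer_diag_eq_zero {a b : J} {s : J →₀ ℕ} (ha : s a = 0) (hb : s b = 0) :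
    adDer 𝕂 a b (diag 𝕂 (monomial s 1)) = 0 := by
  rw [monomial_eq, C_1, one_mul, Finsupp.prod, map_prod, derivation_prod]
  refine Finset.sum_eq_zero fun j hj => ?_
  have hj' := Finsupp.mem_support_iff.1 hj
  rw [map_pow, rename_X, Derivation.leibniz_pow,
    adDer_X_diag_other (fun h : j = a => hj' (h ▸ ha)) (fun h : j = b => hj' (h ▸ hb)),
    smul_zero, smul_zero, mul_zero]

variable [CharZero 𝕂]

/-- Block determinants are turned into powers of diagonal matrix units one after the other. The
functional is supposed to vanish on the diagonal monomials that meet all blocks and contain two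
indices of some block. -/
theorem map_diag_mul_prod_blockDet (Φ : MvPolynomial (J × J) 𝕂 →ₗ[𝕂] 𝕂) {Λ : Type*}
    [DecidableEq Λ] (B : Λ → Type*) [∀ l, DecidableEq (B l)] [∀ l, Fintype (B l)]
    (ι : ∀ l, B l → J) (p : ∀ l, B l) (hι : ∀ l, Function.Injective (ι l))
    (hdisj : ∀ l l', l ≠ l' → ∀ a b, ι l a ≠ ι l' b)
    (hL : ∀ l a b, a ≠ b → ∀ f, Φ (adDer 𝕂 (ι l a) (ι l b) f) = 0)
    (hbad : ∀ s : J →₀ ℕ, (∀ l, ∃ a, s (ι l a) ≠ 0) →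
      (∃ l a b, a ≠ b ∧ s (ι l a) ≠ 0 ∧ s (ι l b) ≠ 0) → Φ (diag 𝕂 (monomial s 1)) = 0)
    (L : Finset Λ) : ∀ s : J →₀ ℕ, (∀ l ∉ L, ∃ a, s (ι l a) ≠ 0) → (∀ l ∈ L, ∀ a, s (ι l a) = 0) →
    Φ (diag 𝕂 (monomial s 1) * ∏ l ∈ L, blockDet 𝕂 (ι l)) =
      (∏ l ∈ L, ((Fintype.card (B l) : 𝕂) + 1)) * Φ (diag 𝕂 (monomial
        (s + ∑ l ∈ L, Finsupp.single (ι l (p l)) (Fintype.card (B l))) 1)) := by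
  induction L using Finset.induction_on with
  | empty =>
    intro s _ _
    simp
  | insert l₀ L hl₀ ih =>
    intro s hs hs'
    set u := diag 𝕂 (monomial s 1) * ∏ l ∈ L, blockDet 𝕂 (ι l) with hu
    set Ψ : MvPolynomial (B l₀ × B l₀) 𝕂 →ₗ[𝕂] 𝕂 := Φ ∘ₗ LinearMap.mulRight 𝕂 u ∘ₗ
      (rename (Prod.map (ι l₀) (ι l₀))).toLinearMap with hΨ
    have hval : ∀ f, Ψ f = Φ (rename (Prod.map (ι l₀) (ι l₀)) f * u) := fun f => rfl
    have hLu : ∀ a b, adDer 𝕂 (ι l₀ a) (ι l₀ b) u = 0 := by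
      intro a b
      rw [hu, Derivation.leibniz, adDer_diag_eq_zero (hs' l₀ (Finset.mem_insert_self _ _) a)
        (hs' l₀ (Finset.mem_insert_self _ _) b), derivation_prod, Finset.sum_eq_zero, smul_zero,
        smul_zero, add_zero]
      intro l hl
      have hne : l ≠ l₀ := fun h => hl₀ (h ▸ hl)
      rw [blockDet_eq_rename, adDer_rename_eq_zero (fun c => hdisj _ _ hne c a)
        (fun c => hdisj _ _ hne c b), mul_zero]
    have hΨL : ∀ a b, a ≠ b → ∀ f, Ψ (adDer 𝕂 a b f) = 0 := by
      intro a b hab f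
      have h := hL l₀ a b hab (rename (Prod.map (ι l₀) (ι l₀)) f * u)
      rw [Derivation.leibniz, hLu, smul_zero, zero_add, smul_eq_mul, adDer_rename (hι l₀),
        mul_comm] at h
      exact h
    -- Extending `s` by indices of the block `l₀` brings the induction hypothesis into play.
    have hext : ∀ t : B l₀ →₀ ℕ, t ≠ 0 → Φ (rename (Prod.map (ι l₀) (ι l₀))
        (diag 𝕂 (monomial t 1)) * u) = (∏ l ∈ L, ((Fintype.card (B l) : 𝕂) + 1)) *
        Φ (diag 𝕂 (monomial (s + t.mapDomain (ι l₀) +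
          ∑ l ∈ L, Finsupp.single (ι l (p l)) (Fintype.card (B l))) 1)) := by
      intro t ht
      rw [← ih (s + t.mapDomain (ι l₀)), hu, ← mul_assoc]
      · congr 2
        have e : rename (Prod.map (ι l₀) (ι l₀)) (diag 𝕂 (monomial t 1)) =
            diag 𝕂 (rename (ι l₀) (monomial t 1)) := by
          rw [rename_rename, rename_rename]; rfl
        rw [e, rename_monomial, ← map_mul, monomial_mul, one_mul, add_comm]
      · intro l hl
        by_cases hll : l = l₀
        · subst hll
          obtain ⟨a, ha⟩ := Finsupp.ne_iff.1 ht
          refine ⟨a, ?_⟩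
          rw [Finsupp.add_apply, Finsupp.mapDomain_apply (hι l)]
          rw [Finsupp.zero_apply] at ha
          omega
        · obtain ⟨a, ha⟩ := hs l (by simp [hll, hl])
          refine ⟨a, ?_⟩
          rw [Finsupp.add_apply]
          omega
      · intro l hl a
        have hne : l ≠ l₀ := fun h => hl₀ (h ▸ hl)
        rw [Finsupp.add_apply, hs' l (Finset.mem_insert_of_mem hl), zero_add,
          Finsupp.mapDomain_of_notMem_range]
        rintro ⟨b, hb⟩
        exact hdisj _ _ hne a b hb.symm
    have hΨcross : ∀ a b, a ≠ b → ∀ d, Ψ (X (a, a) * X (b, b) * diag 𝕂 d) = 0 := by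
      intro a b hab d
      have hlin : ∀ t : B l₀ →₀ ℕ, Ψ (X (a, a) * X (b, b) * diag 𝕂 (monomial t 1)) = 0 := by
        intro t
        have e : X (a, a) * X (b, b) * diag 𝕂 (monomial t 1) =
            diag 𝕂 (monomial (Finsupp.single a 1 + Finsupp.single b 1 + t) 1) := by
          rw [← rename_X (R := 𝕂) (fun j : B l₀ => (j, j)) a,
            ← rename_X (R := 𝕂) (fun j : B l₀ => (j, j)) b, ← map_mul, ← map_mul]
          simp only [X, monomial_mul, one_mul]
        have hne : Finsupp.single a 1 + Finsupp.single b 1 + t ≠ 0 := by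
          intro h
          have := DFunLike.congr_fun h a
          simp at this
        have h1 : ∀ c, (Finsupp.single a 1 + Finsupp.single b 1 + t : B l₀ →₀ ℕ) c ≠ 0 →
            (s + (Finsupp.single a 1 + Finsupp.single b 1 + t).mapDomain (ι l₀) +
              ∑ l ∈ L, Finsupp.single (ι l (p l)) (Fintype.card (B l))) (ι l₀ c) ≠ 0 := by
          intro c hc
          rw [Finsupp.add_apply, Finsupp.add_apply, Finsupp.mapDomain_apply (hι l₀)]
          omega
        rw [e, hval, hext _ hne, hbad, mul_zero]
        · intro l
          by_cases hll : l = l₀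
          · subst hll
            exact ⟨a, h1 a (by simp)⟩
          · by_cases hl : l ∈ L
            · refine ⟨p l, ?_⟩
              rw [Finsupp.add_apply, Finsupp.finsetSum_apply]
              have hle := Finset.single_le_sum
                (f := fun l' => (Finsupp.single (ι l' (p l')) (Fintype.card (B l'))) (ι l (p l)))
                (fun _ _ => Nat.zero_le _) hl
              have hpos : 0 < Fintype.card (B l) := Fintype.card_pos_iff.2 ⟨p l⟩
              simp only [Finsupp.single_eq_same] at hle
              omega
            · obtain ⟨c, hc⟩ := hs l (by simp [hll, hl])
              refine ⟨c, ?_⟩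
              rw [Finsupp.add_apply, Finsupp.add_apply]
              omega
        · exact ⟨l₀, a, b, hab, h1 a (by simp), h1 b (by simp)⟩
      induction d using MvPolynomial.induction_on' with
      | monomial t c =>
        have e : monomial t c = c • monomial t (1 : 𝕂) := by
          rw [smul_monomial, smul_eq_mul, mul_one]
        rw [e, map_smul, mul_smul_comm, map_smul, hlin, smul_zero]
      | add d d' h h' => rw [map_add, mul_add, map_add, h, h', add_zero]
    have hmain := map_det_add_trace hΨL hΨcross (p l₀)
    rw [hval, ← blockDet_eq_rename] at hmain
    have hpos : Fintype.card (B l₀) ≠ 0 := (Fintype.card_pos_iff.2 ⟨p l₀⟩).ne'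
    have hpow : (X (p l₀, p l₀) : MvPolynomial (B l₀ × B l₀) 𝕂) ^ Fintype.card (B l₀) =
        diag 𝕂 (monomial (Finsupp.single (p l₀) (Fintype.card (B l₀))) 1) := by
      rw [← X_pow_eq_monomial, map_pow, rename_X]
    rw [hval, hpow, hext _ (by simpa using hpos), Finsupp.mapDomain_single] at hmain
    rw [Finset.prod_insert hl₀, Finset.prod_insert hl₀, Finset.sum_insert hl₀, mul_left_comm, ← hu,
      hmain, ← mul_assoc, add_assoc]

end Blocks

/-! ### Invariant functionals that vanish on the test determinants -/

section Tests

variable {𝕂 : Type*} [Field 𝕂] {A Y : Type*} [DecidableEq A] [DecidableEq Y] {q : ℕ}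

/-- The indices of the diagonal matrix units that make up the `b`-th test field: the whole block of
positions with the same label if the label of `b` is in `A`, the label itself otherwise. -/
def testSupp (w : Fin q → A ⊕ Y) (κ : Fin q → A) (b : Fin q) : Finset (A ⊕ Y) :=
  if (w b).isLeft then Finset.univ.image fun c : {c // w c = w b} => Sum.inl (κ c) else {w b}

theorem inl_mem_testSupp {w : Fin q → A ⊕ Y} {κ : Fin q → A} (hκ : Function.Injective κ)
    {a b : Fin q} : Sum.inl (κ a) ∈ testSupp w κ b ↔ (w b).isLeft ∧ w a = w b := by
  rw [testSupp]
  split_ifs with h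
  · simp only [Finset.mem_image, Finset.mem_univ, true_and, Subtype.exists, Sum.inl.injEq, h]
    exact ⟨fun ⟨c, hc, e⟩ => hκ e ▸ hc, fun h => ⟨a, h, rfl⟩⟩
  · simp only [Finset.mem_singleton, h]
    refine ⟨fun e => absurd (e ▸ rfl) h, fun e => absurd e.1 (by simp)⟩

/-- The matrix of brackets of the test fields `∂_{κ a}` and `q_{κ b} ∑_{d ∈ testSupp b} e_dd`. -/
def testMatrix (𝕂 : Type*) [Field 𝕂] (w : Fin q → A ⊕ Y) (κ : Fin q → A) :
    Matrix (Fin q) (Fin q) (MvPolynomial ((A ⊕ Y) × (A ⊕ Y)) 𝕂) :=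
  Matrix.of fun a b => (if a = b then ∑ d ∈ testSupp w κ b, X (d, d) else 0) +
    if Sum.inl (κ a) ∈ testSupp w κ b then X (Sum.inl (κ b), Sum.inl (κ a)) else 0

variable [Fintype A] [Fintype Y]

/-- The test matrix is block diagonal, with one block for each label. -/
theorem det_testMatrix (w : Fin q → A ⊕ Y) {κ : Fin q → A} (hκ : Function.Injective κ) :
    (testMatrix 𝕂 w κ).det =
      (∏ i : A, blockDet 𝕂 fun c : {c // w c = Sum.inl i} => (Sum.inl (κ c) : A ⊕ Y)) *
        ∏ y : Y, X (Sum.inr y, Sum.inr y) ^ Fintype.card {c // w c = Sum.inr y} := by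
  set e := Fintype.equivFin (A ⊕ Y)
  have hzero : ∀ a b, w a ≠ w b → testMatrix 𝕂 w κ a b = 0 := by
    intro a b hab
    rw [testMatrix, Matrix.of_apply, if_neg (fun h : a = b => hab (h ▸ rfl)),
      if_neg (fun h => hab ((inl_mem_testSupp hκ).1 h).2), add_zero]
  have hT : (testMatrix 𝕂 w κ).BlockTriangular fun a => e (w a) :=
    fun a b hab => hzero a b fun h => hab.ne (congrArg e h.symm)
  have hblock : ∀ j : A ⊕ Y, ((testMatrix 𝕂 w κ).toSquareBlock (fun a => e (w a)) (e j)).det =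
      (Matrix.of fun a b : {c // w c = j} => testMatrix 𝕂 w κ a b).det := by
    intro j
    let f : {a // e (w a) = e j} ≃ {c // w c = j} :=
      Equiv.subtypeEquivRight fun a => e.injective.eq_iff
    rw [← Matrix.det_submatrix_equiv_self f]
    rfl
  rw [hT.det_fintype, ← e.prod_comp, Fintype.prod_sum_type]
  simp only [hblock]
  congr 1
  · refine Finset.prod_congr rfl fun i _ => ?_
    rw [blockDet, ← Matrix.det_transpose]
    congr 1
    ext1 b a
    obtain ⟨a, ha⟩ := a
    obtain ⟨b, hb⟩ := b
    have hsupp : testSupp w κ b = Finset.univ.image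
        fun c : {c // w c = Sum.inl i} => (Sum.inl (κ c) : A ⊕ Y) := by
      rw [testSupp, if_pos (by rw [hb]; rfl), hb]
    have hinj : Function.Injective fun c : {c // w c = Sum.inl i} => (Sum.inl (κ c) : A ⊕ Y) :=
      fun c d h => Subtype.ext (hκ (Sum.inl_injective h))
    rw [Matrix.transpose_apply, Matrix.of_apply, Matrix.of_apply, testMatrix, Matrix.of_apply,
      if_pos ((inl_mem_testSupp hκ).2 ⟨by rw [hb]; rfl, ha.trans hb.symm⟩), hsupp,
      Finset.sum_image hinj.injOn, add_comm]
    congr 1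
    refine if_congr ?_ rfl rfl
    rw [Subtype.mk.injEq, eq_comm]
  · refine Finset.prod_congr rfl fun y _ => ?_
    have : (Matrix.of fun a b : {c // w c = Sum.inr y} => testMatrix 𝕂 w κ a b) =
        Matrix.diagonal fun _ => X (Sum.inr y, Sum.inr y) := by
      ext1 a b
      rw [Matrix.of_apply, testMatrix, Matrix.of_apply, Matrix.diagonal_apply]
      have hn : Sum.inl (κ a) ∉ testSupp w κ b :=
        fun h => by simpa [b.2] using ((inl_mem_testSupp hκ).1 h).1
      rw [if_neg hn, add_zero, testSupp, b.2]
      simp [Subtype.ext_iff]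
    rw [this, Matrix.det_diagonal, Finset.prod_const, Finset.card_univ]

omit [DecidableEq A] [DecidableEq Y] [Fintype A] [Fintype Y] in
/-- A monomial of degree `n` is a word of length `n` up to the order of the letters. -/
theorem exists_word {J : Type*} (n : ℕ) : ∀ s : J →₀ ℕ, s.degree = n →
    ∃ w : Fin n → J, ∑ a, Finsupp.single (w a) 1 = s := by
  classical
  induction n with
  | zero =>
    intro s hs
    exact ⟨Fin.elim0, by rw [(Finsupp.degree_eq_zero_iff s).1 hs]; rfl⟩
  | succ n ih =>
    intro s hs
    have hne : s ≠ 0 := by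
      rintro rfl
      simp at hs
    obtain ⟨j, hj⟩ := Finsupp.ne_iff.1 hne
    have hle : Finsupp.single j 1 ≤ s := by
      rw [Finsupp.single_le_iff]
      exact Nat.one_le_iff_ne_zero.2 hj
    have h1 := add_tsub_cancel_of_le hle
    have h2 := congrArg Finsupp.degree h1
    rw [map_add, Finsupp.degree_single, hs] at h2
    obtain ⟨w, hw⟩ := ih (s - Finsupp.single j 1) (by omega)
    refine ⟨Fin.cons j w, ?_⟩
    rw [Fin.sum_univ_succ]
    simp only [Fin.cons_zero, Fin.cons_succ, hw, h1]

omit [DecidableEq Y] [Fintype Y] in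
/-- The positions of a word can be distributed injectively over `A` in such a way that every label
in `A` is taken by one of its own positions. -/
theorem exists_positions (w : Fin q → A ⊕ Y) (hq : q ≤ Fintype.card A) :
    ∃ κ : Fin q → A, Function.Injective κ ∧ ∀ a i, w a = Sum.inl i →
      ∃ b, w b = Sum.inl i ∧ κ b = i := by
  rcases Nat.eq_zero_or_pos q with rfl | hpos
  · exact ⟨Fin.elim0, fun a => a.elim0, fun a => a.elim0⟩
  have : Nonempty A := Fintype.card_pos_iff.1 (lt_of_lt_of_le hpos hq)
  have : Nonempty (Fin q) := ⟨⟨0, hpos⟩⟩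
  let f : Fin q → A := fun a => Sum.elim id (fun _ => Classical.arbitrary A) (w a)
  have hf : ∀ a i, w a = Sum.inl i → f a = i := fun a i h => by simp [f, h]
  let c : Fin q → Fin q := fun a => Function.invFun w (w a)
  have hc : ∀ a, w (c a) = w a := fun a => Function.invFun_eq ⟨a, rfl⟩
  have hcc : ∀ a b, w a = w b → c a = c b := fun a b h => by simp only [c, h]
  let S : Finset (Fin q) := Finset.univ.filter fun a => (w a).isLeft ∧ c a = a
  have hS : ∀ {a}, a ∈ S ↔ (w a).isLeft ∧ c a = a := by simp [S]
  have hinj : Set.InjOn f S := by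
    intro a ha b hb hab
    obtain ⟨ha1, ha2⟩ := hS.1 ha
    obtain ⟨hb1, hb2⟩ := hS.1 hb
    obtain ⟨i, hi⟩ := Sum.isLeft_iff.1 ha1
    obtain ⟨j, hj⟩ := Sum.isLeft_iff.1 hb1
    rw [hf a i hi, hf b j hj] at hab
    rw [← ha2, ← hb2]
    exact hcc a b (by rw [hi, hj, hab])
  obtain ⟨t, htS, htc⟩ := Finset.exists_superset_card_eq (s := S.image f) (n := q)
    ((Finset.card_image_le.trans (Finset.card_le_univ S)).trans (by simp)) hq
  obtain ⟨g, hg⟩ := Finset.exists_equiv_extend_of_card_eq (α := Fin q) (t := t) (by simp [htc]) htS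
    hinj
  refine ⟨fun a => g a, fun a b h => g.injective (Subtype.ext h), fun a i h => ?_⟩
  have hci : w (c a) = Sum.inl i := (hc a).trans h
  refine ⟨c a, hci, ?_⟩
  exact (hg (c a) (hS.2 ⟨by rw [hci]; rfl, hcc _ _ (hc a)⟩)).trans (hf _ _ hci)

/-- An invariant functional of degree `q ≤ |A|` that vanishes on all test determinants is zero.
By restriction to the diagonal and descending induction on the number of distinct indices in `A`
it suffices to find, for every diagonal monomial, a test determinant that evaluates to a nonzero
multiple of it up to diagonal monomials with more distinct indices in `A`. -/
theorem eq_zero_of_test [CharZero 𝕂]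
    (Φ : MvPolynomial ((A ⊕ Y) × (A ⊕ Y)) 𝕂 →ₗ[𝕂] 𝕂) (R : A ⊕ Y → A ⊕ Y → Prop)
    (hRA : ∀ i j, R (Sum.inl i) (Sum.inl j))
    (hL : ∀ a b, a ≠ b → R a b → ∀ f, Φ (adDer 𝕂 a b f) = 0)
    (hR : ∀ a b, a ≠ b → ¬R a b → ∀ f, Φ (X (a, b) * f) = 0)
    (hdeg : ∀ s : A ⊕ Y →₀ ℕ, s.degree ≠ q → Φ (diag 𝕂 (monomial s 1)) = 0)
    (hq : q ≤ Fintype.card A)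
    (htest : ∀ (w : Fin q → A ⊕ Y) (κ : Fin q → A), Function.Injective κ →
      Φ (testMatrix 𝕂 w κ).det = 0) : Φ = 0 := by
  refine eq_zero_of_diag_eq_zero Φ R hL hR fun d => ?_
  suffices h : ∀ n, ∀ s : A ⊕ Y →₀ ℕ,
      Fintype.card A - (Finset.univ.filter fun i : A => s (Sum.inl i) ≠ 0).card = n →
      Φ (diag 𝕂 (monomial s 1)) = 0 by
    induction d using MvPolynomial.induction_on' with
    | monomial t c =>
      have e : monomial t c = c • monomial t (1 : 𝕂) := by rw [smul_monomial, smul_eq_mul, mul_one]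
      rw [e, map_smul, map_smul, h _ t rfl, smul_zero]
    | add d d' h h' => rw [map_add, map_add, h, h', add_zero]
  intro n
  induction n using Nat.strong_induction_on with
  | _ n ih =>
  intro s hn
  by_cases hsq : s.degree = q
  swap
  · exact hdeg s hsq
  obtain ⟨w, hw⟩ := exists_word q s hsq
  have hcard : ∀ j, s j = Fintype.card {c // w c = j} := by
    intro j
    rw [← hw, Finsupp.finsetSum_apply, Fintype.card_subtype, Finset.card_filter]
    exact Finset.sum_congr rfl fun a _ => Finsupp.single_apply
  obtain ⟨κ, hκ, hκw⟩ := exists_positions w hq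
  let Λ := {i : A // s (Sum.inl i) ≠ 0}
  let B : Λ → Type := fun l => {c // w c = Sum.inl l.1}
  let ι : ∀ l : Λ, B l → A ⊕ Y := fun l c => Sum.inl (κ c.1)
  have hp : ∀ l : Λ, ∃ b : B l, κ b.1 = l.1 := by
    rintro ⟨i, hi⟩
    rw [hcard, ← Nat.pos_iff_ne_zero, Fintype.card_pos_iff] at hi
    obtain ⟨a, ha⟩ := hi
    obtain ⟨b, hb, hb'⟩ := hκw a i ha
    exact ⟨⟨b, hb⟩, hb'⟩
  choose p hp' using hp
  have hι : ∀ l, Function.Injective (ι l) :=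
    fun l a b h => Subtype.ext (hκ (Sum.inl_injective h))
  have hdisj : ∀ l l', l ≠ l' → ∀ a b, ι l a ≠ ι l' b := by
    intro l l' hll a b h
    have hab : a.1 = b.1 := hκ (Sum.inl_injective h)
    exact hll (Subtype.ext (Sum.inl_injective (a.2.symm.trans ((congrArg w hab).trans b.2))))
  have hbad : ∀ s' : A ⊕ Y →₀ ℕ, (∀ l, ∃ a, s' (ι l a) ≠ 0) →
      (∃ l a b, a ≠ b ∧ s' (ι l a) ≠ 0 ∧ s' (ι l b) ≠ 0) → Φ (diag 𝕂 (monomial s' 1)) = 0 := by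
    rintro s' h1 ⟨l₀, a₀, b₀, hab, ha₀, hb₀⟩
    refine ih _ ?_ s' rfl
    let T : Λ → Finset A := fun l =>
      (Finset.univ.filter fun c : B l => s' (ι l c) ≠ 0).image fun c => κ c.1
    have hT : ∀ l, (T l).card = (Finset.univ.filter fun c : B l => s' (ι l c) ≠ 0).card :=
      fun l => Finset.card_image_of_injective _ fun c d h => Subtype.ext (hκ h)
    have hTdisj : Set.PairwiseDisjoint ((Finset.univ : Finset Λ) : Set Λ) T := by
      intro l _ l' _ hll
      rw [Function.onFun, Finset.disjoint_left]
      rintro i hi hi'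
      obtain ⟨c, _, rfl⟩ := Finset.mem_image.1 hi
      obtain ⟨d, _, hd⟩ := Finset.mem_image.1 hi'
      exact hdisj _ _ hll c d (congrArg Sum.inl hd.symm)
    have hsub : Finset.univ.biUnion T ⊆ Finset.univ.filter fun i : A => s' (Sum.inl i) ≠ 0 := by
      intro i hi
      obtain ⟨l, _, hl⟩ := Finset.mem_biUnion.1 hi
      obtain ⟨c, hc, rfl⟩ := Finset.mem_image.1 hl
      exact Finset.mem_filter.2 ⟨Finset.mem_univ _, (Finset.mem_filter.1 hc).2⟩
    have hle := Finset.card_le_card hsub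
    rw [Finset.card_biUnion hTdisj] at hle
    have hlt : ∑ _l : Λ, 1 < ∑ l, (T l).card := by
      refine Finset.sum_lt_sum (fun l _ => ?_) ⟨l₀, Finset.mem_univ _, ?_⟩
      · obtain ⟨a, ha⟩ := h1 l
        rw [hT, Nat.one_le_iff_ne_zero, Finset.card_ne_zero]
        exact ⟨a, Finset.mem_filter.2 ⟨Finset.mem_univ _, ha⟩⟩
      · rw [hT, Finset.one_lt_card]
        exact ⟨a₀, Finset.mem_filter.2 ⟨Finset.mem_univ _, ha₀⟩, b₀,
          Finset.mem_filter.2 ⟨Finset.mem_univ _, hb₀⟩, hab⟩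
    rw [Finset.sum_const, Finset.card_univ, smul_eq_mul, mul_one, Fintype.card_subtype] at hlt
    have := Finset.card_le_univ (Finset.univ.filter fun i : A => s' (Sum.inl i) ≠ 0)
    omega
  let s₀ : A ⊕ Y →₀ ℕ := ∑ y : Y, Finsupp.single (Sum.inr y) (s (Sum.inr y))
  have hs₀l : ∀ i, s₀ (Sum.inl i) = 0 := by
    intro i
    rw [Finsupp.finsetSum_apply]
    exact Finset.sum_eq_zero fun y _ => Finsupp.single_eq_of_ne (by simp)
  have hs₀r : ∀ y, s₀ (Sum.inr y) = s (Sum.inr y) := by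
    intro y
    rw [Finsupp.finsetSum_apply, Finset.sum_eq_single y, Finsupp.single_eq_same]
    · intro y' _ hy
      exact Finsupp.single_eq_of_ne (by simpa using hy.symm)
    · simp
  have hmain := map_diag_mul_prod_blockDet Φ B ι p hι hdisj
    (fun l a b hab f => hL _ _ (fun h => hab (hι l h)) (hRA _ _) f) hbad Finset.univ s₀
    (fun l hl => absurd (Finset.mem_univ l) hl) (fun l _ a => hs₀l _)
  have hdet : diag 𝕂 (monomial s₀ 1) * ∏ l, blockDet 𝕂 (ι l) = (testMatrix 𝕂 w κ).det := by
    rw [det_testMatrix w hκ, ← Fintype.prod_subtype_mul_prod_subtype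
      (fun i : A => s (Sum.inl i) ≠ 0), mul_comm]
    have h1 : ∏ i : {i : A // ¬s (Sum.inl i) ≠ 0},
        blockDet 𝕂 (fun c : {c // w c = Sum.inl i.1} => (Sum.inl (κ c) : A ⊕ Y)) = 1 := by
      refine Finset.prod_eq_one fun i _ => ?_
      have hi : s (Sum.inl i.1) = 0 := not_not.1 i.2
      rw [hcard, Fintype.card_eq_zero_iff] at hi
      rw [blockDet, Matrix.det_isEmpty]
    have h2 : diag 𝕂 (monomial s₀ 1) =
        ∏ y : Y, X (Sum.inr y, Sum.inr y) ^ Fintype.card {c // w c = Sum.inr y} := by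
      have : monomial s₀ (1 : 𝕂) = ∏ y : Y, X (Sum.inr y) ^ s (Sum.inr y) := by
        simp only [s₀, X_pow_eq_monomial, ← monomial_sum_one]
      rw [this, map_prod]
      refine Finset.prod_congr rfl fun y _ => ?_
      rw [map_pow, rename_X, hcard]
    rw [h1, mul_one, h2]
  have hs : s₀ + ∑ l, Finsupp.single (ι l (p l)) (Fintype.card (B l)) = s := by
    ext j
    rw [Finsupp.add_apply]
    have hιp : ∀ l, ι l (p l) = Sum.inl l.1 := fun l => congrArg Sum.inl (hp' l)
    simp only [hιp]
    rcases j with i | y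
    · rw [hs₀l, zero_add, Finsupp.finsetSum_apply]
      by_cases hi : s (Sum.inl i) = 0
      · rw [hi]
        refine Finset.sum_eq_zero fun l _ => Finsupp.single_eq_of_ne ?_
        intro h
        exact l.2 (by rw [← h, hi])
      · rw [Finset.sum_eq_single ⟨i, hi⟩, Finsupp.single_eq_same, hcard]
        · intro l _ hl
          exact Finsupp.single_eq_of_ne fun h => hl (Subtype.ext (Sum.inl_injective h).symm)
        · simp
    · rw [hs₀r, Finsupp.finsetSum_apply, Finset.sum_eq_zero, add_zero]
      exact fun l _ => Finsupp.single_eq_of_ne (by simp)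
  rw [hdet, htest w κ hκ, hs] at hmain
  refine (mul_eq_zero.1 hmain.symm).resolve_left (Finset.prod_ne_zero_iff.2 fun l _ => ?_)
  exact Nat.cast_add_one_ne_zero _

end Tests

/-! ### Symmetric multilinear forms as functionals on polynomials -/

section Polar

variable {𝕂 : Type*} [Field 𝕂] {H : Type*} [AddCommGroup H] [Module 𝕂 H] {ι : Type*} {q : ℕ}

/-- Two words that represent the same monomial differ by a permutation of the letters. -/
theorem exists_perm_of_sum_single_eq {n : ℕ} {c c' : Fin n → ι}
    (h : ∑ a, Finsupp.single (c a) 1 = ∑ a, Finsupp.single (c' a) 1) :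
    ∃ σ : Equiv.Perm (Fin n), ∀ a, c (σ a) = c' a := by
  classical
  have hcard : ∀ (d : Fin n → ι) j, (∑ a, Finsupp.single (d a) 1 : ι →₀ ℕ) j =
      Fintype.card {a // d a = j} := by
    intro d j
    rw [Finsupp.finsetSum_apply, Fintype.card_subtype, Finset.card_filter]
    exact Finset.sum_congr rfl fun a _ => Finsupp.single_apply
  have e : ∀ j, {a // c' a = j} ≃ {a // c a = j} := fun j =>
    Fintype.equivOfCardEq (by rw [← hcard, ← hcard, h])
  refine ⟨(Equiv.sigmaFiberEquiv c').symm.trans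
    ((Equiv.sigmaCongrRight e).trans (Equiv.sigmaFiberEquiv c)), fun a => ?_⟩
  exact (e (c' a) ⟨a, rfl⟩).2

open Classical in
/-- The functional on polynomials in the family `b` that a multilinear form defines: on a product
of `q` variables it is the value of the form at the corresponding members of `b`, and it vanishes
in the degrees other than `q`. -/
def polarFunctional (P : MultilinearMap 𝕂 (fun _ : Fin q => H) 𝕂) (b : ι → H) :
    MvPolynomial ι 𝕂 →ₗ[𝕂] 𝕂 :=
  (basisMonomials ι 𝕂).constr 𝕂 fun s =>
    if h : ∃ c : Fin q → ι, ∑ a, Finsupp.single (c a) 1 = s then P fun a => b (h.choose a) else 0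

variable {P : MultilinearMap 𝕂 (fun _ : Fin q => H) 𝕂} {b : ι → H}

theorem polarFunctional_monomial_of_degree_ne {s : ι →₀ ℕ} (hs : s.degree ≠ q) (c : 𝕂) :
    polarFunctional P b (monomial s c) = 0 := by
  have e : monomial s c = c • basisMonomials ι 𝕂 s := by
    rw [coe_basisMonomials, smul_monomial, smul_eq_mul, mul_one]
  rw [e, map_smul, polarFunctional, Module.Basis.constr_basis, dif_neg, smul_zero]
  rintro ⟨w, rfl⟩
  apply hs
  rw [map_sum]
  simp

theorem polarFunctional_of_isHomogeneous {f : MvPolynomial ι 𝕂} {n : ℕ} (hf : f.IsHomogeneous n)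
    (hn : n ≠ q) : polarFunctional P b f = 0 := by
  rw [f.as_sum, map_sum]
  refine Finset.sum_eq_zero fun s hs => polarFunctional_monomial_of_degree_ne ?_ _
  rw [Finsupp.degree_eq_weight_one]
  exact fun h => hn ((hf (mem_support_iff.1 hs)).symm.trans h)

theorem prod_X_eq_monomial {n : ℕ} (c : Fin n → ι) :
    ∏ a, (X (c a) : MvPolynomial ι 𝕂) = monomial (∑ a, Finsupp.single (c a) 1) 1 := by
  rw [monomial_sum_one]
  rfl

section Symmetric

variable (hP : ∀ (σ : Equiv.Perm (Fin q)) (v : Fin q → H), P (fun i => v (σ i)) = P v)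
include hP

theorem polarFunctional_prod_X (c : Fin q → ι) :
    polarFunctional P b (∏ a, X (c a)) = P fun a => b (c a) := by
  have hex : ∃ c' : Fin q → ι, ∑ a, Finsupp.single (c' a) 1 = ∑ a, Finsupp.single (c a) 1 :=
    ⟨c, rfl⟩
  have e : monomial (∑ a, Finsupp.single (c a) 1) (1 : 𝕂) =
      basisMonomials ι 𝕂 (∑ a, Finsupp.single (c a) 1) := by rw [coe_basisMonomials]
  rw [prod_X_eq_monomial, e, polarFunctional, Module.Basis.constr_basis, dif_pos hex]
  obtain ⟨σ, hσ⟩ := exists_perm_of_sum_single_eq hex.choose_spec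
  rw [← hP σ]
  simp only [hσ]

/-- The linear forms in the variables, together with the elements that they represent. -/
def formPairs (𝕂 : Type*) [Field 𝕂] {H : Type*} [AddCommGroup H] [Module 𝕂 H] {ι : Type*}
    (b : ι → H) : Submodule 𝕂 (MvPolynomial ι 𝕂 × H) :=
  Submodule.span 𝕂 (Set.range fun j => (X j, b j))

/-- On a product of linear forms the functional is the value of `P` at the elements that these
represent. -/
theorem polarFunctional_prod [Finite ι] {l : Fin q → MvPolynomial ι 𝕂} {v : Fin q → H}
    (h : ∀ a, (l a, v a) ∈ formPairs 𝕂 b) : polarFunctional P b (∏ a, l a) = P v := by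
  classical
  have := Fintype.ofFinite ι
  have h' : ∀ a, ∃ t : ι → 𝕂, l a = ∑ j, t j • X j ∧ v a = ∑ j, t j • b j := by
    intro a
    obtain ⟨t, ht⟩ := (Submodule.mem_span_range_iff_exists_fun 𝕂).1 (h a)
    refine ⟨t, ?_, ?_⟩
    · have : _ = l a := congrArg Prod.fst ht
      rw [← this, Prod.fst_sum]
      rfl
    · have : _ = v a := congrArg Prod.snd ht
      rw [← this, Prod.snd_sum]
      rfl
  choose t hl hv using h'
  rw [funext hl, funext hv, Finset.prod_univ_sum, P.map_sum, map_sum, Fintype.piFinset_univ]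
  refine Finset.sum_congr rfl fun c _ => ?_
  rw [P.map_smul_univ, Finset.prod_smul, map_smul, polarFunctional_prod_X hP]

omit hP in
theorem isHomogeneous_of_formPairs [Finite ι] {l : MvPolynomial ι 𝕂} {x : H}
    (h : (l, x) ∈ formPairs 𝕂 b) : l.IsHomogeneous 1 := by
  have := Fintype.ofFinite ι
  obtain ⟨t, ht⟩ := (Submodule.mem_span_range_iff_exists_fun 𝕂).1 h
  have h1 : _ = l := congrArg Prod.fst ht
  rw [Prod.fst_sum] at h1
  rw [← h1]
  exact IsHomogeneous.sum _ _ _ fun j _ =>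
    (homogeneousSubmodule ι 𝕂 1).smul_mem (t j) (isHomogeneous_X 𝕂 j)

/-- If `P` is infinitesimally invariant under `T`, the functional vanishes on the image of a
derivation that represents `T` on the linear forms. -/
theorem polarFunctional_derivation [Finite ι]
    (D : Derivation 𝕂 (MvPolynomial ι 𝕂) (MvPolynomial ι 𝕂)) (T : H → H)
    (hD : ∀ j, (D (X j), T (b j)) ∈ formPairs 𝕂 b)
    (hT : ∀ v : Fin q → H, ∑ i, P (Function.update v i (T (v i))) = 0) (f : MvPolynomial ι 𝕂) :
    polarFunctional P b (D f) = 0 := by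
  classical
  induction f using MvPolynomial.induction_on' with
  | add f f' h h' => rw [map_add, map_add, h, h', add_zero]
  | monomial s c =>
    obtain ⟨w, hw⟩ := exists_word s.degree s rfl
    have e : monomial s c = c • ∏ a, X (w a) := by
      rw [prod_X_eq_monomial, hw, smul_monomial, smul_eq_mul, mul_one]
    have hterm : ∀ a, (∏ j ∈ Finset.univ.erase a, X (w j)) * D (X (w a)) =
        ∏ j, Function.update (fun j => (X (w j) : MvPolynomial ι 𝕂)) a (D (X (w a))) j := by
      intro a
      rw [← Finset.prod_erase_mul _ _ (Finset.mem_univ a), Function.update_self]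
      congr 1
      exact Finset.prod_congr rfl fun j hj => by
        rw [Function.update_of_ne (Finset.ne_of_mem_erase hj)]
    have hpair : ∀ a j, (Function.update (fun j => (X (w j) : MvPolynomial ι 𝕂)) a (D (X (w a))) j,
        Function.update (fun j => b (w j)) a (T (b (w a))) j) ∈ formPairs 𝕂 b := by
      intro a j
      by_cases hj : j = a
      · subst hj
        rw [Function.update_self, Function.update_self]
        exact hD _
      · rw [Function.update_of_ne hj, Function.update_of_ne hj]
        exact Submodule.subset_span ⟨w j, rfl⟩
    rw [e, D.map_smul, map_smul, derivation_prod, map_sum]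
    simp only [hterm]
    by_cases hs : s.degree = q
    · subst hs
      rw [Finset.sum_congr rfl fun a _ => polarFunctional_prod hP (hpair a)]
      have h0 : ∑ a, P (Function.update (fun j => b (w j)) a (T (b (w a)))) = 0 :=
        hT fun j => b (w j)
      rw [h0, smul_zero]
    · rw [Finset.sum_eq_zero, smul_zero]
      intro a _
      refine polarFunctional_of_isHomogeneous (IsHomogeneous.prod _ _ (fun _ => 1) fun j _ =>
        isHomogeneous_of_formPairs (hpair a j)) ?_
      simpa using hs

theorem polarFunctional_X_mul_of_eq_zero {j : ι} (hj : b j = 0) (f : MvPolynomial ι 𝕂) :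
    polarFunctional P b (X j * f) = 0 := by
  induction f using MvPolynomial.induction_on' with
  | add f f' h h' => rw [mul_add, map_add, h, h', add_zero]
  | monomial s c =>
    have e : X j * monomial s c = monomial (Finsupp.single j 1 + s) c := by
      rw [X, monomial_mul, one_mul]
    by_cases hs : (Finsupp.single j 1 + s).degree = q
    · obtain ⟨w, hw⟩ := exists_word q _ hs
      have e' : monomial (Finsupp.single j 1 + s) c = c • ∏ a, X (w a) := by
        rw [prod_X_eq_monomial, hw, smul_monomial, smul_eq_mul, mul_one]
      rw [e, e', map_smul, polarFunctional_prod_X hP]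
      have hex : ∃ a, w a = j := by
        by_contra hne
        push Not at hne
        have := DFunLike.congr_fun hw j
        rw [Finsupp.finsetSum_apply, Finset.sum_eq_zero fun a _ =>
          Finsupp.single_eq_of_ne (hne a).symm, Finsupp.add_apply, Finsupp.single_eq_same] at this
        omega
      obtain ⟨a, ha⟩ := hex
      rw [P.map_coord_zero a (by rw [ha, hj]), smul_zero]
    · rw [e, polarFunctional_monomial_of_degree_ne hs]

theorem polarFunctional_det [Finite ι] {M : Matrix (Fin q) (Fin q) (MvPolynomial ι 𝕂)}
    {m : Fin q → Fin q → H} (hM : ∀ a a', (M a a', m a a') ∈ formPairs 𝕂 b) :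
    polarFunctional P b M.det = ∑ τ : Equiv.Perm (Fin q), ((Equiv.Perm.sign τ : ℤ) : 𝕂) *
      P fun a => m a (τ a) := by
  rw [← Matrix.det_transpose, Matrix.det_apply, map_sum]
  refine Finset.sum_congr rfl fun τ _ => ?_
  rw [Units.smul_def, map_zsmul, zsmul_eq_mul]
  simp only [Matrix.transpose_apply]
  rw [polarFunctional_prod hP fun a => hM a (τ a)]

theorem eq_zero_of_polarFunctional_eq_zero [Finite ι] (hb : Submodule.span 𝕂 (Set.range b) = ⊤)
    (h : polarFunctional P b = 0) : P = 0 := by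
  have hsurj : ∀ x : H, ∃ l, (l, x) ∈ formPairs 𝕂 b := by
    intro x
    have hx : x ∈ Submodule.span 𝕂 (Set.range b) := hb ▸ Submodule.mem_top
    induction hx using Submodule.span_induction with
    | mem x hx =>
      obtain ⟨j, rfl⟩ := hx
      exact ⟨X j, Submodule.subset_span ⟨j, rfl⟩⟩
    | zero => exact ⟨0, Submodule.zero_mem _⟩
    | add x y _ _ hx hy =>
      obtain ⟨l, hl⟩ := hx
      obtain ⟨l', hl'⟩ := hy
      exact ⟨l + l', Submodule.add_mem _ hl hl'⟩
    | smul c x _ hx =>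
      obtain ⟨l, hl⟩ := hx
      exact ⟨c • l, Submodule.smul_mem _ c hl⟩
  choose l hl using hsurj
  ext v
  rw [← polarFunctional_prod hP fun a => hl (v a), h]
  rfl

end Symmetric

end Polar

end GlPoly

namespace RelLie

/-! ### Evaluation of Chern--Weil forms on pairs of abelian families -/

variable {𝕂 : Type*} [Field 𝕂] {g : Type*} [LieRing g] [LieAlgebra 𝕂 g] {h : LieSubalgebra 𝕂 g}

/-- A relative coboundary vanishes on every family whose brackets lie in the subalgebra. -/
theorem apply_eq_zero_of_mem_relCoboundary {p : ℕ} {ω : g [⋀^Fin p]→ₗ[𝕂] 𝕂}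
    (hω : ω ∈ relCoboundary h p) {w : Fin p → g} (hw : ∀ i j, ⁅w i, w j⁆ ∈ h) : ω w = 0 := by
  cases p with
  | zero => rw [(Submodule.mem_bot 𝕂).1 hω]; rfl
  | succ p =>
    obtain ⟨η, hη, hη'⟩ := hω
    rw [← hη', ceDiff_apply]
    refine Finset.sum_eq_zero fun i _ => Finset.sum_eq_zero fun j _ => ?_
    split_ifs with hij
    · obtain ⟨l, hl⟩ := Fin.exists_succAbove_eq hij.ne'
      rw [hη.1 _ ⟨l, by rw [hl, Function.update_self]; exact hw i j⟩, mul_zero]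
    · rfl

/-- The division of the positions into a first and a second half. -/
def halfEquiv (q : ℕ) : Fin q ⊕ Fin q ≃ Fin (2 * q) :=
  finSumFinEquiv.trans (finCongr (two_mul q).symm)

theorem val_halfEquiv_inl {q : ℕ} (a : Fin q) : (halfEquiv q (Sum.inl a) : ℕ) = a := by
  simp [halfEquiv]

theorem val_halfEquiv_inr {q : ℕ} (a : Fin q) : (halfEquiv q (Sum.inr a) : ℕ) = q + a := by
  simp [halfEquiv, Nat.add_comm]

/-- On two families of `q` elements, on the second of which the curvature vanishes, a Chern--Weil
form is, up to sign, a determinant-like sum over the pairings of the families. By the condition on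
`σ`, a position `σ (2 i)` in the second half would force a pair inside the second half. -/
theorem chernWeilForm_halves [CharZero 𝕂] (pr : g →ₗ[𝕂] h) {q : ℕ}
    {P : MultilinearMap 𝕂 (fun _ : Fin q => h) 𝕂}
    (hP : ∀ (σ : Equiv.Perm (Fin q)) (v : Fin q → h), P (fun i => v (σ i)) = P v) (u v : Fin q → g)
    (hv : ∀ a b, curvature pr (v a) (v b) = 0) :
    ∃ ε : ℤˣ, chernWeilForm pr P (fun l => Sum.elim u v ((halfEquiv q).symm l)) =
      ((ε : ℤ) : 𝕂) * ∑ τ : Equiv.Perm (Fin q), ((Equiv.Perm.sign τ : ℤ) : 𝕂) *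
        P fun a => curvature pr (u a) (v (τ a)) := by
  set w : Fin (2 * q) → g := fun l => Sum.elim u v ((halfEquiv q).symm l) with hw
  have hwl : ∀ a, w (halfEquiv q (Sum.inl a)) = u a := fun a => by simp [hw]
  have hwr : ∀ a, w (halfEquiv q (Sum.inr a)) = v a := fun a => by simp [hw]
  let s₀ : Equiv.Perm (Fin (2 * q)) := (pairEquiv q).symm.trans (halfEquiv q)
  let E : Equiv.Perm (Fin q) × Equiv.Perm (Fin q) → Equiv.Perm (Fin (2 * q)) := fun x =>
    s₀ * (pairEquiv q).permCongr (Equiv.Perm.sumCongr x.1 x.2)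
  have hEl : ∀ x i, E x (fstIdx i) = halfEquiv q (Sum.inl (x.1 i)) := by
    intro x i
    have : fstIdx i = pairEquiv q (Sum.inl i) := rfl
    simp [E, s₀, this]
  have hEr : ∀ x i, E x (sndIdx i) = halfEquiv q (Sum.inr (x.2 i)) := by
    intro x i
    have : sndIdx i = pairEquiv q (Sum.inr i) := rfl
    simp [E, s₀, this]
  have hEsign : ∀ x, Equiv.Perm.sign (E x) =
      Equiv.Perm.sign s₀ * (Equiv.Perm.sign x.1 * Equiv.Perm.sign x.2) := by
    intro x
    rw [Equiv.Perm.sign_mul, Equiv.Perm.sign_permCongr, Equiv.Perm.sign_sumCongr]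
  have hEinj : Function.Injective E := by
    intro x y hxy
    refine Prod.ext (Equiv.ext fun i => ?_) (Equiv.ext fun i => ?_)
    · have := DFunLike.congr_fun hxy (fstIdx i)
      rw [hEl, hEl] at this
      exact Sum.inl_injective ((halfEquiv q).injective this)
    · have := DFunLike.congr_fun hxy (sndIdx i)
      rw [hEr, hEr] at this
      exact Sum.inr_injective ((halfEquiv q).injective this)
  refine ⟨Equiv.Perm.sign s₀, ?_⟩
  have hsum : ∑ x : Equiv.Perm (Fin q) × Equiv.Perm (Fin q),
      ((Equiv.Perm.sign s₀ : ℤ) : 𝕂) * (((Equiv.Perm.sign x.1 : ℤ) : 𝕂) *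
        (((Equiv.Perm.sign x.2 : ℤ) : 𝕂) * P fun i => curvature pr (u (x.1 i)) (v (x.2 i)))) =
      ∑ σ : Equiv.Perm (Fin (2 * q)) with ∀ i : Fin q, σ (fstIdx i) < σ (sndIdx i),
        ((Equiv.Perm.sign σ : ℤ) : 𝕂) *
          P fun i : Fin q => curvature pr (w (σ (fstIdx i))) (w (σ (sndIdx i))) := by
    refine Finset.sum_of_injOn E hEinj.injOn ?_ ?_ ?_
    · intro x _
      rw [Finset.coe_filter]
      refine ⟨Finset.mem_univ _, fun i => ?_⟩
      rw [hEl, hEr, Fin.lt_def, val_halfEquiv_inl, val_halfEquiv_inr]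
      omega
    · intro σ hσ hσE
      have hσ' := (Finset.mem_filter.1 hσ).2
      let π : Equiv.Perm (Fin q ⊕ Fin q) := (pairEquiv q).trans (σ.trans (halfEquiv q).symm)
      have hπ : ∀ x, halfEquiv q (π x) = σ (pairEquiv q x) := fun x => by simp [π]
      have hnot : ¬Set.MapsTo π (Set.range Sum.inl) (Set.range Sum.inl) := by
        intro hmaps
        obtain ⟨x, hx⟩ := Equiv.Perm.mem_sumCongrHom_range_of_perm_mapsTo_inl hmaps
        apply hσE
        refine ⟨x, by simp, Equiv.ext fun l => ?_⟩
        obtain ⟨i, rfl | rfl⟩ := exists_pair_idx l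
        · have := hπ (Sum.inl i)
          rw [← hx] at this
          exact (hEl x i).trans this
        · have := hπ (Sum.inr i)
          rw [← hx] at this
          exact (hEr x i).trans this
      have hex : ∃ i b, π (Sum.inl i) = Sum.inr b := by
        by_contra hne
        push Not at hne
        apply hnot
        rintro _ ⟨i, rfl⟩
        rcases hi : π (Sum.inl i) with a | b
        · exact ⟨a, rfl⟩
        · exact absurd hi (hne i b)
      obtain ⟨i, b, hib⟩ := hex
      have h1 : σ (fstIdx i) = halfEquiv q (Sum.inr b) := by
        rw [← hib, hπ]; rfl
      obtain ⟨y, hy⟩ := (halfEquiv q).surjective (σ (sndIdx i))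
      have hlt := hσ' i
      rw [h1, ← hy, Fin.lt_def, val_halfEquiv_inr] at hlt
      rcases y with a | b'
      · rw [val_halfEquiv_inl] at hlt
        omega
      · rw [P.map_coord_zero i, mul_zero]
        rw [h1, ← hy, hwr, hwr, hv]
    · intro x _
      simp only [hEl, hEr, hwl, hwr, hEsign]
      push_cast
      ring
  have hinner : ∀ ρ : Equiv.Perm (Fin q), ∑ τ : Equiv.Perm (Fin q),
      ((Equiv.Perm.sign ρ : ℤ) : 𝕂) * (((Equiv.Perm.sign τ : ℤ) : 𝕂) *
        P fun i => curvature pr (u (ρ i)) (v (τ i))) =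
      ∑ τ : Equiv.Perm (Fin q), ((Equiv.Perm.sign τ : ℤ) : 𝕂) *
        P fun a => curvature pr (u a) (v (τ a)) := by
    intro ρ
    rw [← Equiv.sum_comp (Equiv.mulRight ρ)]
    refine Finset.sum_congr rfl fun τ _ => ?_
    rw [Equiv.coe_mulRight, Equiv.Perm.sign_mul, ← hP ρ fun a => curvature pr (u a) (v (τ a))]
    have hsq : ((Equiv.Perm.sign ρ : ℤ) : 𝕂) * ((Equiv.Perm.sign ρ : ℤ) : 𝕂) = 1 := by
      rw [← Int.cast_mul, ← Units.val_mul, Int.units_mul_self]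
      simp
    simp only [Equiv.Perm.mul_apply]
    push_cast
    linear_combination (((Equiv.Perm.sign τ : ℤ) : 𝕂) *
      P fun a => curvature pr (u (ρ a)) (v (τ (ρ a)))) * hsq
  have hform : chernWeilForm pr P w = ((q ! : ℕ) : 𝕂)⁻¹ *
      ∑ σ : Equiv.Perm (Fin (2 * q)) with ∀ i : Fin q, σ (fstIdx i) < σ (sndIdx i),
        ((Equiv.Perm.sign σ : ℤ) : 𝕂) *
          P fun i : Fin q => curvature pr (w (σ (fstIdx i))) (w (σ (sndIdx i))) := rfl
  rw [hform, ← hsum, ← Finset.mul_sum, Fintype.sum_prod_type,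
    Finset.sum_congr rfl fun ρ _ => hinner ρ,
    Finset.sum_const, Finset.card_univ, Fintype.card_perm, Fintype.card_fin, nsmul_eq_mul,
    mul_left_comm, inv_mul_cancel_left₀ (Nat.cast_ne_zero.2 (Nat.factorial_ne_zero q))]

/-- If a Chern--Weil form is a relative coboundary, its invariant polynomial satisfies a
determinant-like relation for each two abelian families in the kernel of the projection whose mutual
brackets lie in the subalgebra. -/
theorem sum_sign_eq_zero_of_mem_relCoboundary [CharZero 𝕂] {pr : g →ₗ[𝕂] h}
    (hpr : IsInvariantProjection pr) {q : ℕ} {P : MultilinearMap 𝕂 (fun _ : Fin q => h) 𝕂}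
    (hP : ∀ (σ : Equiv.Perm (Fin q)) (v : Fin q → h), P (fun i => v (σ i)) = P v)
    (hω : chernWeilAlt pr q P ∈ relCoboundary h (2 * q)) (u v : Fin q → g) (m : Fin q → Fin q → h)
    (hu : ∀ a, pr (u a) = 0) (hv : ∀ a, pr (v a) = 0) (huu : ∀ a b, ⁅u a, u b⁆ = 0)
    (hvv : ∀ a b, ⁅v a, v b⁆ = 0) (huv : ∀ a b, ⁅u a, v b⁆ = m a b) :
    ∑ τ : Equiv.Perm (Fin q), ((Equiv.Perm.sign τ : ℤ) : 𝕂) * P (fun a => m a (τ a)) = 0 := by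
  obtain ⟨ε, hε⟩ := chernWeilForm_halves pr hP u v
    (fun a b => by rw [curvature, hv, zero_lie, hvv, map_zero, sub_zero])
  rw [chernWeilForm_eq_chernWeilAlt, apply_eq_zero_of_mem_relCoboundary hω] at hε
  · have hcurv : ∀ a b, curvature pr (u a) (v b) = (-1 : 𝕂) • m a b := by
      intro a b
      rw [curvature, hu, zero_lie, huv, hpr.1, zero_sub, neg_one_smul]
    simp only [hcurv, P.map_smul_univ, Finset.prod_const, smul_eq_mul] at hε
    simp only [mul_left_comm _ ((-1 : 𝕂) ^ _), ← Finset.mul_sum] at hε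
    have hε0 : ((ε : ℤ) : 𝕂) ≠ 0 := Int.cast_ne_zero.2 (Units.ne_zero ε)
    have h1 : (-1 : 𝕂) ^ Fintype.card (Fin q) ≠ 0 := pow_ne_zero _ (neg_ne_zero.2 one_ne_zero)
    simpa [hε0] using hε
  · intro i j
    obtain ⟨x, rfl⟩ := (halfEquiv q).surjective i
    obtain ⟨y, rfl⟩ := (halfEquiv q).surjective j
    simp only [Equiv.symm_apply_apply]
    rcases x with a | a <;> rcases y with b | b <;> simp only [Sum.elim_inl, Sum.elim_inr]
    · rw [huu]; exact h.zero_mem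
    · rw [huv]; exact (m a b).2
    · rw [← lie_skew, huv]; exact h.neg_mem (m b a).2
    · rw [hvv]; exact h.zero_mem

end RelLie

namespace WGamma

open MvPolynomial

/-! ### The projection to the degree zero part -/

section DegreeScale

variable {𝕂 : Type*} [Field 𝕂] {σ : Type*}

/-- The operator that multiplies the homogeneous polynomials of degree `n` by `c n`. -/
def degScale (c : ℕ → 𝕂) : MvPolynomial σ 𝕂 →ₗ[𝕂] MvPolynomial σ 𝕂 :=
  (basisMonomials σ 𝕂).constr 𝕂 fun s => monomial s (c s.degree)

theorem degScale_monomial (c : ℕ → 𝕂) (s : σ →₀ ℕ) :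
    degScale c (monomial s 1) = c s.degree • monomial s 1 := by
  have e : monomial s (1 : 𝕂) = basisMonomials σ 𝕂 s := by rw [coe_basisMonomials]
  rw [degScale, e, Module.Basis.constr_basis, coe_basisMonomials, smul_monomial, smul_eq_mul,
    mul_one]

theorem linearMap_ext_monomial {V : Type*} [AddCommGroup V] [Module 𝕂 V]
    {L L' : MvPolynomial σ 𝕂 →ₗ[𝕂] V} (h : ∀ s, L (monomial s 1) = L' (monomial s 1)) : L = L' :=
  (basisMonomials σ 𝕂).ext fun s => by rw [coe_basisMonomials]; exact h s

theorem degScale_of_isHomogeneous (c : ℕ → 𝕂) {f : MvPolynomial σ 𝕂} {n : ℕ}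
    (hf : f.IsHomogeneous n) : degScale c f = c n • f := by
  conv_lhs => rw [f.as_sum]
  conv_rhs => rw [f.as_sum]
  rw [map_sum, Finset.smul_sum]
  refine Finset.sum_congr rfl fun s hs => ?_
  have e : monomial s (coeff s f) = coeff s f • monomial s (1 : 𝕂) := by
    rw [smul_monomial, smul_eq_mul, mul_one]
  have hn : s.degree = n := by
    rw [Finsupp.degree_eq_weight_one]
    exact hf (mem_support_iff.1 hs)
  rw [e, map_smul, degScale_monomial, hn, smul_comm]

theorem degScale_degScale (c d : ℕ → 𝕂) (f : MvPolynomial σ 𝕂) :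
    degScale c (degScale d f) = degScale (fun n => c n * d n) f := by
  have : (degScale c).comp (degScale d) = degScale (σ := σ) fun n => c n * d n :=
    linearMap_ext_monomial fun s => by
      rw [LinearMap.comp_apply, degScale_monomial, map_smul, degScale_monomial, degScale_monomial,
        smul_smul, mul_comm]
  exact DFunLike.congr_fun this f

theorem degScale_one (f : MvPolynomial σ 𝕂) : degScale (fun _ => (1 : 𝕂)) f = f := by
  have : degScale (fun _ => (1 : 𝕂)) = LinearMap.id (M := MvPolynomial σ 𝕂) :=
    linearMap_ext_monomial fun s => by rw [degScale_monomial, one_smul]; rfl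
  exact DFunLike.congr_fun this f

theorem degScale_sub (c d : ℕ → 𝕂) (f : MvPolynomial σ 𝕂) :
    degScale (fun n => c n - d n) f = degScale c f - degScale d f := by
  have : degScale (fun n => c n - d n) = degScale (σ := σ) c - degScale d :=
    linearMap_ext_monomial fun s => by
      rw [LinearMap.sub_apply, degScale_monomial, degScale_monomial, degScale_monomial, sub_smul]
  exact DFunLike.congr_fun this f

/-- The scaling operators commute with the linear maps that preserve the degree. -/
theorem degScale_comm (c : ℕ → 𝕂) {L : MvPolynomial σ 𝕂 →ₗ[𝕂] MvPolynomial σ 𝕂}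
    (hL : ∀ s, (L (monomial s 1)).IsHomogeneous s.degree) (f : MvPolynomial σ 𝕂) :
    degScale c (L f) = L (degScale c f) := by
  have : (degScale c).comp L = L.comp (degScale c) :=
    linearMap_ext_monomial fun s => by
      rw [LinearMap.comp_apply, degScale_of_isHomogeneous c (hL s), LinearMap.comp_apply,
        degScale_monomial, map_smul]
  exact DFunLike.congr_fun this f

theorem isHomogeneous_degScale_single (n : ℕ) (f : MvPolynomial σ 𝕂) :
    (degScale (Pi.single n (1 : 𝕂)) f).IsHomogeneous n := by
  induction f using MvPolynomial.induction_on' with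
  | add f f' h h' => rw [map_add]; exact h.add h'
  | monomial s c =>
    rw [degScale_of_isHomogeneous _ (isHomogeneous_monomial c rfl)]
    by_cases hs : s.degree = n
    · exact (homogeneousSubmodule σ 𝕂 n).smul_mem _ (isHomogeneous_monomial c hs)
    · rw [Pi.single_eq_of_ne hs, zero_smul]
      exact isHomogeneous_zero σ 𝕂 n

theorem derivation_monomial_eq_sum (D : Derivation 𝕂 (MvPolynomial σ 𝕂) (MvPolynomial σ 𝕂))
    {n : ℕ} (w : Fin n → σ) : D (monomial (∑ a, Finsupp.single (w a) 1) 1) =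
      ∑ a, (∏ j ∈ Finset.univ.erase a, X (w j)) * D (X (w a)) := by
  rw [← GlPoly.prod_X_eq_monomial, GlPoly.derivation_prod]

theorem isHomogeneous_derivation_monomial
    (D : Derivation 𝕂 (MvPolynomial σ 𝕂) (MvPolynomial σ 𝕂))
    (hD : ∀ i, (D (X i)).IsHomogeneous 1) (s : σ →₀ ℕ) :
    (D (monomial s 1)).IsHomogeneous s.degree := by
  obtain ⟨w, hw⟩ := GlPoly.exists_word s.degree s rfl
  rw [← hw, derivation_monomial_eq_sum, hw]
  refine IsHomogeneous.sum _ _ _ fun a _ => ?_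
  have hcard : (∑ _j ∈ Finset.univ.erase a, 1) + 1 = s.degree := by
    rw [Finset.sum_const, smul_eq_mul, mul_one, Finset.card_erase_add_one (Finset.mem_univ a),
      Finset.card_univ, Fintype.card_fin]
  have := (IsHomogeneous.prod (Finset.univ.erase a) (fun j => (X (w j) : MvPolynomial σ 𝕂))
    (fun _ => 1) fun j _ => isHomogeneous_X 𝕂 (w j)).mul (hD (w a))
  rwa [hcard] at this

/-- Euler's identity. -/
theorem mkDerivation_X_apply (f : MvPolynomial σ 𝕂) :
    mkDerivation 𝕂 (X : σ → MvPolynomial σ 𝕂) f = degScale (fun n => (n : 𝕂)) f := by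
  have : ((mkDerivation 𝕂 X : Derivation 𝕂 (MvPolynomial σ 𝕂) (MvPolynomial σ 𝕂)) :
      MvPolynomial σ 𝕂 →ₗ[𝕂] MvPolynomial σ 𝕂) = degScale fun n => (n : 𝕂) :=
    linearMap_ext_monomial fun s => by
      obtain ⟨w, hw⟩ := GlPoly.exists_word s.degree s rfl
      rw [degScale_monomial, Derivation.coeFn_coe]
      conv_lhs => rw [← hw, derivation_monomial_eq_sum]
      simp only [mkDerivation_X, Finset.prod_erase_mul, Finset.mem_univ]
      rw [Finset.sum_const, GlPoly.prod_X_eq_monomial, hw, Finset.card_univ, Fintype.card_fin,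
        Nat.cast_smul_eq_nsmul]
  exact DFunLike.congr_fun this f

end DegreeScale

variable {𝕂 : Type*} [Field 𝕂] {k m N : ℕ} {ev : Fin m → 𝕂ˣ}

theorem lie_left_apply (x y : W 𝕂 k m N) (s t : Fin N) : (⁅x, y⁆ : W 𝕂 k m N).left s t =
    (∑ l, x.left s l * y.left l t - ∑ l, y.left s l * x.left l t)
      + x.right (y.left s t) - y.right (x.left s t) := rfl

theorem lie_right_apply (x y : W 𝕂 k m N) (f : Poly 𝕂 k m) : (⁅x, y⁆ : W 𝕂 k m N).right f =
    x.right (y.right f) - y.right (x.right f) := rfl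

theorem W_ext {x y : W 𝕂 k m N} (hl : ∀ s t, x.left s t = y.left s t)
    (hr : ∀ i, x.right (X i) = y.right (X i)) : x = y :=
  LieAlgebra.SemiDirectSum.ext (Matrix.ext hl) (derivation_ext hr)

variable (ev) in
/-- The eigenvalues of `γ` on the coordinates. -/
def weight : Fin k ⊕ Fin m → 𝕂 := Sum.elim (fun _ => 1) fun j => ev j

theorem gammaPoly_X (i : Fin k ⊕ Fin m) : gammaPoly k ev (X i) = weight ev i • X i := by
  rw [gammaPoly, aeval_X]
  cases i with
  | inl i => rw [weight, Sum.elim_inl, Sum.elim_inl, one_smul]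
  | inr j => rfl

/-- A vector field is `γ`-invariant when its coefficients are eigenvectors of `γ` with the same
eigenvalues as the coordinates. -/
theorem gammaPoly_derivation_iff (D : Derivation 𝕂 (Poly 𝕂 k m) (Poly 𝕂 k m)) :
    (∀ f, gammaPoly k ev (D f) = D (gammaPoly k ev f)) ↔
      ∀ i, gammaPoly k ev (D (X i)) = weight ev i • D (X i) := by
  refine ⟨fun h i => by rw [h, gammaPoly_X, D.map_smul], fun h f => ?_⟩
  induction f using MvPolynomial.induction_on with
  | C a => rw [derivation_C, map_zero, ← algebraMap_eq, AlgHom.commutes, D.map_algebraMap]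
  | add f f' hf hf' => rw [map_add, map_add, map_add, map_add, hf, hf']
  | mul_X f i hf =>
    rw [D.leibniz, map_mul, D.leibniz, map_add, smul_eq_mul, smul_eq_mul, map_mul, map_mul, hf, h,
      gammaPoly_X, D.map_smul, smul_eq_mul, smul_eq_mul]

theorem degScale_gammaPoly (c : ℕ → 𝕂) (f : Poly 𝕂 k m) :
    degScale c (gammaPoly k ev f) = gammaPoly k ev (degScale c f) := by
  refine degScale_comm c (L := (gammaPoly k ev).toLinearMap) (fun s => ?_) f
  have := (isHomogeneous_monomial (1 : 𝕂) (d := s) rfl).aeval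
    (Sum.elim (fun i => qVar 𝕂 m i) (fun j => (ev j : 𝕂) • zVar 𝕂 k j)) (n := 1) (by
      rintro (i | j)
      · exact isHomogeneous_X 𝕂 _
      · exact (homogeneousSubmodule _ 𝕂 1).smul_mem _ (isHomogeneous_X 𝕂 _))
  rwa [one_mul] at this

/-- The operator on `W` that multiplies the homogeneous matrices of degree `n` by `c n` and the
vector fields with homogeneous coefficients of degree `n` by `d n`. -/
def scale (c d : ℕ → 𝕂) : W 𝕂 k m N →ₗ[𝕂] W 𝕂 k m N where
  toFun x := ⟨x.left.map (degScale c), mkDerivation 𝕂 fun i => degScale d (x.right (X i))⟩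
  map_add' x y := W_ext (fun s t => by simp) (fun i => by simp)
  map_smul' a x := W_ext (fun s t => by simp) (fun i => by simp)

theorem scale_left (c d : ℕ → 𝕂) (x : W 𝕂 k m N) (s t : Fin N) :
    (scale c d x).left s t = degScale c (x.left s t) := rfl

theorem scale_right (c d : ℕ → 𝕂) (x : W 𝕂 k m N) (i : Fin k ⊕ Fin m) :
    (scale c d x).right (X i) = degScale d (x.right (X i)) :=
  mkDerivation_X _ _ _

theorem scale_mem (c d : ℕ → 𝕂) {x : W 𝕂 k m N} (hx : x ∈ Wγ k N ev) :
    scale c d x ∈ Wγ k N ev := by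
  refine ⟨fun s t => ?_, (gammaPoly_derivation_iff _).2 fun i => ?_⟩
  · rw [scale_left, ← degScale_gammaPoly, hx.1]
  · rw [scale_right, ← degScale_gammaPoly, (gammaPoly_derivation_iff _).1 hx.2, map_smul]

/-- Multiplication of the homogeneous parts by scalars as an operator on `Wγ`. -/
def scaleγ (c d : ℕ → 𝕂) : Wγ k N ev →ₗ[𝕂] Wγ k N ev :=
  (scale c d).restrict fun _ hx => scale_mem c d hx

theorem coe_scaleγ (c d : ℕ → 𝕂) (x : Wγ k N ev) :
    (scaleγ c d x : W 𝕂 k m N) = scale c d (x : W 𝕂 k m N) := rfl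

theorem Wγ_ext {x y : Wγ k N ev}
    (hl : ∀ s t, (x : W 𝕂 k m N).left s t = (y : W 𝕂 k m N).left s t)
    (hr : ∀ i, (x : W 𝕂 k m N).right (X i) = (y : W 𝕂 k m N).right (X i)) : x = y :=
  Subtype.ext (W_ext hl hr)

theorem scaleγ_scaleγ (c d c' d' : ℕ → 𝕂) (x : Wγ k N ev) :
    scaleγ c d (scaleγ c' d' x) = scaleγ (fun n => c n * c' n) (fun n => d n * d' n) x :=
  Wγ_ext (fun s t => by simp only [coe_scaleγ, scale_left, degScale_degScale])
    (fun i => by simp only [coe_scaleγ, scale_right, degScale_degScale])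

theorem scaleγ_one (x : Wγ k N ev) : scaleγ (fun _ => 1) (fun _ => 1) x = x :=
  Wγ_ext (fun s t => by simp only [coe_scaleγ, scale_left, degScale_one])
    (fun i => by simp only [coe_scaleγ, scale_right, degScale_one])

theorem scaleγ_sub (c d c' d' : ℕ → 𝕂) (x : Wγ k N ev) :
    scaleγ (fun n => c n - c' n) (fun n => d n - d' n) x = scaleγ c d x - scaleγ c' d' x :=
  Wγ_ext (fun s t => degScale_sub _ _ _)
    (fun i => by
      have e : ((scaleγ c d x - scaleγ c' d' x : Wγ k N ev) : W 𝕂 k m N).right (X i) =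
        (scaleγ c d x : W 𝕂 k m N).right (X i) - (scaleγ c' d' x : W 𝕂 k m N).right (X i) := rfl
      simp only [e, coe_scaleγ, scale_right, degScale_sub])

theorem isHomogeneous_of_mem_h₁ {x : Wγ k N ev} (hx : x ∈ h₁ k N ev) (i : Fin k ⊕ Fin m) :
    ((x : W 𝕂 k m N).right (X i)).IsHomogeneous 1 := by
  cases i with
  | inl i =>
    refine Submodule.span_le (p := homogeneousSubmodule _ 𝕂 1).2 ?_ (hx.2.1 i)
    rintro _ ⟨j, rfl⟩
    exact isHomogeneous_X 𝕂 _
  | inr j =>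
    refine Submodule.span_le (p := homogeneousSubmodule _ 𝕂 1).2 ?_ (hx.2.2 j)
    rintro _ ⟨j', -, rfl⟩
    exact isHomogeneous_X 𝕂 _

/-- A homogeneous linear form that is an eigenvector of `γ` is a combination of the coordinates
with the same eigenvalue. -/
theorem mem_span_of_gammaPoly_eq {f : Poly 𝕂 k m} (hf : f.IsHomogeneous 1) {c : 𝕂}
    (hc : gammaPoly k ev f = c • f) :
    f ∈ Submodule.span 𝕂 {g : Poly 𝕂 k m | ∃ i, weight ev i = c ∧ g = X i} := by
  have hmem : f ∈ homogeneousSubmodule (Fin k ⊕ Fin m) 𝕂 1 := hf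
  rw [homogeneousSubmodule_one_eq_span_X] at hmem
  obtain ⟨t, rfl⟩ := (Submodule.mem_span_range_iff_exists_fun 𝕂).1 hmem
  refine Submodule.sum_mem _ fun i _ => ?_
  by_cases hi : weight ev i = c
  · exact Submodule.smul_mem _ _ (Submodule.subset_span ⟨i, hi, rfl⟩)
  · have hlin : LinearIndependent 𝕂 (X : Fin k ⊕ Fin m → Poly 𝕂 k m) := linearIndependent_X _ _
    have h0 : ∑ j, ((weight ev j - c) * t j) • (X j : Poly 𝕂 k m) = 0 := by
      rw [map_sum, Finset.smul_sum, ← sub_eq_zero, ← Finset.sum_sub_distrib] at hc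
      rw [← hc]
      refine Finset.sum_congr rfl fun j _ => ?_
      rw [map_smul, gammaPoly_X, smul_smul, smul_smul, ← sub_smul]
      congr 1
      ring
    have := (mul_eq_zero.1 (Fintype.linearIndependent_iff.1 hlin _ h0 i)).resolve_left
      (sub_ne_zero.2 hi)
    rw [this, zero_smul]
    exact Submodule.zero_mem _

/-- The part of degree zero of an invariant element lies in `h₁`. Since no `ev j` is `1`, the
eigenvalues tell the `q_i` from the `z_j`. -/
theorem scaleγ_single_mem_h₁ (hev : ∀ j, ev j ≠ 1) (x : Wγ k N ev) :
    scaleγ (Pi.single 0 1) (Pi.single 1 1) x ∈ h₁ k N ev := by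
  have hspan : ∀ i, (scaleγ (Pi.single 0 1) (Pi.single 1 1) x : W 𝕂 k m N).right (X i) ∈
      Submodule.span 𝕂 {g : Poly 𝕂 k m | ∃ j, weight ev j = weight ev i ∧ g = X j} := by
    intro i
    refine mem_span_of_gammaPoly_eq ?_
      ((gammaPoly_derivation_iff _).1 (scaleγ (Pi.single 0 1) (Pi.single 1 1) x).2.2 i)
    rw [coe_scaleγ, scale_right]
    exact isHomogeneous_degScale_single 1 _
  refine ⟨fun s t => ?_, fun i => ?_, fun j => ?_⟩
  · have h := isHomogeneous_degScale_single 0 ((x : W 𝕂 k m N).left s t)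
    exact ⟨_, totalDegree_eq_zero_iff_eq_C.1 ((totalDegree_zero_iff_isHomogeneous _).2 h)⟩
  · refine Submodule.span_mono ?_ (hspan (Sum.inl i))
    rintro _ ⟨i' | j', h, rfl⟩
    · exact ⟨i', rfl⟩
    · exact absurd (Units.ext h) (hev j')
  · refine Submodule.span_mono ?_ (hspan (Sum.inr j))
    rintro _ ⟨i' | j', h, rfl⟩
    · exact absurd (Units.ext h.symm) (hev j)
    · exact ⟨j', Units.ext h, rfl⟩

/-- The elements of `h₁` have degree zero. -/
theorem scaleγ_of_mem_h₁ (c d : ℕ → 𝕂) (hc : c 0 = 1) (hd : d 1 = 1) {x : Wγ k N ev}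
    (hx : x ∈ h₁ k N ev) : scaleγ c d x = x :=
  Wγ_ext
    (fun s t => by
      obtain ⟨a, ha⟩ := hx.1 s t
      rw [coe_scaleγ, scale_left, ha, degScale_of_isHomogeneous c (isHomogeneous_C _ a), hc,
        one_smul])
    (fun i => by
      rw [coe_scaleγ, scale_right, degScale_of_isHomogeneous d (isHomogeneous_of_mem_h₁ hx i), hd,
        one_smul])

/-- The scaling operators commute with the action of `h₁`, which has degree zero. -/
theorem scaleγ_lie (c d : ℕ → 𝕂) {x : Wγ k N ev} (hx : x ∈ h₁ k N ev) (y : Wγ k N ev) :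
    scaleγ c d ⁅x, y⁆ = ⁅x, scaleγ c d y⁆ := by
  have hhom := isHomogeneous_of_mem_h₁ hx
  have hcomm : ∀ (c' : ℕ → 𝕂) f, degScale c' ((x : W 𝕂 k m N).right f) =
      (x : W 𝕂 k m N).right (degScale c' f) := fun c' f =>
    degScale_comm c' (L := ((x : W 𝕂 k m N).right : Poly 𝕂 k m →ₗ[𝕂] Poly 𝕂 k m))
      (isHomogeneous_derivation_monomial _ hhom) f
  refine Wγ_ext (fun s t => ?_) fun i => ?_
  · choose a ha using hx.1
    simp only [coe_scaleγ, LieSubalgebra.coe_bracket, scale_left, lie_left_apply, ha, derivation_C,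
      mul_comm _ (C _), ← smul_eq_C_mul, map_sub, map_add, map_sum, map_smul, map_zero, hcomm]
  -- For the vector fields: both sides of the identity `hlin` are linear in `f`, and they agree on
  -- the coordinates.
  · have hlin : ∀ f : Poly 𝕂 k m, f.IsHomogeneous 1 →
        degScale d ((y : W 𝕂 k m N).right f) = (scale c d (y : W 𝕂 k m N)).right f := by
      intro f hf
      have hmem : f ∈ homogeneousSubmodule (Fin k ⊕ Fin m) 𝕂 1 := hf
      rw [homogeneousSubmodule_one_eq_span_X] at hmem
      obtain ⟨t, rfl⟩ := (Submodule.mem_span_range_iff_exists_fun 𝕂).1 hmem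
      simp only [map_sum, Derivation.map_smul, map_smul, scale_right]
    rw [coe_scaleγ, scale_right, LieSubalgebra.coe_bracket, LieSubalgebra.coe_bracket,
      lie_right_apply, lie_right_apply, map_sub, hcomm, coe_scaleγ, scale_right, hlin _ (hhom i)]

/-- The projection of `Wγ` to its part of degree zero. -/
def degreeZero (hev : ∀ j, ev j ≠ 1) : Wγ k N ev →ₗ[𝕂] h₁ k N ev :=
  LinearMap.codRestrict (h₁ k N ev).toSubmodule (scaleγ (Pi.single 0 1) (Pi.single 1 1))
    (scaleγ_single_mem_h₁ hev)

theorem coe_degreeZero (hev : ∀ j, ev j ≠ 1) (x : Wγ k N ev) :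
    (degreeZero hev x : Wγ k N ev) = scaleγ (Pi.single 0 1) (Pi.single 1 1) x := rfl

theorem isInvariantProjection_degreeZero (hev : ∀ j, ev j ≠ 1) :
    RelLie.IsInvariantProjection (degreeZero (k := k) (N := N) hev) :=
  ⟨fun x => Subtype.ext (scaleγ_of_mem_h₁ _ _ (Pi.single_eq_same 0 1) (Pi.single_eq_same 1 1) x.2),
    fun x y => Subtype.ext (scaleγ_lie _ _ x.2 y)⟩

variable (k N ev) in
/-- The Euler vector field `∑ q_i ∂/∂q_i + ∑ z_j ∂/∂z_j`. -/
def euler : Wγ k N ev :=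
  ⟨⟨0, mkDerivation 𝕂 X⟩, fun s t => map_zero _, (gammaPoly_derivation_iff _).2 fun i => by
    rw [mkDerivation_X, gammaPoly_X]⟩

theorem euler_mem_h₁ : euler k N ev ∈ h₁ k N ev := by
  have hr : ∀ i, (euler k N ev : W 𝕂 k m N).right (X i) = X i := mkDerivation_X 𝕂 X
  refine ⟨fun s t => ⟨0, (map_zero C).symm⟩, fun i => ?_, fun j => ?_⟩
  · exact Submodule.subset_span ⟨i, (hr _).symm⟩
  · exact Submodule.subset_span ⟨j, rfl, hr _⟩

/-- A vector field with coefficients of degree `n` has weight `n - 1` under the Euler field, a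
matrix of degree `n` has weight `n`. -/
theorem lie_euler (x : Wγ k N ev) :
    ⁅euler k N ev, x⁆ = scaleγ (fun n => (n : 𝕂)) (fun n => (n : 𝕂) - 1) x := by
  refine Wγ_ext (fun s t => ?_) fun i => ?_
  · have hl : ∀ s t, (euler k N ev : W 𝕂 k m N).left s t = 0 := fun _ _ => rfl
    have hr : ∀ f, (euler k N ev : W 𝕂 k m N).right f = mkDerivation 𝕂 X f := fun _ => rfl
    rw [LieSubalgebra.coe_bracket, lie_left_apply, coe_scaleγ, scale_left]
    simp only [hl, hr, zero_mul, mul_zero, Finset.sum_const_zero, sub_zero, zero_add, map_zero,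
      mkDerivation_X_apply]
  · have hr : ∀ f, (euler k N ev : W 𝕂 k m N).right f = mkDerivation 𝕂 X f := fun _ => rfl
    rw [LieSubalgebra.coe_bracket, lie_right_apply, coe_scaleγ, scale_right, hr, hr, mkDerivation_X,
      mkDerivation_X_apply, degScale_sub, degScale_one]

/-- The part of degree zero is the only invariant projection: the Euler field is central in `h₁`,
and it acts invertibly on the parts of other degrees. -/
theorem eq_degreeZero [CharZero 𝕂] (hev : ∀ j, ev j ≠ 1) {pr : Wγ k N ev →ₗ[𝕂] h₁ k N ev}
    (hpr : RelLie.IsInvariantProjection pr) : pr = degreeZero hev := by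
  have hcentral : ∀ x : h₁ k N ev, ⁅(⟨euler k N ev, euler_mem_h₁⟩ : h₁ k N ev), x⁆ = 0 := by
    intro x
    refine Subtype.ext ?_
    have hx : (x : Wγ k N ev) = scaleγ (Pi.single 0 1) (Pi.single 1 1) (x : Wγ k N ev) :=
      (scaleγ_of_mem_h₁ _ _ (Pi.single_eq_same 0 1) (Pi.single_eq_same 1 1) x.2).symm
    have e1 : (fun n : ℕ => (n : 𝕂) * Pi.single (M := fun _ => 𝕂) 0 1 n) = fun _ => 1 - 1 := by
      funext n
      rcases eq_or_ne n 0 with rfl | hn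
      · simp
      · simp [hn]
    have e2 : (fun n : ℕ => ((n : 𝕂) - 1) * Pi.single (M := fun _ => 𝕂) 1 1 n) =
        fun _ => 1 - 1 := by
      funext n
      rcases eq_or_ne n 1 with rfl | hn
      · simp
      · simp [hn]
    rw [LieSubalgebra.coe_bracket, lie_euler, hx, scaleγ_scaleγ, e1, e2, scaleγ_sub, sub_self]
    rfl
  -- In the degree of `h₁` itself the inverses below are `0⁻¹ = 0`.
  have hker : ∀ y, pr (y - scaleγ (Pi.single 0 1) (Pi.single 1 1) y) = 0 := by
    intro y
    have e1 : (fun n : ℕ => (n : 𝕂) * (n : 𝕂)⁻¹) =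
        fun n => 1 - Pi.single (M := fun _ => 𝕂) 0 1 n := by
      funext n
      rcases eq_or_ne n 0 with rfl | hn
      · simp
      · simp [hn]
    have e2 : (fun n : ℕ => ((n : 𝕂) - 1) * ((n : 𝕂) - 1)⁻¹) =
        fun n => 1 - Pi.single (M := fun _ => 𝕂) 1 1 n := by
      funext n
      rcases eq_or_ne n 1 with rfl | hn
      · simp
      · rw [mul_inv_cancel₀ (sub_ne_zero.2 (by exact_mod_cast hn)), Pi.single_eq_of_ne hn, sub_zero]
    have e : y - scaleγ (Pi.single 0 1) (Pi.single 1 1) y =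
        ⁅euler k N ev, scaleγ (fun n => (n : 𝕂)⁻¹) (fun n => ((n : 𝕂) - 1)⁻¹) y⁆ := by
      rw [lie_euler, scaleγ_scaleγ, e1, e2, scaleγ_sub, scaleγ_one]
    rw [e, hpr.2 ⟨euler k N ev, euler_mem_h₁⟩, hcentral]
  ext1 y
  have h := hker y
  rw [map_sub, sub_eq_zero] at h
  rw [h, ← coe_degreeZero hev, hpr.1]

/-! ### Matrix units in the degree zero part -/

/-- The indices of the matrix units: the coordinates `q_i`, the coordinates `z_j`, and the
indices of `gl_N`. -/
abbrev Idx (k m N : ℕ) : Type := Fin k ⊕ (Fin m ⊕ Fin N)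

/-- The index of a coordinate. -/
def varIdx : Fin k ⊕ Fin m → Idx k m N := Sum.elim Sum.inl fun j => Sum.inr (Sum.inl j)

theorem varIdx_injective : Function.Injective (varIdx (k := k) (m := m) (N := N)) := by
  rintro (i | i) (j | j) h <;> simp_all [varIdx]

/-- The index of a basis vector on which `gl_N` acts. -/
abbrev matIdx (s : Fin N) : Idx k m N := Sum.inr (Sum.inr s)

theorem varIdx_ne_matIdx (i : Fin k ⊕ Fin m) (s : Fin N) : varIdx i ≠ (matIdx s : Idx k m N) := by
  cases i <;> simp [varIdx]

variable (ev) in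
/-- The block of `h₁` to which an index belongs. As no `ev j` is `1`, the value `1` is free for the
coordinates `q_i`. -/
def block : Idx k m N → Option 𝕂ˣ :=
  Sum.elim (fun _ => some 1) (Sum.elim (fun j => some (ev j)) fun _ => none)

variable (𝕂) in
/-- The coordinate of an index, and `0` for the indices of `gl_N`. -/
def coord : Idx k m N → Poly 𝕂 k m :=
  Sum.elim (fun i => X (Sum.inl i)) (Sum.elim (fun j => X (Sum.inr j)) fun _ => 0)

theorem coord_varIdx (i : Fin k ⊕ Fin m) : coord 𝕂 (varIdx i : Idx k m N) = X i := by
  cases i <;> rfl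

theorem idx_cases (a : Idx k m N) : (∃ i, a = varIdx i) ∨ ∃ s, a = matIdx s := by
  rcases a with i | j | s
  · exact Or.inl ⟨Sum.inl i, rfl⟩
  · exact Or.inl ⟨Sum.inr j, rfl⟩
  · exact Or.inr ⟨s, rfl⟩

theorem block_varIdx (i : Fin k ⊕ Fin m) : ∃ c : 𝕂ˣ,
    block ev (varIdx i : Idx k m N) = some c ∧ (c : 𝕂) = weight ev i := by
  cases i
  · exact ⟨1, rfl, rfl⟩
  · exact ⟨_, rfl, rfl⟩

theorem block_matIdx_eq_iff {a : Idx k m N} {s : Fin N} :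
    block ev a = block ev (matIdx s : Idx k m N) ↔ ∃ t, a = matIdx t := by
  rcases a with i | j | t <;> simp [block]

theorem gammaPoly_coord {a : Idx k m N} {i : Fin k ⊕ Fin m}
    (h : block ev a = block ev (varIdx i : Idx k m N)) :
    gammaPoly k ev (coord 𝕂 a) = weight ev i • coord 𝕂 a := by
  obtain ⟨j, rfl⟩ | ⟨s, rfl⟩ := idx_cases a
  · obtain ⟨c, hc, hc'⟩ := block_varIdx (N := N) (ev := ev) i
    obtain ⟨d, hd, hd'⟩ := block_varIdx (N := N) (ev := ev) j
    rw [hc, hd, Option.some_inj] at h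
    rw [coord_varIdx, gammaPoly_X, ← hc', ← hd', h]
  · have e : coord 𝕂 (matIdx s : Idx k m N) = 0 := rfl
    rw [e, map_zero, smul_zero]

open Classical in
/-- The vector field `x_a ∂/∂x_b` for two coordinates, the elementary matrix for two indices of
`gl_N`, both for indices in the same block, and `0` otherwise. -/
def unitW (ev : Fin m → 𝕂ˣ) (a b : Idx k m N) : W 𝕂 k m N :=
  if block ev a = block ev b then
    ⟨Matrix.of fun s t => if a = matIdx s ∧ b = matIdx t then 1 else 0,
      mkDerivation 𝕂 fun i => if varIdx i = b then coord 𝕂 a else 0⟩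
  else 0

theorem unitW_left {a b : Idx k m N} (h : block ev a = block ev b) (s t : Fin N) :
    (unitW ev a b).left s t = if a = matIdx s ∧ b = matIdx t then 1 else 0 := by
  rw [unitW, if_pos h]
  rfl

theorem unitW_right {a b : Idx k m N} (h : block ev a = block ev b) (i : Fin k ⊕ Fin m) :
    (unitW ev a b).right (X i) = if varIdx i = b then coord 𝕂 a else 0 := by
  rw [unitW, if_pos h]
  exact mkDerivation_X _ _ _

theorem unitW_of_ne {a b : Idx k m N} (h : block ev a ≠ block ev b) : unitW ev a b = 0 := by
  rw [unitW, if_neg h]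

theorem unitW_right_coord {a b : Idx k m N} (h : block ev a = block ev b) (c : Idx k m N) :
    (unitW ev a b).right (coord 𝕂 c) = if b = c then coord 𝕂 a else 0 := by
  obtain ⟨j, rfl⟩ | ⟨s, rfl⟩ := idx_cases c
  · rw [coord_varIdx, unitW_right h]
    simp only [eq_comm]
  · have e : coord 𝕂 (matIdx s : Idx k m N) = 0 := rfl
    rw [e, map_zero]
    split_ifs with hb
    · subst hb
      obtain ⟨t, rfl⟩ := block_matIdx_eq_iff.1 h
      rfl
    · rfl

theorem unitW_mem_Wγ (a b : Idx k m N) : unitW ev a b ∈ Wγ k N ev := by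
  by_cases h : block ev a = block ev b
  · refine ⟨fun s t => ?_, (gammaPoly_derivation_iff _).2 fun i => ?_⟩
    · rw [unitW_left h]
      split_ifs
      · exact map_one _
      · exact map_zero _
    · rw [unitW_right h]
      split_ifs with hi
      · exact gammaPoly_coord (hi ▸ h)
      · rw [map_zero, smul_zero]
  · rw [unitW_of_ne h]
    exact (Wγ k N ev).zero_mem

theorem unitW_mem_h₁ (hev : ∀ j, ev j ≠ 1) (a b : Idx k m N) :
    (⟨unitW ev a b, unitW_mem_Wγ a b⟩ : Wγ k N ev) ∈ h₁ k N ev := by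
  by_cases h : block ev a = block ev b
  · refine ⟨fun s t => ?_, fun i => ?_, fun j => ?_⟩
    · exact ⟨if a = matIdx s ∧ b = matIdx t then 1 else 0, by
        rw [unitW_left h, apply_ite C, map_one, map_zero]⟩
    · have e := unitW_right h (Sum.inl i)
      rw [e]
      split_ifs with hi
      · subst hi
        rcases a with i' | j' | s
        · exact Submodule.subset_span ⟨i', rfl⟩
        · exact absurd (Option.some_injective _ h) (hev j')
        · exact Submodule.zero_mem _
      · exact Submodule.zero_mem _
    · have e := unitW_right h (Sum.inr j)
      rw [e]
      split_ifs with hi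
      · subst hi
        rcases a with i' | j' | s
        · exact absurd (Option.some_injective _ h).symm (hev j)
        · exact Submodule.subset_span ⟨j', Option.some_injective _ h, rfl⟩
        · exact Submodule.zero_mem _
      · exact Submodule.zero_mem _
  · have e : (⟨unitW ev a b, unitW_mem_Wγ a b⟩ : Wγ k N ev) = 0 := Subtype.ext (unitW_of_ne h)
    rw [e]
    exact (h₁ k N ev).zero_mem

/-- The matrix units of `h₁`, extended by `0` to pairs of indices in different blocks. -/
def unit (hev : ∀ j, ev j ≠ 1) (a b : Idx k m N) : h₁ k N ev :=
  ⟨⟨unitW ev a b, unitW_mem_Wγ a b⟩, unitW_mem_h₁ hev a b⟩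

theorem unit_of_ne (hev : ∀ j, ev j ≠ 1) {a b : Idx k m N} (h : block ev a ≠ block ev b) :
    unit hev a b = 0 :=
  Subtype.ext (Subtype.ext (unitW_of_ne h))

/-- The relations of matrix units. They hold for indices in different blocks too, where both sides
vanish. -/
theorem lie_unitW {a b : Idx k m N} (hab : block ev a = block ev b) (c d : Idx k m N) :
    ⁅unitW ev a b, unitW ev c d⁆ =
      (if b = c then unitW ev a d else 0) - (if d = a then unitW ev c b else 0) := by
  by_cases hcd : block ev c = block ev d
  · have hl : ∀ (p : Prop) [Decidable p] (x : W 𝕂 k m N) s t,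
        (if p then x else 0).left s t = if p then x.left s t else 0 := by
      intro p _ x s t
      split_ifs <;> rfl
    have hr : ∀ (p : Prop) [Decidable p] (x : W 𝕂 k m N) f,
        (if p then x else 0).right f = if p then x.right f else 0 := by
      intro p _ x f
      split_ifs <;> rfl
    have hsub : ∀ (x y : W 𝕂 k m N) s t, (x - y).left s t = x.left s t - y.left s t :=
      fun _ _ _ _ => rfl
    have hsub' : ∀ (x y : W 𝕂 k m N) f, (x - y).right f = x.right f - y.right f :=
      fun _ _ _ => rfl
    have hprod : ∀ {a b c d : Idx k m N}, block ev a = block ev b → block ev c = block ev d →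
        ∀ s t, ∑ l, (unitW ev a b).left s l * (unitW ev c d).left l t =
          if b = c then (unitW ev a d).left s t else 0 := by
      intro a b c d hab hcd s t
      by_cases ha : a = matIdx s
      · subst ha
        obtain ⟨l, rfl⟩ := block_matIdx_eq_iff.1 hab.symm
        rw [Finset.sum_eq_single l]
        · split_ifs with hc
          · subst hc
            rw [unitW_left hab, unitW_left hcd, unitW_left (hab.trans hcd)]
            simp
          · rw [unitW_left hcd, if_neg fun h => hc h.1.symm, mul_zero]
        · intro l' _ hl'
          rw [unitW_left hab, if_neg, zero_mul]
          rintro ⟨-, h⟩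
          simp only [Sum.inr.injEq] at h
          exact hl' h.symm
        · exact fun h => absurd (Finset.mem_univ l) h
      · rw [Finset.sum_eq_zero]
        · split_ifs with hc
          · subst hc
            rw [unitW_left (hab.trans hcd), if_neg fun h => ha h.1]
          · rfl
        · intro l _
          rw [unitW_left hab, if_neg fun h => ha h.1, zero_mul]
    have hconst : ∀ {a b : Idx k m N}, block ev a = block ev b →
        ∀ (D : Derivation 𝕂 (Poly 𝕂 k m) (Poly 𝕂 k m)) s t, D ((unitW ev a b).left s t) = 0 := by
      intro a b hab D s t
      rw [unitW_left hab]
      split_ifs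
      · exact D.map_one_eq_zero
      · exact map_zero D
    refine W_ext (fun s t => ?_) fun i => ?_
    · rw [lie_left_apply, hprod hab hcd, hprod hcd hab, hconst hcd, hconst hab, hsub, hl, hl]
      ring
    · rw [lie_right_apply, hsub', hr, hr, unitW_right hcd, unitW_right hab, apply_ite
        (unitW ev a b).right, apply_ite (unitW ev c d).right, map_zero, map_zero,
        unitW_right_coord hab, unitW_right_coord hcd]
      have h1 : b = c → (unitW ev a d).right (X i) = if varIdx i = d then coord 𝕂 a else 0 := by
        rintro rfl
        exact unitW_right (hab.trans hcd) i
      have h2 : d = a → (unitW ev c b).right (X i) = if varIdx i = b then coord 𝕂 c else 0 := by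
        rintro rfl
        exact unitW_right (hcd.trans hab) i
      rw [ite_congr rfl h1 fun _ => rfl, ite_congr rfl h2 fun _ => rfl]
      split_ifs <;> rfl
  · rw [unitW_of_ne hcd, lie_zero]
    have h1 : (if b = c then unitW ev a d else 0) = 0 := by
      split_ifs with h
      · subst h
        exact unitW_of_ne fun h => hcd (hab.symm.trans h)
      · rfl
    have h2 : (if d = a then unitW ev c b else 0) = 0 := by
      split_ifs with h
      · subst h
        exact unitW_of_ne fun h => hcd (h.trans hab.symm)
      · rfl
    rw [h1, h2, sub_zero]

theorem lie_unit (hev : ∀ j, ev j ≠ 1) {a b : Idx k m N} (hab : block ev a = block ev b)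
    (c d : Idx k m N) : ⁅unit hev a b, unit hev c d⁆ =
      (if b = c then unit hev a d else 0) - (if d = a then unit hev c b else 0) := by
  refine Subtype.ext (Subtype.ext ((lie_unitW hab c d).trans ?_))
  split_ifs <;> rfl

/-- The matrix entries of an element as a linear map. -/
def entryₗ (s t : Fin N) : h₁ k N ev →ₗ[𝕂] Poly 𝕂 k m where
  toFun x := ((x : Wγ k N ev) : W 𝕂 k m N).left s t
  map_add' _ _ := rfl
  map_smul' _ _ := rfl

/-- The coefficients of the vector field of an element as a linear map. -/
def coeffₗ (i : Fin k ⊕ Fin m) : h₁ k N ev →ₗ[𝕂] Poly 𝕂 k m where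
  toFun x := ((x : Wγ k N ev) : W 𝕂 k m N).right (X i)
  map_add' _ _ := rfl
  map_smul' _ _ := rfl

theorem h₁_ext {x y : h₁ k N ev} (hl : ∀ s t, entryₗ s t x = entryₗ s t y)
    (hr : ∀ i, coeffₗ i x = coeffₗ i y) : x = y :=
  Subtype.ext (Wγ_ext hl hr)

theorem entryₗ_unit (hev : ∀ j, ev j ≠ 1) {a b : Idx k m N} (h : block ev a = block ev b)
    (s t : Fin N) : entryₗ s t (unit hev a b) = if a = matIdx s ∧ b = matIdx t then 1 else 0 :=
  unitW_left h s t

theorem coeffₗ_unit (hev : ∀ j, ev j ≠ 1) {a b : Idx k m N} (h : block ev a = block ev b)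
    (i : Fin k ⊕ Fin m) : coeffₗ i (unit hev a b) = if varIdx i = b then coord 𝕂 a else 0 :=
  unitW_right h i

theorem span_unit (hev : ∀ j, ev j ≠ 1) :
    Submodule.span 𝕂 (Set.range fun p : Idx k m N × Idx k m N => unit hev p.1 p.2) = ⊤ := by
  set S := Submodule.span 𝕂 (Set.range fun p : Idx k m N × Idx k m N => unit hev p.1 p.2)
  have hS : ∀ a b, unit hev a b ∈ S := fun a b => Submodule.subset_span ⟨(a, b), rfl⟩
  refine eq_top_iff.2 fun x _ => ?_
  have hx : ∀ i, ∃ y ∈ S, (∀ s t, entryₗ s t y = 0) ∧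
      ∀ l, coeffₗ l y = if l = i then coeffₗ i x else 0 := by
    intro i
    have hmem := mem_span_of_gammaPoly_eq (isHomogeneous_of_mem_h₁ x.2 i)
      ((gammaPoly_derivation_iff _).1 x.1.2.2 i)
    change coeffₗ i x ∈ _ at hmem
    generalize coeffₗ i x = f at hmem ⊢
    induction hmem using Submodule.span_induction with
    | mem f hf =>
      obtain ⟨j, hj, rfl⟩ := hf
      have hb : block ev (varIdx j : Idx k m N) = block ev (varIdx i : Idx k m N) := by
        obtain ⟨c, hc, hc'⟩ := block_varIdx (N := N) (ev := ev) i
        obtain ⟨d, hd, hd'⟩ := block_varIdx (N := N) (ev := ev) j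
        rw [hc, hd, Units.ext (hd'.trans (hj.trans hc'.symm))]
      refine ⟨_, hS (varIdx j) (varIdx i), fun s t => ?_, fun l => ?_⟩
      · rw [entryₗ_unit hev hb, if_neg fun h => varIdx_ne_matIdx j s h.1]
      · rw [coeffₗ_unit hev hb, coord_varIdx]
        simp only [varIdx_injective.eq_iff]
    | zero => exact ⟨0, S.zero_mem, fun s t => map_zero _, fun l => by simp⟩
    | add f f' _ _ hf hf' =>
      obtain ⟨y, hy, h1, h2⟩ := hf
      obtain ⟨y', hy', h1', h2'⟩ := hf'
      refine ⟨y + y', S.add_mem hy hy', fun s t => by rw [map_add, h1, h1', add_zero], fun l => ?_⟩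
      rw [map_add, h2, h2']
      split_ifs
      · rfl
      · exact add_zero 0
    | smul c f _ hf =>
      obtain ⟨y, hy, h1, h2⟩ := hf
      refine ⟨c • y, S.smul_mem c hy, fun s t => by rw [map_smul, h1, smul_zero], fun l => ?_⟩
      rw [map_smul, h2, smul_ite, smul_zero]
  choose y hyS hyl hyr using hx
  choose c hc using x.2.1
  have hmat : ∀ s t, block ev (matIdx s : Idx k m N) = block ev (matIdx t : Idx k m N) :=
    fun _ _ => rfl
  have e : x = ∑ i, y i + ∑ s, ∑ t, c s t • unit hev (matIdx s) (matIdx t) := by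
    refine h₁_ext (fun s t => ?_) fun i => ?_
    · have e' : entryₗ s t x = C (c s t) := hc s t
      simp only [map_add, map_sum, map_smul, hyl, entryₗ_unit hev (hmat _ _), e', Sum.inr.injEq,
        ite_and, smul_ite, smul_zero, Finset.sum_const_zero, zero_add, smul_eq_C_mul, mul_one]
      simp
    · simp only [map_add, map_sum, map_smul, hyr, coeffₗ_unit hev (hmat _ _),
        if_neg (varIdx_ne_matIdx _ _), smul_zero, Finset.sum_const_zero, add_zero]
      simp
  rw [e]
  exact S.add_mem (S.sum_mem fun i _ => hyS i) (S.sum_mem fun s _ => S.sum_mem fun t _ =>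
    S.smul_mem _ (hS _ _))

/-! ### The test families -/

variable (m N ev) in
/-- The vector field `∂/∂q_i`. -/
def partialQ (i : Fin k) : Wγ k N ev :=
  ⟨⟨0, pderiv (Sum.inl i)⟩, fun s t => map_zero _, (gammaPoly_derivation_iff _).2 fun j => by
    rcases eq_or_ne j (Sum.inl i) with rfl | h
    · rw [pderiv_X_self, map_one, weight, Sum.elim_inl, one_smul]
    · rw [pderiv_X_of_ne h, map_zero, smul_zero]⟩

theorem partialQ_left (i : Fin k) (s t : Fin N) :
    (partialQ m N ev i : W 𝕂 k m N).left s t = 0 := rfl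

theorem partialQ_right (i : Fin k) : (partialQ m N ev i : W 𝕂 k m N).right = pderiv (Sum.inl i) :=
  rfl

/-- The sum of the diagonal matrix units of a set of indices. -/
def diagSum (hev : ∀ j, ev j ≠ 1) (S : Finset (Idx k m N)) : h₁ k N ev := ∑ d ∈ S, unit hev d d

theorem diagSum_left (hev : ∀ j, ev j ≠ 1) (S : Finset (Idx k m N)) (s t : Fin N) :
    ((diagSum hev S : Wγ k N ev) : W 𝕂 k m N).left s t =
      C (if s = t ∧ matIdx s ∈ S then 1 else 0) := by
  have e : ((diagSum hev S : Wγ k N ev) : W 𝕂 k m N).left s t = entryₗ s t (diagSum hev S) := rfl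
  rw [e, diagSum, map_sum, Finset.sum_congr rfl fun d _ => entryₗ_unit hev rfl s t]
  split_ifs with h
  · rw [Finset.sum_eq_single_of_mem _ h.2, if_pos ⟨rfl, by rw [h.1]⟩, map_one]
    exact fun d _ hd => if_neg fun h => hd h.1
  · rw [map_zero]
    refine Finset.sum_eq_zero fun d hd => if_neg ?_
    rintro ⟨rfl, h'⟩
    simp only [Sum.inr.injEq] at h'
    exact h ⟨h', hd⟩

theorem diagSum_right (hev : ∀ j, ev j ≠ 1) (S : Finset (Idx k m N)) (i : Fin k ⊕ Fin m) :
    ((diagSum hev S : Wγ k N ev) : W 𝕂 k m N).right (X i) =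
      (if varIdx i ∈ S then 1 else 0 : 𝕂) • X i := by
  have e : ((diagSum hev S : Wγ k N ev) : W 𝕂 k m N).right (X i) = coeffₗ i (diagSum hev S) := rfl
  rw [e, diagSum, map_sum, Finset.sum_congr rfl fun d _ => coeffₗ_unit hev rfl i,
    Finset.sum_ite_eq, coord_varIdx, ite_smul, one_smul, zero_smul]

/-- The product of `q_i` and `diagSum hev S`. -/
def mulDiagSum (hev : ∀ j, ev j ≠ 1) (i : Fin k) (S : Finset (Idx k m N)) : Wγ k N ev :=
  ⟨⟨qVar 𝕂 m i • ((diagSum hev S : Wγ k N ev) : W 𝕂 k m N).left,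
      qVar 𝕂 m i • ((diagSum hev S : Wγ k N ev) : W 𝕂 k m N).right⟩, by
    have hq : gammaPoly k ev (qVar 𝕂 m i) = qVar 𝕂 m i := by
      rw [gammaPoly_X, weight, Sum.elim_inl, one_smul]
    refine ⟨fun s t => ?_, fun f => ?_⟩
    · simp only [Matrix.smul_apply, smul_eq_mul, map_mul, hq]
      rw [(diagSum hev S).1.2.1]
    · simp only [Derivation.coe_smul, Pi.smul_apply, smul_eq_mul, map_mul, hq]
      rw [(diagSum hev S).1.2.2]⟩

theorem mulDiagSum_left (hev : ∀ j, ev j ≠ 1) (i : Fin k) (S : Finset (Idx k m N)) (s t : Fin N) :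
    (mulDiagSum hev i S : W 𝕂 k m N).left s t =
      (if s = t ∧ matIdx s ∈ S then 1 else 0 : 𝕂) • X (Sum.inl i) := by
  have e : (mulDiagSum hev i S : W 𝕂 k m N).left s t =
    X (Sum.inl i) * ((diagSum hev S : Wγ k N ev) : W 𝕂 k m N).left s t := rfl
  rw [e, diagSum_left, mul_comm, smul_eq_C_mul]

theorem mulDiagSum_right (hev : ∀ j, ev j ≠ 1) (i : Fin k) (S : Finset (Idx k m N))
    (l : Fin k ⊕ Fin m) : (mulDiagSum hev i S : W 𝕂 k m N).right (X l) =
      (if varIdx l ∈ S then 1 else 0 : 𝕂) • (X (Sum.inl i) * X l) := by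
  have e : (mulDiagSum hev i S : W 𝕂 k m N).right (X l) =
    X (Sum.inl i) * ((diagSum hev S : Wγ k N ev) : W 𝕂 k m N).right (X l) := rfl
  rw [e, diagSum_right, mul_smul_comm]

theorem lie_partialQ (i j : Fin k) : ⁅partialQ m N ev i, partialQ m N ev j⁆ = 0 := by
  have h : ∀ (i j : Fin k) (l : Fin k ⊕ Fin m),
      pderiv (R := 𝕂) (Sum.inl i) (pderiv (Sum.inl j) (X l)) = 0 := by
    intro i j l
    rcases eq_or_ne l (Sum.inl j) with rfl | h
    · rw [pderiv_X_self, pderiv_one]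
    · rw [pderiv_X_of_ne h, map_zero]
  refine Wγ_ext (fun s t => ?_) fun l => ?_
  · rw [LieSubalgebra.coe_bracket, lie_left_apply]
    simp [partialQ_left]
  · rw [LieSubalgebra.coe_bracket, lie_right_apply, partialQ_right, partialQ_right, h, h, sub_zero]
    rfl

theorem lie_partialQ_mulDiagSum (hev : ∀ j, ev j ≠ 1) (i j : Fin k) (S : Finset (Idx k m N)) :
    ⁅partialQ m N ev i, mulDiagSum hev j S⁆ = (((if i = j then diagSum hev S else 0) +
      if Sum.inl i ∈ S then unit hev (Sum.inl j) (Sum.inl i) else 0 : h₁ k N ev) : Wγ k N ev) := by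
  have hb : block ev (Sum.inl j : Idx k m N) = block ev (Sum.inl i : Idx k m N) := rfl
  refine Wγ_ext (fun s t => ?_) fun l => ?_
  · have hE : ∀ y : h₁ k N ev, ((y : Wγ k N ev) : W 𝕂 k m N).left s t = entryₗ s t y :=
      fun _ => rfl
    have hz : entryₗ s t (unit hev (Sum.inl j) (Sum.inl i)) = 0 := by
      rw [entryₗ_unit hev hb, if_neg fun h => Sum.inl_ne_inr h.1]
    rw [hE, map_add, apply_ite (entryₗ s t), apply_ite (entryₗ s t), hz, map_zero, ite_self,
      add_zero, LieSubalgebra.coe_bracket,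
      lie_left_apply]
    have e : entryₗ s t (diagSum hev S) = _ := diagSum_left hev S s t
    simp only [partialQ_left, zero_mul, mul_zero, Finset.sum_const_zero, sub_zero, zero_add,
      map_zero, mulDiagSum_left, partialQ_right, Derivation.map_smul, pderiv_X, e, Pi.single_apply,
      Sum.inl.injEq, eq_comm (a := j)]
    split_ifs <;> simp
  · have hE : ∀ y : h₁ k N ev, ((y : Wγ k N ev) : W 𝕂 k m N).right (X l) = coeffₗ l y :=
      fun _ => rfl
    rw [hE, map_add, apply_ite (coeffₗ l), apply_ite (coeffₗ l), coeffₗ_unit hev hb, map_zero,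
      LieSubalgebra.coe_bracket, lie_right_apply, mulDiagSum_right, partialQ_right]
    have e : coeffₗ l (diagSum hev S) = _ := diagSum_right hev S l
    have hc : coord 𝕂 (Sum.inl j : Idx k m N) = X (Sum.inl j) := rfl
    have h0 : (mulDiagSum hev j S : W 𝕂 k m N).right (pderiv (Sum.inl i) (X l)) = 0 := by
      rw [pderiv_X, Pi.single_apply]
      split_ifs
      · exact Derivation.map_one_eq_zero _
      · exact map_zero _
    have hv : (varIdx l = (Sum.inl i : Idx k m N)) ↔ l = Sum.inl i :=
      varIdx_injective.eq_iff (b := Sum.inl i)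
    rw [h0, sub_zero, Derivation.map_smul, Derivation.leibniz, pderiv_X, pderiv_X, e, hc]
    simp only [hv, Pi.single_apply, Sum.inl.injEq, eq_comm (a := j), smul_eq_mul]
    rcases eq_or_ne l (Sum.inl i) with rfl | hl
    · have hvi : varIdx (Sum.inl i) = (Sum.inl i : Idx k m N) := rfl
      rw [hvi]
      split_ifs <;> simp [add_comm]
    · split_ifs <;> simp_all

/-- If neither element differentiates the factor of the other, they commute because diagonal matrix
units do. If both do and `S = T`, the terms with the derivatives of the two factors cancel. -/
theorem lie_mulDiagSum (hev : ∀ j, ev j ≠ 1) (i j : Fin k) (S T : Finset (Idx k m N))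
    (h : (Sum.inl j ∈ S ∧ Sum.inl i ∈ T ∧ S = T) ∨ (Sum.inl j ∉ S ∧ Sum.inl i ∉ T)) :
    ⁅mulDiagSum hev i S, mulDiagSum hev j T⁆ = 0 := by
  have hj : (mulDiagSum hev i S : W 𝕂 k m N).right (X (Sum.inl j)) =
      (if Sum.inl j ∈ S then 1 else 0 : 𝕂) • (X (Sum.inl i) * X (Sum.inl j)) :=
    mulDiagSum_right hev i S (Sum.inl j)
  have hi : (mulDiagSum hev j T : W 𝕂 k m N).right (X (Sum.inl i)) =
      (if Sum.inl i ∈ T then 1 else 0 : 𝕂) • (X (Sum.inl j) * X (Sum.inl i)) :=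
    mulDiagSum_right hev j T (Sum.inl i)
  refine Wγ_ext (fun s t => ?_) fun l => ?_
  · have hprod : ∀ (i j : Fin k) (S T : Finset (Idx k m N)),
        ∑ l, (mulDiagSum hev i S : W 𝕂 k m N).left s l * (mulDiagSum hev j T : W 𝕂 k m N).left l t =
          (if s = t ∧ matIdx s ∈ S ∧ matIdx s ∈ T then 1 else 0 : 𝕂) •
            (X (Sum.inl i) * X (Sum.inl j)) := by
      intro i j S T
      rw [Finset.sum_eq_single s]
      · rw [mulDiagSum_left, mulDiagSum_left, smul_mul_smul_comm]
        congr 1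
        by_cases hst : s = t
        · subst hst
          by_cases hS : matIdx s ∈ S <;> by_cases hT : matIdx s ∈ T <;> simp [hS, hT]
        · simp [hst]
      · intro l _ hl
        rw [mulDiagSum_left, if_neg fun h => hl h.1.symm, zero_smul, zero_mul]
      · exact fun h => absurd (Finset.mem_univ s) h
    have hcomm := (hprod j i T S).trans (c :=
        (if s = t ∧ matIdx s ∈ S ∧ matIdx s ∈ T then 1 else 0 : 𝕂) •
          (X (Sum.inl i) * X (Sum.inl j))) (by
      rw [mul_comm]
      congr 1
      exact if_congr (by tauto) rfl rfl)
    rw [LieSubalgebra.coe_bracket, lie_left_apply, hprod, hcomm, mulDiagSum_left, mulDiagSum_left,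
      Derivation.map_smul, Derivation.map_smul, hj, hi, sub_self, zero_add,
      mul_comm (X (Sum.inl j))]
    rcases h with ⟨h1, h2, rfl⟩ | ⟨h1, h2⟩
    · rw [if_pos h1, if_pos h2, sub_self]; rfl
    · rw [if_neg h1, if_neg h2, zero_smul, smul_zero, smul_zero, sub_self]; rfl
  · rw [LieSubalgebra.coe_bracket, lie_right_apply, mulDiagSum_right, mulDiagSum_right,
      Derivation.map_smul, Derivation.map_smul, Derivation.leibniz, Derivation.leibniz, hj, hi,
      mulDiagSum_right, mulDiagSum_right]
    have h0 : ((0 : Wγ k N ev) : W 𝕂 k m N).right (X l) = 0 := rfl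
    rw [h0]
    simp only [smul_eq_mul, MvPolynomial.smul_eq_C_mul]
    rcases h with ⟨h1, h2, rfl⟩ | ⟨h1, h2⟩
    · rw [if_pos h1, if_pos h2]
      ring
    · rw [if_neg h1, if_neg h2, map_zero]
      ring

theorem degreeZero_eq_zero (hev : ∀ j, ev j ≠ 1) {x : Wγ k N ev} {p r : ℕ} (hp : p ≠ 0)
    (hr : r ≠ 1) (hl : ∀ s t, ((x : W 𝕂 k m N).left s t).IsHomogeneous p)
    (hx : ∀ i, ((x : W 𝕂 k m N).right (X i)).IsHomogeneous r) : degreeZero hev x = 0 := by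
  refine Subtype.ext (Wγ_ext (fun s t => ?_) fun i => ?_)
  · rw [coe_degreeZero, coe_scaleγ, scale_left, degScale_of_isHomogeneous _ (hl s t),
      Pi.single_eq_of_ne hp, zero_smul]
    rfl
  · rw [coe_degreeZero, coe_scaleγ, scale_right, degScale_of_isHomogeneous _ (hx i),
      Pi.single_eq_of_ne hr, zero_smul]
    rfl

theorem degreeZero_partialQ (hev : ∀ j, ev j ≠ 1) (i : Fin k) :
    degreeZero hev (partialQ m N ev i) = 0 := by
  refine degreeZero_eq_zero hev one_ne_zero zero_ne_one (fun s t => isHomogeneous_zero _ _ _)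
    fun l => ?_
  rw [partialQ_right, pderiv_X, Pi.single_apply]
  split_ifs
  · exact isHomogeneous_one _ _
  · exact isHomogeneous_zero _ _ _

theorem degreeZero_mulDiagSum (hev : ∀ j, ev j ≠ 1) (i : Fin k) (S : Finset (Idx k m N)) :
    degreeZero hev (mulDiagSum hev i S) = 0 := by
  refine degreeZero_eq_zero hev one_ne_zero (by norm_num : 2 ≠ 1) (fun s t => ?_) fun l => ?_
  · rw [mulDiagSum_left]
    exact (homogeneousSubmodule _ 𝕂 1).smul_mem _ (isHomogeneous_X 𝕂 _)
  · rw [mulDiagSum_right]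
    exact (homogeneousSubmodule _ 𝕂 2).smul_mem _ ((isHomogeneous_X 𝕂 _).mul (isHomogeneous_X 𝕂 _))

/-! ### Injectivity -/

open GlPoly RelLie

/-- A form `P` whose Chern--Weil form is a coboundary vanishes: the associated functional on
polynomials in the matrix units is invariant and kills the test determinants. -/
theorem eq_zero_of_chernWeilAlt_mem_relCoboundary [CharZero 𝕂] (hev : ∀ j, ev j ≠ 1) {q : ℕ}
    (hq : q ≤ k) {P : MultilinearMap 𝕂 (fun _ : Fin q => h₁ k N ev) 𝕂}
    (hP : P ∈ invPoly (h₁ k N ev) q)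
    (hω : chernWeilAlt (degreeZero hev) q P ∈ relCoboundary (h₁ k N ev) (2 * q)) : P = 0 := by
  set b : Idx k m N × Idx k m N → h₁ k N ev := fun p => unit hev p.1 p.2 with hb
  have hX : ∀ c d, (X (c, d), unit hev c d) ∈ formPairs 𝕂 b := fun c d =>
    Submodule.subset_span ⟨(c, d), rfl⟩
  have hite : ∀ (p : Prop) [Decidable p] (l : MvPolynomial (Idx k m N × Idx k m N) 𝕂)
      (x : h₁ k N ev), (l, x) ∈ formPairs 𝕂 b →
      ((if p then l else 0), (if p then x else 0)) ∈ formPairs 𝕂 b := by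
    intro p _ l x h
    split_ifs
    · exact h
    · exact Submodule.zero_mem _
  refine eq_zero_of_polarFunctional_eq_zero hP.1 (span_unit hev) ?_
  refine eq_zero_of_test (q := q) (polarFunctional P b) (fun a b => block ev a = block ev b)
    (fun _ _ => rfl) ?_ ?_ ?_ (by rwa [Fintype.card_fin]) ?_
  · intro a c _ hac f
    refine polarFunctional_derivation hP.1 _ (fun x => ⁅unit hev a c, x⁆) (fun j => ?_)
      (hP.2 (unit hev a c)) f
    obtain ⟨c', d'⟩ := j
    rw [adDer_X, hb, lie_unit hev hac]
    exact Submodule.sub_mem _ (hite _ _ _ (hX _ _)) (hite _ _ _ (hX _ _))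
  · intro a c _ hac f
    exact polarFunctional_X_mul_of_eq_zero hP.1 (b := b) (j := (a, c)) (unit_of_ne hev hac) f
  · intro s hs
    exact polarFunctional_of_isHomogeneous (isHomogeneous_monomial 1 rfl).rename_isHomogeneous hs
  · intro w κ hκ
    set μ : Fin q → Fin q → h₁ k N ev := fun a c =>
      (if a = c then diagSum hev (testSupp w κ c) else 0) +
        if Sum.inl (κ a) ∈ testSupp w κ c then unit hev (Sum.inl (κ c)) (Sum.inl (κ a)) else 0
    have hμ : ∀ a c, (testMatrix 𝕂 w κ a c, μ a c) ∈ formPairs 𝕂 b := by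
      intro a c
      rw [testMatrix, Matrix.of_apply]
      refine Submodule.add_mem (formPairs 𝕂 b) (x := (_, _)) (y := (_, _)) ?_
        (hite _ _ _ (hX _ _))
      refine hite _ _ _ ?_
      have e : (∑ d ∈ testSupp w κ c, X (d, d), diagSum hev (testSupp w κ c)) =
          ∑ d ∈ testSupp w κ c, ((X (d, d) : MvPolynomial (Idx k m N × Idx k m N) 𝕂),
            unit hev d d) := by
        rw [Prod.ext_iff, Prod.fst_sum, Prod.snd_sum]
        exact ⟨rfl, rfl⟩
      rw [e]
      exact Submodule.sum_mem _ fun d _ => hX d d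
    rw [polarFunctional_det hP.1 hμ]
    refine sum_sign_eq_zero_of_mem_relCoboundary (isInvariantProjection_degreeZero hev) hP.1 hω
      (fun a => partialQ m N ev (κ a)) (fun a => mulDiagSum hev (κ a) (testSupp w κ a)) μ
      (fun a => degreeZero_partialQ hev _) (fun a => degreeZero_mulDiagSum hev _ _)
      (fun a c => lie_partialQ _ _) (fun a c => lie_mulDiagSum hev _ _ _ _ ?_)
      (fun a c => (lie_partialQ_mulDiagSum hev _ _ _).trans (by simp only [hκ.eq_iff]; rfl))
    rw [inl_mem_testSupp hκ, inl_mem_testSupp hκ]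
    by_cases h : (w a).isLeft ∧ w c = w a
    · exact Or.inl ⟨h, ⟨h.2 ▸ h.1, h.2.symm⟩, by rw [testSupp, testSupp, h.2]⟩
    · exact Or.inr ⟨h, fun h' => h ⟨h'.2 ▸ h'.1, h'.2.symm⟩⟩

end WGamma

end

theorem proposition4p2 {𝕂 : Type*} [Field 𝕂] [CharZero 𝕂] (k m N q : ℕ) (ev : Fin m → 𝕂ˣ)
    (hev : ∀ j, ev j ≠ 1) (hq : q ≤ k) :
    (∃ pr : WGamma.Wγ k N ev →ₗ[𝕂] WGamma.h₁ k N ev, RelLie.IsInvariantProjection pr) ∧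
    ∃ χ : RelLie.invPoly (WGamma.h₁ k N ev) q →ₗ[𝕂]
        RelLie.relCohomology (WGamma.h₁ k N ev) (2 * q),
      RelLie.IsChernWeilHom (WGamma.h₁ k N ev) q χ ∧ Function.Injective χ := by
  have hpr := WGamma.isInvariantProjection_degreeZero (k := k) (N := N) hev
  let ω : RelLie.invPoly (WGamma.h₁ k N ev) q →ₗ[𝕂]
      RelLie.relCocycle (WGamma.h₁ k N ev) (2 * q) :=
    LinearMap.codRestrict _ ((RelLie.chernWeilAlt (WGamma.degreeZero hev) q).comp
      (RelLie.invPoly (WGamma.h₁ k N ev) q).subtype) fun P =>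
        ⟨RelLie.chernWeilAlt_mem_relCochain hpr P.2, RelLie.ceDiff_chernWeilAlt _ P.2⟩
  refine ⟨⟨_, hpr⟩, (RelLie.cohomologyClass (WGamma.h₁ k N ev) (2 * q)).comp ω, ?_, ?_⟩
  · intro pr hpr' P
    refine ⟨ω P, fun v => ?_, rfl⟩
    rw [WGamma.eq_degreeZero hev hpr', RelLie.chernWeilForm_eq_chernWeilAlt]
    rfl
  · rw [injective_iff_map_eq_zero]
    intro P hP
    have hω : RelLie.chernWeilAlt (WGamma.degreeZero hev) q P.1 ∈
        RelLie.relCoboundary (WGamma.h₁ k N ev) (2 * q) :=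
      (Submodule.Quotient.mk_eq_zero _).1 (congrArg Subtype.val hP)
    exact Subtype.ext (WGamma.eq_zero_of_chernWeilAlt_mem_relCoboundary hev hq P.2 hω)
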